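/- Let $X$, $U$, $Y$ be complex Hilbert spaces, let $A_0:\operatorname{dom}A_0\subset X\to X$ be skew-adjoint, let $D\in\mathcal L(U,X)$, and let $A=A_0-DD^*$ with $\operatorname{dom}A=\operatorname{dom}A_0$. Write $R(\lambda,A)=(\lambda-A)^{-1}$ for $\lambda\in\rho(A)$, and let $P_{(a,b)}$ denote the spectral projection of $A_0$ corresponding to the interval $(ia,ib)\subset i\mathbb R$. Assume that there are $\eta_0,\delta_0>0$ and functions $\eta:\mathbb R\to(0,\eta_0]$, $\delta:\mathbb R\to(0,\delta_0]$ such that $$\|D^*x\|\ge\eta(s)\|x\|\qquad\text{for all } s\in\mathbb R,\ x\in\operatorname{ran}P_{(s-\delta(s),s+\delta(s))}.$$ (a) Then for every $s\in\mathbb R$ we have $is\in\rho(A)$ and $$\|R(is,A)\|\le\frac{M_R}{\eta(s)^2\delta(s)^2},\qquad M_R=2\sqrt{\eta_0^4\delta_0^2+2\eta_0^2\delta_0^2\|D\|^2+\bigl(\delta_0^2+\eta_0^2\|D\|^2+2\|D\|^4\bigr)^2}.$$ (b) Suppose in addition that $\alpha>0$, $M_0>0$ and $\eta(s)^{-2}\delta(s)^{-2}\le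 M_0(1+|s|^\alpha)$ for all $s\in\mathbb R$. Let $\beta,\gamma\ge0$ with $\beta+\gamma=\lceil\alpha\rceil$, let $s_0>0$ be arbitrary, put $$M_C=\max\Bigl\{M_RM_0\|A^{-1}\|^{\lceil\alpha\rceil}(1+s_0^\alpha),\ \frac{M_RM_0(1+s_0^\alpha)}{s_0^{\lceil\alpha\rceil}}+\sum_{k=1}^{\lceil\alpha\rceil}\frac{\|A^{-1}\|^k}{s_0^{\lceil\alpha\rceil+1-k}}\Bigr\},$$ and let $0<\kappa<1/\sqrt{2M_C}$. Then $\mathbb C_+=\{\operatorname{Re}\lambda>0\}\subset\rho(A)$ and $$\kappa<\frac1{\sup_{\lambda\in\mathbb C_+}\|R(\lambda,A)(-A)^{-\beta-\gamma}\|^{1/2}}$$ (where $1/0=\infty$). Moreover, if $B\in\mathcal L(Y,X)$ and $C\in\mathcal L(X,Y)$ satisfy $\operatorname{ran}B\subset\operatorname{dom}(-A)^\beta$ and $\operatorname{ran}C^*\subset\operatorname{dom}(-A^*)^\gamma$, if $(-A)^\beta B$ and $(-A^*)^\gamma C^*$ are Hilbert--Schmidt operators, and if $\|(-A)^\beta B\|<\kappa$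 and $\|(-A^*)^\gamma C^*\|<\kappa$, then $A+BC$ generates a strongly continuous semigroup $T(t)$ on $X$ that is polynomially stable with the same $\alpha$, that is, $\sup_{t\ge0}\|T(t)\|<\infty$, $i\mathbb R\subset\rho(A+BC)$, and there is $M>0$ with $\|T(t)(A+BC)^{-1}\|\le M\,t^{-1/\alpha}$ for all $t>0$. -/

import Mathlib

open Filter Topology Set
open scoped InnerProductSpace

noncomputable section

namespace PolyStab

/-! ### Unbounded operators, resolvents, semigroups -/

section Basic

variable {X : Type*} [NormedAddCommGroup X] [NormedSpace ℂ X]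

/-- `R` is the (bounded, everywhere defined, two-sided) inverse of `z - A : dom A → X`. -/
def IsResolventAt (A : X →ₗ.[ℂ] X) (z : ℂ) (R : X →L[ℂ] X) : Prop :=
  (∀ y : X, ∃ h : R y ∈ A.domain, z • R y - A ⟨R y, h⟩ = y) ∧
    ∀ x : A.domain, R (z • (x : X) - A x) = x

/-- The resolvent set `ρ(A)`. -/
def rho (A : X →ₗ.[ℂ] X) : Set ℂ := {z | ∃ R : X →L[ℂ] X, IsResolventAt A z R}

open Classical in
/-- The resolvent operator `R(z, A) = (z - A)⁻¹` for `z ∈ ρ(A)` (and `0` otherwise). -/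
def resolventOp (A : X →ₗ.[ℂ] X) (z : ℂ) : X →L[ℂ] X :=
  if h : ∃ R : X →L[ℂ] X, IsResolventAt A z R then h.choose else 0

/-- The bounded inverse `A⁻¹ = -R(0, A)` of an operator with `0 ∈ ρ(A)`. -/
def invOp (A : X →ₗ.[ℂ] X) : X →L[ℂ] X := -resolventOp A 0

/-- The sum `A + K` with a bounded operator `K`, on the domain of `A`. -/
def addBounded (A : X →ₗ.[ℂ] X) (K : X →L[ℂ] X) : X →ₗ.[ℂ] X :=
  (K : X →ₗ[ℂ] X) +ᵥ A

/-- Strongly continuous one-parameter semigroups `T(t)`, `t ≥ 0`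
(the values at `t < 0` are irrelevant). -/
structure IsC0Semigroup (T : ℝ → X →L[ℂ] X) : Prop where
  map_zero : T 0 = 1
  map_add : ∀ s t : ℝ, 0 ≤ s → 0 ≤ t → T (s + t) = T s * T t
  strong_cont : ∀ x : X, Tendsto (fun t => T t x) (𝓝[>] 0) (𝓝 x)

/-- `A` is the infinitesimal generator of `T`: one has `x ∈ dom A` and `A x = y`
iff `(T(t)x - x)/t → y` as `t → 0+`. -/
def IsGenerator (A : X →ₗ.[ℂ] X) (T : ℝ → X →L[ℂ] X) : Prop :=
  ∀ x y : X, (∃ h : x ∈ A.domain, A ⟨x, h⟩ = y) ↔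
    Tendsto (fun t : ℝ => ((t⁻¹ : ℝ) : ℂ) • (T t x - x)) (𝓝[>] 0) (𝓝 y)

/-- Polynomial stability with exponent `α` of a semigroup `T` with generator `A`:
`T` is uniformly bounded, `iℝ ⊆ ρ(A)`, and `‖T(t)A⁻¹‖ ≤ M / t ^ (1/α)` for all `t > 0`. -/
def IsPolynomiallyStable (A : X →ₗ.[ℂ] X) (T : ℝ → X →L[ℂ] X) (α : ℝ) : Prop :=
  (∃ K : ℝ, ∀ t : ℝ, 0 ≤ t → ‖T t‖ ≤ K) ∧
    (∀ s : ℝ, Complex.I * (s : ℂ) ∈ rho A) ∧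
    ∃ M : ℝ, 0 < M ∧ ∀ t : ℝ, 0 < t → ‖T t ∘L invOp A‖ ≤ M / t ^ (1 / α)

/-! ### Fractional powers -/

open Classical in
/-- The bounded operator `(-A)^(-β)`, `β ≥ 0`, for `A` with `[0, ∞) ⊆ ρ(A)` and
`‖R(t, A)‖ = O(1 / t)`.  For `0 < θ < 1`,
`(-A)^(-θ) = (sin (π θ) / π) ∫_0^∞ t^(-θ) (t - A)⁻¹ dt` (Balakrishnan's formula), and
`(-A)^(-(k + θ)) = (-A)^(-k) (-A)^(-θ)`, where `(-A)⁻¹ = R(0, A)`. -/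
def negFracPow (A : X →ₗ.[ℂ] X) (β : ℝ) : X →L[ℂ] X :=
  resolventOp A 0 ^ ⌊β⌋₊ *
    (if Int.fract β = 0 then 1 else
      ((Real.sin (Real.pi * Int.fract β) / Real.pi : ℝ) : ℂ) •
        ∫ t in Ioi (0 : ℝ), ((t ^ (-Int.fract β) : ℝ) : ℂ) • resolventOp A (t : ℂ))

/-- The fractional power `(-A)^β`, `β ≥ 0`: the inverse of the injective operator `(-A)^(-β)`,
with domain `ran (-A)^(-β)`. -/
def fracPow (A : X →ₗ.[ℂ] X) (β : ℝ) : X →ₗ.[ℂ] X :=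
  ((negFracPow A β : X →ₗ[ℂ] X).toPMap ⊤).inverse

/-- `ran B ⊆ dom S`, and `B'` is the operator `S B`. -/
def IsCompOf {Y : Type*} [NormedAddCommGroup Y] [NormedSpace ℂ Y]
    (S : X →ₗ.[ℂ] X) (B B' : Y →L[ℂ] X) : Prop :=
  ∀ y : Y, ∃ h : B y ∈ S.domain, S ⟨B y, h⟩ = B' y

end Basic

/-! ### Hilbert space notions -/

section Hilbert

variable {X : Type*} [NormedAddCommGroup X] [InnerProductSpace ℂ X]

/-- Hilbert--Schmidt operators: `∑ ‖K e_i‖² < ∞` for an orthonormal basis `(e_i)` of `Y`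
(the sum does not depend on the basis). -/
def IsHilbertSchmidt {Y : Type*} [NormedAddCommGroup Y] [InnerProductSpace ℂ Y]
    (K : Y →L[ℂ] X) : Prop :=
  ∃ (w : Set Y) (b : HilbertBasis w ℂ Y), Summable fun i => ‖K (b i)‖ ^ 2

variable [CompleteSpace X]

/-- Skew-adjointness of a densely defined operator: `A₀* = -A₀`, domains included. -/
def IsSkewAdjoint (A₀ : X →ₗ.[ℂ] X) : Prop :=
  Dense (A₀.domain : Set X) ∧ A₀.adjoint = -A₀

/-- For skew-adjoint `A₀` and continuous compactly supported `f : ℝ → ℂ`, the operator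
`f(-i A₀)`, obtained by applying the continuous functional calculus to the bounded normal operator
`R(1, A₀) = (1 - A₀)⁻¹`: the spectral point `iξ` of `A₀` corresponds to the spectral point
`z = (1 - iξ)⁻¹` of `R(1, A₀)`, so that `ξ = Im (1 - z⁻¹)`, and the point `z = 0` corresponds
to `ξ = ±∞`, where `f` vanishes. -/
def funcCalc (A₀ : X →ₗ.[ℂ] X) (f : ℝ → ℂ) : X →L[ℂ] X :=
  cfc (fun z : ℂ => if z = 0 then 0 else f (1 - z⁻¹).im) (resolventOp A₀ 1)

/-- The spectral subspace of the skew-adjoint operator `A₀` corresponding to the open interval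
`(ia, ib)` of the imaginary axis: the closed span of the ranges of the operators `f(-i A₀)`,
with `f` continuous and supported in `(a, b)`. -/
def spectralSubspace (A₀ : X →ₗ.[ℂ] X) (a b : ℝ) : Submodule ℂ X :=
  (⨆ f : {f : ℝ → ℂ // Continuous f ∧ tsupport f ⊆ Ioo a b},
    LinearMap.range (funcCalc A₀ f.1 : X →ₗ[ℂ] X)).topologicalClosure

/-- The spectral subspace is complete, being closed. -/
instance spectralSubspace_complete (A₀ : X →ₗ.[ℂ] X) (a b : ℝ) :
    CompleteSpace (spectralSubspace A₀ a b) :=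
  (Submodule.isClosed_topologicalClosure _).completeSpace_coe

/-- The spectral projection `P_(a,b) = 1_(a,b)(-i A₀)` of the skew-adjoint operator `A₀`
corresponding to `(ia, ib)`.  As `1_(a,b)` is the supremum of the continuous functions
`0 ≤ f ≤ 1` supported in `(a, b)`, it is the orthogonal projection onto `spectralSubspace`. -/
def spectralProj (A₀ : X →ₗ.[ℂ] X) (a b : ℝ) : X →L[ℂ] X :=
  (spectralSubspace A₀ a b).starProjection

/-- The operator `A₀ - D D*` on the domain of `A₀`. -/
def damped {U : Type*} [NormedAddCommGroup U] [InnerProductSpace ℂ U] [CompleteSpace U]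
    (A₀ : X →ₗ.[ℂ] X) (D : U →L[ℂ] X) : X →ₗ.[ℂ] X :=
  addBounded A₀ (-(D ∘L ContinuousLinearMap.adjoint D))

end Hilbert

/-! ### The explicit constants -/

/-- The constant `M_R`, where `d = ‖D‖`. -/
def constMR (η₀ δ₀ d : ℝ) : ℝ :=
  2 * Real.sqrt (η₀ ^ 4 * δ₀ ^ 2 + 2 * η₀ ^ 2 * δ₀ ^ 2 * d ^ 2 +
    (δ₀ ^ 2 + η₀ ^ 2 * d ^ 2 + 2 * d ^ 4) ^ 2)

/-- The constant `M_C`, where `a = ‖A⁻¹‖`. -/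
def constMC (MR M₀ a α s₀ : ℝ) : ℝ :=
  max (MR * M₀ * a ^ ⌈α⌉₊ * (1 + s₀ ^ α))
    (MR * M₀ * (1 + s₀ ^ α) / s₀ ^ ⌈α⌉₊ +
      ∑ k ∈ Finset.Icc 1 ⌈α⌉₊, a ^ k / s₀ ^ (⌈α⌉₊ + 1 - k))

end PolyStab

end

open Filter Topology Set
open scoped InnerProductSpace

set_option linter.unusedSectionVars false

noncomputable section

namespace PolyStab

/-! ### Resolvents of unbounded operators: identities, perturbation, continuity. -/

section Resolvent

variable {X : Type*} [NormedAddCommGroup X] [NormedSpace ℂ X] {A : X →ₗ.[ℂ] X} {z w : ℂ}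
  {R S K : X →L[ℂ] X}

/-! Part (a) is an energy estimate. For y = (z - A)x with Re z ≥ 0, skew-adjointness of A₀ gives
‖D*x‖² ≤ Re⟨x, y⟩ ≤ ‖x‖‖y‖. Split x = x₀ + x₁ by the spectral projection onto the window of radius δ
around Im z. On x₁ the operator z - A₀ is bounded below by δ (`IsSkewAdjoint.norm_sub_ge`), which
controls x₁ by y and D*x; on x₀ the hypothesis on D* controls x₀ by D*x and x₁. `le_constMR_mul`
assembles these inequalities into M_R. So z - A is bounded below up to the imaginary axis, and since
A is maximally dissipative its resolvent extends there (`IsSkewAdjoint.damped_resolvent`).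

For part (b) let n = ⌈α⌉. The resolvent identity trades each factor A⁻¹ for a factor 1/|z|, so R(z,
A)(-A)^(-n) is bounded by M_C on the closed half-plane (`norm_resolventOp_mul_pow_le_constMC`).
Write B = (-A)^(-β) B' and C = C'* (-A)^(-γ). Balakrishnan's powers multiply correctly when the
exponents add up to an integer (`negFracPow_mul_negFracPow`), hence C R(z, A) B = C'* R(z,
A)(-A)^(-n) B' has norm at most κ² M_C ≤ 1/2. Therefore 1 - CRB has an inverse Q with ‖Q‖ ≤ 2, and
R(z, A + BC) = R + RBQCR on the closed half-plane.

Existence of this resolvent does not bound the semigroup. Boundedness follows from a Hilbert space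
criterion: σ ∫ ‖R(σ + iξ)x‖² dξ ≤ const ‖x‖² for all σ > 0, both for the operator and for its
adjoint (`AdjointPair.exists_norm_le`). For A and A* this is Plancherel's theorem for contraction
semigroups. For A + BC, the moment inequality for fractional powers bounds RBQCRx by a multiple of
S(z)‖x‖ + ‖R(z)x‖, where S(z)² is a sum of terms ‖R(z)vᵢ‖² with ∑ ‖vᵢ‖² < ∞
(`norm_correction_apply_le`). Each term is integrable along vertical lines, and this is where the
Hilbert-Schmidt hypothesis enters.

The same estimate with S = ‖R‖‖B'‖ shows that R(z, A + BC) still grows at most like 1 + |Im z|^α.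
The decay rate then follows from the Borichev-Tomilov theorem (`AdjointPair.polynomial_decay`),
proved by splitting A⁻¹ with powers of the filter aR(a, A) at the threshold a = t^(1/α). -/

theorem apply_congr_of_eq (A : X →ₗ.[ℂ] X) {x y : X} (hx : x ∈ A.domain) (hy : y ∈ A.domain)
    (h : x = y) : A ⟨x, hx⟩ = A ⟨y, hy⟩ := by
  subst h; rfl

theorem IsResolventAt.mem_domain (h : IsResolventAt A z R) (y : X) : R y ∈ A.domain :=
  (h.1 y).1

theorem IsResolventAt.apply_eq (h : IsResolventAt A z R) (y : X) :
    A ⟨R y, h.mem_domain y⟩ = z • R y - y := by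
  obtain ⟨h1, h2⟩ := h.1 y
  rw [eq_sub_iff_add_eq, ← eq_sub_iff_add_eq', h2]

theorem IsResolventAt.left_inv (h : IsResolventAt A z R) (x : A.domain) :
    R (z • (x : X) - A x) = x := h.2 x

theorem IsResolventAt.map_apply (h : IsResolventAt A z R) (x : A.domain) :
    R (A x) = z • R x - x := by
  have := h.left_inv x
  rw [map_sub, map_smul] at this
  linear_combination (norm := module) -this

theorem IsResolventAt.injective (h : IsResolventAt A z R) : Function.Injective R := by
  rw [injective_iff_map_eq_zero]
  intro y hy
  have h1 := h.apply_eq y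
  have h2 : A ⟨R y, h.mem_domain y⟩ = 0 := by
    rw [apply_congr_of_eq A _ A.domain.zero_mem hy]
    exact A.map_zero
  rw [h2, hy] at h1
  simpa using h1.symm

theorem IsResolventAt.unique (h : IsResolventAt A z R) (h' : IsResolventAt A z S) : R = S := by
  ext y
  have := h.left_inv ⟨S y, h'.mem_domain y⟩
  rw [h'.apply_eq] at this
  simpa using this

theorem IsResolventAt.resolventOp_eq (h : IsResolventAt A z R) : resolventOp A z = R := by
  have hex : ∃ R : X →L[ℂ] X, IsResolventAt A z R := ⟨R, h⟩
  rw [resolventOp, dif_pos hex]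
  exact hex.choose_spec.unique h

theorem IsResolventAt.mem_rho (h : IsResolventAt A z R) : z ∈ rho A := ⟨R, h⟩

theorem isResolventAt_resolventOp (h : z ∈ rho A) : IsResolventAt A z (resolventOp A z) := by
  obtain ⟨R, hR⟩ := h
  rw [hR.resolventOp_eq]
  exact hR

/-- The resolvent identity. -/
theorem IsResolventAt.sub_eq (h : IsResolventAt A z R) (h' : IsResolventAt A w S) :
    R - S = (w - z) • (R * S) := by
  ext y
  have := h.left_inv ⟨S y, h'.mem_domain y⟩
  rw [h'.apply_eq] at this
  simp only [map_sub, map_smul] at this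
  change R y - S y = (w - z) • R (S y)
  linear_combination (norm := module) this

theorem IsResolventAt.commute (h : IsResolventAt A z R) (h' : IsResolventAt A w S) :
    Commute R S := by
  by_cases hzw : w = z
  · subst hzw
    rw [h.unique h']
  · have h1 := h.sub_eq h'
    have h2 := h'.sub_eq h
    have h3 : (w - z) • (R * S - S * R) = 0 := by
      rw [smul_sub, ← h1, ← neg_sub z w, neg_smul, ← h2]; abel
    rcases smul_eq_zero.1 h3 with h4 | h4
    · exact absurd (sub_eq_zero.1 h4) hzw
    · exact sub_eq_zero.1 h4

/-- The factorization z - A - K = (1 - KR)(z - A) reduces invertibility to that of the bounded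
operator 1 - KR; `IsResolventAt.shift` is the same argument with a scalar in place of K. -/
theorem IsResolventAt.addBounded (h : IsResolventAt A z R) (h1 : (1 - K * R) * S = 1)
    (h2 : S * (1 - K * R) = 1) : IsResolventAt (addBounded A K) z (R * S) := by
  refine ⟨fun y => ⟨h.mem_domain (S y), ?_⟩, fun x => ?_⟩
  · have h3 : S y - K (R (S y)) = y := by
      simpa using congrArg (fun T : X →L[ℂ] X => T y) h1
    change z • R (S y) - (K (R (S y)) + A ⟨R (S y), h.mem_domain (S y)⟩) = y
    rw [h.apply_eq]
    linear_combination (norm := module) h3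
  · have h3 : ∀ u, S (u - K (R u)) = u := fun u => by
      simpa using congrArg (fun T : X →L[ℂ] X => T u) h2
    change R (S (z • (x : X) - (K x + A x))) = x
    have h4 := h3 (z • (x : X) - A x)
    rw [h.left_inv x] at h4
    have h5 : z • (x : X) - (K x + A x) = z • (x : X) - A x - K x := by abel
    rw [h5, h4]
    exact h.left_inv x

theorem IsResolventAt.shift (h : IsResolventAt A z R) (h1 : (1 - (z - w) • R) * S = 1)
    (h2 : S * (1 - (z - w) • R) = 1) : IsResolventAt A w (R * S) := by
  refine ⟨fun y => ⟨h.mem_domain (S y), ?_⟩, fun x => ?_⟩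
  · have h3 : S y - (z - w) • R (S y) = y := by
      simpa using congrArg (fun T : X →L[ℂ] X => T y) h1
    change w • R (S y) - A ⟨R (S y), h.mem_domain (S y)⟩ = y
    rw [h.apply_eq]
    linear_combination (norm := module) h3
  · have h3 : ∀ u, S (u - (z - w) • R u) = u := fun u => by
      simpa using congrArg (fun T : X →L[ℂ] X => T u) h2
    change R (S (w • (x : X) - A x)) = x
    have h4 := h3 (z • (x : X) - A x)
    rw [h.left_inv x] at h4
    have h5 : w • (x : X) - A x = z • (x : X) - A x - (z - w) • (x : X) := by
      rw [sub_smul]; abel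
    rw [h5, h4]
    exact h.left_inv x

theorem IsResolventAt.norm_le (h : IsResolventAt A z R) {c : ℝ} (hc : 0 < c)
    (hb : ∀ x : A.domain, c * ‖(x : X)‖ ≤ ‖z • (x : X) - A x‖) : ‖R‖ ≤ 1 / c := by
  refine R.opNorm_le_bound (by positivity) fun y => ?_
  have h1 := hb ⟨R y, h.mem_domain y⟩
  rw [h.apply_eq] at h1
  simp only [sub_sub_cancel] at h1
  rw [div_mul_eq_mul_div, one_mul, le_div_iff₀ hc]
  linarith

variable [CompleteSpace X]

theorem exists_inverse_one_sub (T : X →L[ℂ] X) (hT : ‖T‖ < 1) :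
    ∃ S : X →L[ℂ] X, (1 - T) * S = 1 ∧ S * (1 - T) = 1 ∧ ‖S‖ ≤ (1 - ‖T‖)⁻¹ := by
  refine ⟨((Units.oneSub T hT)⁻¹ : (X →L[ℂ] X)ˣ), ?_, ?_, ?_⟩
  · exact (Units.oneSub T hT).mul_inv
  · exact (Units.oneSub T hT).inv_mul
  · have h1 : (1 - T) * (((Units.oneSub T hT)⁻¹ : (X →L[ℂ] X)ˣ) : X →L[ℂ] X) = 1 := by
      exact (Units.oneSub T hT).mul_inv
    set S := (((Units.oneSub T hT)⁻¹ : (X →L[ℂ] X)ˣ) : X →L[ℂ] X)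
    rw [← one_div, le_div_iff₀ (by linarith)]
    have h2 : S = 1 + T * S := by rw [sub_mul, one_mul, sub_eq_iff_eq_add] at h1; exact h1
    have h3 : ‖S‖ ≤ 1 + ‖T‖ * ‖S‖ := by
      nth_rewrite 1 [h2]
      refine (norm_add_le _ _).trans (add_le_add ?_ (norm_mul_le _ _))
      exact ContinuousLinearMap.norm_id_le
    linarith

theorem IsResolventAt.mem_rho_of_near (h : IsResolventAt A z R) (hw : ‖w - z‖ * ‖R‖ < 1) :
    w ∈ rho A := by
  obtain ⟨S, h1, h2, -⟩ := exists_inverse_one_sub ((z - w) • R)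
    (by rwa [norm_smul, norm_sub_rev])
  exact (h.shift h1 h2).mem_rho

theorem isOpen_rho : IsOpen (rho A) := by
  rw [Metric.isOpen_iff]
  rintro z ⟨R, hR⟩
  refine ⟨(‖R‖ + 1)⁻¹, by positivity, fun w hw => hR.mem_rho_of_near ?_⟩
  rw [Metric.mem_ball, dist_eq_norm] at hw
  calc ‖w - z‖ * ‖R‖ ≤ (‖R‖ + 1)⁻¹ * ‖R‖ := by gcongr
    _ < 1 := by
      rw [inv_mul_lt_iff₀ (by positivity)]; linarith

/-- Points of a segment starting in the resolvent set stay in the resolvent set as long as `z - A`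
is bounded below uniformly. -/
theorem mem_rho_of_lower_bound (hz : z ∈ rho A) {c : ℝ} (hc : 0 < c)
    (hb : ∀ u ∈ segment ℝ z w, ∀ x : A.domain, c * ‖(x : X)‖ ≤ ‖u • (x : X) - A x‖) :
    w ∈ rho A := by
  obtain ⟨N, hN⟩ := exists_nat_gt (‖w - z‖ / c)
  have hN0 : (0 : ℝ) < N := lt_of_le_of_lt (by positivity) hN
  have key : ∀ k : ℕ, k ≤ N → z + ((k / N : ℝ) : ℂ) * (w - z) ∈ rho A := by
    intro k
    induction k with
    | zero => intro; simpa using hz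
    | succ k ih =>
      intro hk
      -- Each of the N steps has length ‖w - z‖/N < c, while the resolvent at the current point has
      -- norm at most 1/c, so the Neumann series reaches the next point.
      have hR := isResolventAt_resolventOp (ih (by omega))
      refine hR.mem_rho_of_near ?_
      have hk' : (k : ℝ) ≤ N := by exact_mod_cast (by omega : k ≤ N)
      have hmem : z + ((k / N : ℝ) : ℂ) * (w - z) ∈ segment ℝ z w := by
        rw [segment_eq_image']
        exact ⟨k / N, ⟨by positivity, by rw [div_le_one hN0]; exact hk'⟩, by simp⟩
      have hn := hR.norm_le hc (hb _ hmem)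
      have h1 : z + (((k + 1 : ℕ) / N : ℝ) : ℂ) * (w - z) - (z + ((k / N : ℝ) : ℂ) * (w - z))
          = ((1 / N : ℝ) : ℂ) * (w - z) := by
        push_cast; ring
      rw [h1, norm_mul, Complex.norm_real, Real.norm_of_nonneg (by positivity)]
      calc 1 / N * ‖w - z‖ * ‖resolventOp A (z + ((k / N : ℝ) : ℂ) * (w - z))‖
          ≤ 1 / N * ‖w - z‖ * (1 / c) := by gcongr
        _ = ‖w - z‖ / c / N := by field_simp
        _ < 1 := by rw [div_lt_one hN0]; exact hN
  have := key N le_rfl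
  rw [div_self hN0.ne'] at this
  simpa using this

theorem continuousOn_resolventOp : ContinuousOn (resolventOp A) (rho A) := by
  intro z hz
  apply ContinuousAt.continuousWithinAt
  have hR := isResolventAt_resolventOp hz
  set r := ‖resolventOp A z‖ with hr
  have hev : ∀ᶠ w in 𝓝 z, ‖w - z‖ * r < 1 / 2 := by
    have : Tendsto (fun w => ‖w - z‖ * r) (𝓝 z) (𝓝 (‖z - z‖ * r)) :=
      ((continuous_id.sub continuous_const).norm.mul continuous_const).tendsto z
    rw [sub_self, norm_zero, zero_mul] at this
    exact this.eventually (gt_mem_nhds (by norm_num))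
  rw [ContinuousAt, tendsto_iff_norm_sub_tendsto_zero]
  have hlim : Tendsto (fun w => ‖w - z‖ * (r * (2 * r))) (𝓝 z) (𝓝 0) := by
    have : Tendsto (fun w => ‖w - z‖ * (r * (2 * r))) (𝓝 z) (𝓝 (‖z - z‖ * (r * (2 * r)))) :=
      ((continuous_id.sub continuous_const).norm.mul continuous_const).tendsto z
    simpa using this
  refine squeeze_zero' (Eventually.of_forall fun _ => norm_nonneg _) ?_ hlim
  filter_upwards [hev] with w hw
  have hw' := isResolventAt_resolventOp (hR.mem_rho_of_near (w := w) (by linarith))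
  set s := ‖resolventOp A w‖
  have h1 : ‖resolventOp A w - resolventOp A z‖ ≤ ‖w - z‖ * (r * s) := by
    rw [norm_sub_rev, hR.sub_eq hw', norm_smul]
    gcongr
    exact norm_mul_le _ _
  -- The smallness ‖w - z‖ r < 1/2 lets the difference be absorbed: s ≤ s/2 + r.
  have h2 : s ≤ 2 * r := by
    have h3 : s ≤ ‖resolventOp A w - resolventOp A z‖ + r := by
      have := norm_add_le (resolventOp A w - resolventOp A z) (resolventOp A z)
      simpa using this
    have h4 : ‖w - z‖ * (r * s) ≤ 1 / 2 * s := by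
      rw [← mul_assoc]; gcongr
    linarith
  refine h1.trans ?_
  gcongr

/-- `d/dz R(z, A) = -R(z, A)²`. -/
theorem hasDerivAt_resolventOp (hz : z ∈ rho A) :
    HasDerivAt (resolventOp A) (-(resolventOp A z * resolventOp A z)) z := by
  rw [hasDerivAt_iff_tendsto_slope]
  have hc : ContinuousAt (resolventOp A) z :=
    continuousOn_resolventOp.continuousAt (isOpen_rho.mem_nhds hz)
  have h1 : Tendsto (fun w => -(resolventOp A z * resolventOp A w)) (𝓝[≠] z)
      (𝓝 (-(resolventOp A z * resolventOp A z))) :=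
    (tendsto_const_nhds.mul (hc.tendsto.mono_left nhdsWithin_le_nhds)).neg
  refine h1.congr' ?_
  have h2 : ∀ᶠ w in 𝓝[≠] z, w ∈ rho A :=
    nhdsWithin_le_nhds (isOpen_rho.mem_nhds hz)
  filter_upwards [h2, self_mem_nhdsWithin] with w hw hne
  have h3 := (isResolventAt_resolventOp hz).sub_eq (isResolventAt_resolventOp hw)
  have hne' : w - z ≠ 0 := sub_ne_zero.2 hne
  rw [slope_def_module, ← neg_sub (resolventOp A z), h3, smul_neg, smul_smul,
    inv_mul_cancel₀ hne', one_smul]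

end Resolvent

/-! ### Plancherel's theorem for Hilbert-space-valued functions. -/

section Plancherel

open MeasureTheory FourierTransform SchwartzMap

variable {H : Type*} [NormedAddCommGroup H] [InnerProductSpace ℂ H] [CompleteSpace H]

/-- On `L¹ ∩ L²` the Fourier transform on `L²` is given by the Fourier integral. -/
theorem fourier_toLp_ae_eq {f : ℝ → H} (h1 : Integrable f) (h2 : MemLp f 2) :
    (𝓕 (h2.toLp f) : Lp H 2 (volume : Measure ℝ)) =ᵐ[volume] 𝓕 f := by
  have hcont : Continuous (𝓕 f) := VectorFourier.fourierIntegral_continuous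
    Real.continuous_fourierChar (by exact continuous_inner) h1
  refine ae_eq_of_integral_contDiff_smul_eq (μ := (volume : Measure ℝ)) ?_ ?_ ?_
  · exact (Lp.memLp _).locallyIntegrable (by norm_num)
  · exact hcont.locallyIntegrable
  -- Both sides are tested against a smooth compactly supported g: the L² transform agrees with the
  -- distributional one, and the Fourier integral can be moved onto g by Fubini.
  · intro g hg hgc
    have hgC : ContDiff ℝ ((⊤ : ℕ∞) : WithTop ℕ∞) (fun x => (g x : ℂ)) := Complex.ofRealCLM.contDiff.comp hg
    have hgCc : HasCompactSupport (fun x => (g x : ℂ)) := hgc.comp_left Complex.ofReal_zero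
    let φ : 𝓢(ℝ, ℂ) := hgCc.toSchwartzMap hgC
    have hφ : ∀ x, φ x = (g x : ℂ) := fun x => rfl
    have e1 := congrArg (fun u => u φ) (Lp.fourier_toTemperedDistribution_eq (h2.toLp f))
    simp only [TemperedDistribution.fourier_apply, Lp.toTemperedDistribution_apply] at e1
    have e2 : ∫ x, g x • (𝓕 (h2.toLp f) : Lp H 2 (volume : Measure ℝ)) x
        = ∫ x, φ x • (𝓕 (h2.toLp f) : Lp H 2 (volume : Measure ℝ)) x := by
      congr 1
    have e3 : ∫ x, g x • 𝓕 f x = ∫ x, φ x • 𝓕 f x := by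
      congr 1
    rw [e2, e3, ← e1]
    have e4 : ∫ x, (𝓕 φ) x • (h2.toLp f) x = ∫ x, (𝓕 φ) x • f x := by
      refine integral_congr_ae ?_
      filter_upwards [h2.coeFn_toLp] with x hx
      rw [hx]
    rw [e4]
    have e5 := VectorFourier.integral_fourierIntegral_smul_eq_flip (μ := (volume : Measure ℝ))
      (ν := (volume : Measure ℝ)) (L := innerₗ ℝ) (f := (φ : ℝ → ℂ)) (g := f)
      Real.continuous_fourierChar (by exact continuous_inner) φ.integrable h1
    have e6 : (innerₗ ℝ : ℝ →ₗ[ℝ] ℝ →ₗ[ℝ] ℝ).flip = innerₗ ℝ := by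
      ext; simp
    rw [e6] at e5
    exact e5

theorem lintegral_enorm_fourier_sq {f : ℝ → H} (h1 : Integrable f) (h2 : MemLp f 2) :
    ∫⁻ ξ, ‖𝓕 f ξ‖ₑ ^ 2 = ∫⁻ x, ‖f x‖ₑ ^ 2 := by
  have key : ∀ g : Lp H 2 (volume : Measure ℝ), ∫⁻ x, ‖g x‖ₑ ^ 2 = ‖g‖ₑ ^ 2 := by
    intro g
    rw [Lp.enorm_def, eLpNorm_eq_lintegral_rpow_enorm_toReal (by norm_num) (by norm_num)]
    rw [← ENNReal.rpow_natCast, ← ENNReal.rpow_mul]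
    simp
  have e1 : ∫⁻ ξ, ‖𝓕 f ξ‖ₑ ^ 2
      = ∫⁻ ξ, ‖(𝓕 (h2.toLp f) : Lp H 2 (volume : Measure ℝ)) ξ‖ₑ ^ 2 := by
    refine lintegral_congr_ae ?_
    filter_upwards [fourier_toLp_ae_eq h1 h2] with x hx
    rw [hx]
  have e2 : ∫⁻ x, ‖f x‖ₑ ^ 2 = ∫⁻ x, ‖h2.toLp f x‖ₑ ^ 2 := by
    refine lintegral_congr_ae ?_
    filter_upwards [h2.coeFn_toLp] with x hx
    rw [hx]
  rw [e1, e2, key, key]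
  congr 1
  rw [← ofReal_norm, ← ofReal_norm, Lp.norm_fourier_eq]

end Plancherel

/-! ### The Hille-Yosida theorem through Yosida approximations. -/

section HilleYosida

open NormedSpace

variable {X : Type*} [NormedAddCommGroup X] [NormedSpace ℂ X] [CompleteSpace X]

theorem norm_exp_clm_le (S : X →L[ℂ] X) : ‖exp S‖ ≤ Real.exp ‖S‖ := by
  have h1 : HasSum (fun n : ℕ => ((n.factorial : ℂ)⁻¹) • S ^ n) (exp S) :=
    exp_series_hasSum_exp' S
  have h2 : HasSum (fun n : ℕ => ((n.factorial : ℝ)⁻¹) • ‖S‖ ^ n) (Real.exp ‖S‖) := by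
    rw [Real.exp_eq_exp_ℝ]
    exact exp_series_hasSum_exp' ‖S‖
  rw [← h1.tsum_eq]
  refine tsum_of_norm_bounded h2 fun n => ?_
  rw [norm_smul, norm_inv, Complex.norm_natCast, smul_eq_mul]
  gcongr
  rcases n with _ | n
  · simp only [pow_zero]
    exact ContinuousLinearMap.norm_id_le
  · exact norm_pow_le' _ (Nat.succ_pos n)

theorem exp_add_clm {S S' : X →L[ℂ] X} (h : Commute S S') : exp (S + S') = exp S * exp S' := by
  let +nondep : NormedAlgebra ℚ (X →L[ℂ] X) := NormedAlgebra.restrictScalars ℚ ℂ _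
  exact exp_add_of_commute h

theorem hasDerivAt_clm_apply {F : ℝ → X →L[ℂ] X} {F' : X →L[ℂ] X} {t : ℝ}
    (h : HasDerivAt F F' t) (x : X) : HasDerivAt (fun s => F s x) (F' x) t :=
  ((ContinuousLinearMap.apply ℂ X x).restrictScalars ℝ).hasFDerivAt.comp_hasDerivAt t h

theorem continuous_exp_smul_clm (S : X →L[ℂ] X) : Continuous fun t : ℝ => exp (t • S) :=
  continuous_iff_continuousAt.2 fun u => (hasDerivAt_exp_smul_const (𝕂 := ℝ) S u).continuousAt

theorem exp_add_smul (S : X →L[ℂ] X) (s t : ℝ) :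
    exp ((s + t) • S) = exp (s • S) * exp (t • S) := by
  rw [add_smul, exp_add_clm]
  exact ((Commute.refl S).smul_left s).smul_right t

/-- The path s ↦ exp(sS) exp((t - s)S') joins the two exponentials. As S and S' commute, its
derivative is the path applied to S - S', and the mean value inequality gives the factor t. -/
theorem norm_exp_sub_exp_apply_le {S S' : X →L[ℂ] X} (hc : Commute S S') {ω : ℝ}
    (hS : ∀ t : ℝ, 0 ≤ t → ‖exp (t • S)‖ ≤ Real.exp (ω * t))
    (hS' : ∀ t : ℝ, 0 ≤ t → ‖exp (t • S')‖ ≤ Real.exp (ω * t)) {t : ℝ} (ht : 0 ≤ t) (x : X) :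
    ‖exp (t • S) x - exp (t • S') x‖ ≤ t * Real.exp (ω * t) * ‖S x - S' x‖ := by
  have hd : ∀ s : ℝ, HasDerivAt (fun s : ℝ => (exp (s • S) * exp ((t - s) • S')) x)
      ((exp (s • S) * exp ((t - s) • S')) (S x - S' x)) s := by
    intro s
    have d1 := hasDerivAt_exp_smul_const (𝕂 := ℝ) S s
    have d2 : HasDerivAt (fun s : ℝ => exp ((t - s) • S')) (-(S' * exp ((t - s) • S'))) s := by
      have := (hasDerivAt_exp_smul_const' (𝕂 := ℝ) S' (t - s)).scomp s
        ((hasDerivAt_id s).const_sub t)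
      rw [neg_one_smul] at this
      exact this
    have d3 := hasDerivAt_clm_apply (d1.mul d2) x
    refine HasDerivAt.congr_deriv (f := fun s : ℝ => (exp (s • S) * exp ((t - s) • S')) x) d3 ?_
    have c1 : Commute S (exp ((t - s) • S')) := (hc.smul_right _).exp_right
    have c2 : Commute S' (exp ((t - s) • S')) := ((Commute.refl S').smul_right _).exp_right
    have e1 : exp (s • S) * S * exp ((t - s) • S') = exp (s • S) * exp ((t - s) • S') * S := by
      rw [mul_assoc, c1.eq, mul_assoc]
    have e2 : exp (s • S) * -(S' * exp ((t - s) • S'))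
        = -(exp (s • S) * exp ((t - s) • S') * S') := by
      rw [c2.eq, mul_neg, mul_assoc]
    rw [e1, e2]
    simp [sub_eq_add_neg]
  have hb := norm_image_sub_le_of_norm_deriv_le_segment' (a := 0) (b := t)
    (f := fun s : ℝ => (exp (s • S) * exp ((t - s) • S')) x)
    (C := Real.exp (ω * t) * ‖S x - S' x‖)
    (fun s _ => (hd s).hasDerivWithinAt) (fun s hs => by
      refine (ContinuousLinearMap.le_opNorm _ _).trans ?_
      gcongr
      refine (norm_mul_le _ _).trans ?_
      calc _ ≤ Real.exp (ω * s) * Real.exp (ω * (t - s)) := by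
            gcongr
            · exact hS s hs.1
            · exact hS' _ (by linarith [hs.2])
        _ = _ := by rw [← Real.exp_add]; ring_nf) t ⟨ht, le_rfl⟩
  simp only [sub_self, zero_smul, exp_zero, mul_one, sub_zero, one_mul] at hb
  linarith

/-- The hypotheses of the Hille--Yosida theorem, for semigroups with `‖T(t)‖ ≤ e^(ωt)`. -/
structure HilleYosida (A : X →ₗ.[ℂ] X) (ω : ℝ) : Prop where
  dense : Dense (A.domain : Set X)
  mem_rho : ∀ μ : ℝ, 0 < μ → ((ω + μ : ℝ) : ℂ) ∈ rho A
  norm_le : ∀ μ : ℝ, 0 < μ → ‖resolventOp A ((ω + μ : ℝ) : ℂ)‖ ≤ 1 / μ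

/-- `T` is a strongly continuous semigroup with `‖T(t)‖ ≤ e^(ωt)` generated by `A`. -/
structure Generates (A : X →ₗ.[ℂ] X) (T : ℝ → X →L[ℂ] X) (ω : ℝ) : Prop where
  map_zero : T 0 = 1
  map_add : ∀ s t : ℝ, 0 ≤ s → 0 ≤ t → T (s + t) = T s * T t
  norm_le : ∀ t : ℝ, 0 ≤ t → ‖T t‖ ≤ Real.exp (ω * t)
  continuous : ∀ x : X, Continuous fun t => T t x
  integral_eq : ∀ x : A.domain, ∀ t : ℝ, 0 ≤ t → T t x - x = ∫ s in (0 : ℝ)..t, T s (A x)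
  commute : ∀ (z : ℂ) (R : X →L[ℂ] X), IsResolventAt A z R → ∀ t : ℝ, 0 ≤ t → Commute (T t) R

/-- The Yosida approximations of `A`. -/
def yosida (A : X →ₗ.[ℂ] X) (ω : ℝ) (n : ℕ) : X →L[ℂ] X :=
  ((n + 1 : ℝ) ^ 2) • resolventOp A ((ω + (n + 1) : ℝ) : ℂ) + (ω - (n + 1)) • (1 : X →L[ℂ] X)

namespace HilleYosida

variable {A : X →ₗ.[ℂ] X} {ω : ℝ}

theorem isResolventAt (h : HilleYosida A ω) (n : ℕ) :
    IsResolventAt A ((ω + (n + 1) : ℝ) : ℂ) (resolventOp A ((ω + (n + 1) : ℝ) : ℂ)) :=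
  isResolventAt_resolventOp (h.mem_rho _ (by positivity))

/-- With λ = n + 1, the scalar part contributes e^(t(ω - λ)), and the resolvent part at most
e^(tλ²‖R‖) ≤ e^(tλ); the two factors λ cancel. -/
theorem norm_exp_yosida_le (h : HilleYosida A ω) (n : ℕ) (t : ℝ) (ht : 0 ≤ t) :
    ‖exp (t • yosida A ω n)‖ ≤ Real.exp (ω * t) := by
  set R := resolventOp A ((ω + (n + 1) : ℝ) : ℂ) with hR
  have hRn : ‖R‖ ≤ 1 / (n + 1 : ℝ) := h.norm_le _ (by positivity)
  have e1 : t • yosida A ω n = (t * (n + 1 : ℝ) ^ 2) • R + (t * (ω - (n + 1))) • (1 : X →L[ℂ] X) := by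
    rw [yosida, smul_add, smul_smul, smul_smul]
  have e2 : exp ((t * (ω - (n + 1))) • (1 : X →L[ℂ] X))
      = Real.exp (t * (ω - (n + 1))) • (1 : X →L[ℂ] X) := by
    rw [← Algebra.algebraMap_eq_smul_one, ← Algebra.algebraMap_eq_smul_one, Real.exp_eq_exp_ℝ]
    exact (algebraMap_exp_comm _).symm
  rw [e1, exp_add_clm ((Commute.one_right _).smul_right _), e2, mul_smul_comm, mul_one,
    norm_smul, Real.norm_of_nonneg (Real.exp_pos _).le]
  calc _ ≤ Real.exp (t * (ω - (n + 1))) * Real.exp (t * (n + 1)) := by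
        gcongr
        refine (norm_exp_clm_le _).trans (Real.exp_le_exp.2 ?_)
        rw [norm_smul, Real.norm_of_nonneg (by positivity)]
        calc t * (n + 1 : ℝ) ^ 2 * ‖R‖ ≤ t * (n + 1 : ℝ) ^ 2 * (1 / (n + 1)) := by gcongr
          _ = t * (n + 1) := by field_simp
    _ = _ := by rw [← Real.exp_add]; ring_nf

theorem commute_yosida (h : HilleYosida A ω) {z : ℂ} {R : X →L[ℂ] X} (hR : IsResolventAt A z R)
    (n : ℕ) : Commute (yosida A ω n) R := by
  refine Commute.add_left ?_ ?_
  · exact ((h.isResolventAt n).commute hR).smul_left _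
  · exact (Commute.one_left _).smul_left _

theorem commute_yosida_yosida (h : HilleYosida A ω) (n m : ℕ) :
    Commute (yosida A ω n) (yosida A ω m) := by
  refine Commute.add_right ?_ ?_
  · exact (h.commute_yosida (h.isResolventAt m) n).smul_right _
  · exact (Commute.one_right _).smul_right _

/-- On the domain the error is R(Ay - ωy) = O(1/n). The operators are contractions, so convergence
passes to the closure of the domain. -/
theorem smul_resolventOp_tendsto (h : HilleYosida A ω) (x : X) :
    Tendsto (fun n : ℕ => (n + 1 : ℝ) • resolventOp A ((ω + (n + 1) : ℝ) : ℂ) x) atTop (𝓝 x) := by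
  have hb : ∀ n : ℕ, ‖(n + 1 : ℝ) • resolventOp A ((ω + (n + 1) : ℝ) : ℂ)‖ ≤ 1 := by
    intro n
    rw [norm_smul, Real.norm_of_nonneg (by positivity)]
    calc _ ≤ (n + 1 : ℝ) * (1 / (n + 1)) := by
          gcongr
          exact h.norm_le _ (by positivity)
      _ = 1 := by field_simp
  have hdom : ∀ y : A.domain, Tendsto (fun n : ℕ => (n + 1 : ℝ) •
      resolventOp A ((ω + (n + 1) : ℝ) : ℂ) (y : X)) atTop (𝓝 y) := by
    intro y
    rw [tendsto_iff_norm_sub_tendsto_zero]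
    have hlim : Tendsto (fun n : ℕ => (1 / ((n : ℝ) + 1)) * ‖A y - ω • (y : X)‖) atTop (𝓝 0) := by
      simpa using tendsto_one_div_add_atTop_nhds_zero_nat.mul_const ‖A y - ω • (y : X)‖
    refine squeeze_zero (fun _ => norm_nonneg _) (fun n => ?_) hlim
    have h1 := (h.isResolventAt n).left_inv y
    set R := resolventOp A ((ω + (n + 1) : ℝ) : ℂ)
    have h2 : (n + 1 : ℝ) • R (y : X) - y = R (A y - ω • (y : X)) := by
      have h3 : R (A y - ω • (y : X)) = R (A y) - ω • R y := by
        rw [map_sub, ← Complex.coe_smul ω (y : X), map_smul, Complex.coe_smul]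
      rw [map_sub, map_smul, Complex.coe_smul] at h1
      rw [h3]
      linear_combination (norm := module) h1
    rw [h2]
    refine (R.le_opNorm _).trans ?_
    gcongr
    exact h.norm_le _ (by positivity)
  rw [Metric.tendsto_atTop]
  intro ε hε
  obtain ⟨y, hy, hxy⟩ := Metric.mem_closure_iff.1 (h.dense x) (ε / 3) (by positivity)
  obtain ⟨N, hN⟩ := Metric.tendsto_atTop.1 (hdom ⟨y, hy⟩) (ε / 3) (by positivity)
  refine ⟨N, fun n hn => ?_⟩
  have h1 := hN n hn
  rw [dist_eq_norm] at hxy h1 ⊢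
  set S := (n + 1 : ℝ) • resolventOp A ((ω + (n + 1) : ℝ) : ℂ) with hS
  change ‖S y - y‖ < ε / 3 at h1
  change ‖S x - x‖ < ε
  have h2 : ‖S (x - y)‖ ≤ ‖x - y‖ := by
    simpa using S.le_of_opNorm_le (hb n) (x - y)
  have h3 : S x - x = S (x - y) + (S y - y) - (x - y) := by rw [map_sub]; abel
  rw [h3]
  have := norm_sub_le (S (x - y) + (S y - y)) (x - y)
  have := norm_add_le (S (x - y)) (S y - y)
  linarith

theorem yosida_apply (h : HilleYosida A ω) (x : A.domain) (n : ℕ) :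
    yosida A ω n x = (n + 1 : ℝ) • resolventOp A ((ω + (n + 1) : ℝ) : ℂ) (A x - ω • (x : X))
      + ω • (x : X) := by
  have h1 := (h.isResolventAt n).left_inv x
  set R := resolventOp A ((ω + (n + 1) : ℝ) : ℂ) with hR
  have h3 : R (A x - ω • (x : X)) = R (A x) - ω • R x := by
    rw [map_sub, ← Complex.coe_smul ω (x : X), map_smul, Complex.coe_smul]
  rw [map_sub, map_smul, Complex.coe_smul] at h1
  rw [h3]
  change ((n + 1 : ℝ) ^ 2) • R x + (ω - (n + 1)) • (x : X) = _
  linear_combination (norm := module) ((n : ℝ) + 1) • h1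

theorem yosida_tendsto (h : HilleYosida A ω) (x : A.domain) :
    Tendsto (fun n => yosida A ω n x) atTop (𝓝 (A x)) := by
  have := (h.smul_resolventOp_tendsto (A x - ω • (x : X))).add_const (ω • (x : X))
  rw [sub_add_cancel] at this
  exact this.congr fun n => (h.yosida_apply x n).symm

theorem exists_tendsto (h : HilleYosida A ω) {t : ℝ} (ht : 0 ≤ t) (x : X) :
    ∃ y, Tendsto (fun n => exp (t • yosida A ω n) x) atTop (𝓝 y) := by
  refine cauchySeq_tendsto_of_complete ?_
  rw [Metric.cauchySeq_iff]
  intro ε hε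
  set E := Real.exp (ω * t) with hE
  have hE0 : 0 < E := Real.exp_pos _
  obtain ⟨y, hy, hxy⟩ := Metric.mem_closure_iff.1 (h.dense x) (ε / (3 * E)) (by positivity)
  obtain ⟨N, hN⟩ := Metric.cauchySeq_iff.1 (h.yosida_tendsto ⟨y, hy⟩).cauchySeq
    (ε / (3 * (t + 1) * E)) (by positivity)
  refine ⟨N, fun m hm n hn => ?_⟩
  have h1 := hN m hm n hn
  rw [dist_eq_norm] at hxy h1 ⊢
  have h2 := norm_exp_sub_exp_apply_le (h.commute_yosida_yosida m n) (h.norm_exp_yosida_le m)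
    (h.norm_exp_yosida_le n) ht y
  have h3 : ∀ k, ‖exp (t • yosida A ω k) (x - y)‖ < ε / 3 := by
    intro k
    calc _ ≤ E * ‖x - y‖ := ContinuousLinearMap.le_of_opNorm_le _ (h.norm_exp_yosida_le k t ht) _
      _ < E * (ε / (3 * E)) := by gcongr
      _ = ε / 3 := by field_simp
  have h4 : t * E * ‖yosida A ω m y - yosida A ω n y‖ ≤ ε / 3 := by
    calc _ ≤ (t + 1) * E * (ε / (3 * (t + 1) * E)) := by
          gcongr
          · linarith
      _ = ε / 3 := by field_simp
  have h5 : exp (t • yosida A ω m) x - exp (t • yosida A ω n) x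
      = exp (t • yosida A ω m) (x - y) + (exp (t • yosida A ω m) y - exp (t • yosida A ω n) y)
        - exp (t • yosida A ω n) (x - y) := by
    simp only [map_sub]; abel
  rw [h5]
  have := norm_sub_le (exp (t • yosida A ω m) (x - y) + (exp (t • yosida A ω m) y -
    exp (t • yosida A ω n) y)) (exp (t • yosida A ω n) (x - y))
  have := norm_add_le (exp (t • yosida A ω m) (x - y)) (exp (t • yosida A ω m) y -
    exp (t • yosida A ω n) y)
  have := h3 m
  have := h3 n
  linarith

/-- The Hille--Yosida theorem. -/
theorem exists_generates (h : HilleYosida A ω) :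
    ∃ T : ℝ → X →L[ℂ] X, Generates A T ω ∧
      ∀ t : ℝ, 0 ≤ t → ∀ x, Tendsto (fun n => exp (t • yosida A ω n) x) atTop (𝓝 (T t x)) := by
  have hex : ∀ t : ℝ, ∃ S : X →L[ℂ] X, ∀ x,
      Tendsto (fun n => exp (max t 0 • yosida A ω n) x) atTop (𝓝 (S x)) := by
    intro t
    choose f hf using fun x => h.exists_tendsto (le_max_right t 0) x
    exact ⟨continuousLinearMapOfTendsto (fun n => exp (max t 0 • yosida A ω n))
      (tendsto_pi_nhds.2 hf), hf⟩
  choose T hT using hex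
  have hT' : ∀ t : ℝ, 0 ≤ t → ∀ x, Tendsto (fun n => exp (t • yosida A ω n) x) atTop
      (𝓝 (T t x)) := by
    intro t ht x
    have := hT t x
    rwa [max_eq_left ht] at this
  -- The family is constant for t ≤ 0, which turns continuity on the half-line into continuity on ℝ.
  have hmax : ∀ t, T t = T (max t 0) := by
    intro t
    ext x
    refine tendsto_nhds_unique (hT t x) ?_
    exact hT' _ (le_max_right t 0) x
  have hnorm : ∀ t : ℝ, 0 ≤ t → ‖T t‖ ≤ Real.exp (ω * t) := by
    intro t ht
    refine ContinuousLinearMap.opNorm_le_bound _ (Real.exp_pos _).le fun x => ?_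
    refine le_of_tendsto (hT' t ht x).norm (Eventually.of_forall fun n => ?_)
    exact ContinuousLinearMap.le_of_opNorm_le _ (h.norm_exp_yosida_le n t ht) _
  have hzero : T 0 = 1 := by
    ext x
    refine tendsto_nhds_unique (hT' 0 le_rfl x) ?_
    simp
  have hadd : ∀ s t : ℝ, 0 ≤ s → 0 ≤ t → T (s + t) = T s * T t := by
    intro s t hs ht
    ext x
    refine tendsto_nhds_unique (hT' _ (add_nonneg hs ht) x) ?_
    have h1 : Tendsto (fun n => exp (s • yosida A ω n) (T t x)) atTop (𝓝 (T s (T t x))) :=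
      hT' s hs _
    have h2 : Tendsto (fun n => exp (s • yosida A ω n) (exp (t • yosida A ω n) x - T t x))
        atTop (𝓝 0) := by
      have h3 : Tendsto (fun n => Real.exp (ω * s) * ‖exp (t • yosida A ω n) x - T t x‖) atTop
          (𝓝 0) := by
        simpa using (tendsto_iff_norm_sub_tendsto_zero.1 (hT' t ht x)).const_mul
          (Real.exp (ω * s))
      refine squeeze_zero_norm (fun n => ?_) h3
      exact ContinuousLinearMap.le_of_opNorm_le _ (h.norm_exp_yosida_le n s hs) _
    have h4 := h1.add h2
    rw [add_zero] at h4
    refine h4.congr fun n => ?_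
    rw [← map_add, exp_add_smul]
    simp
  have hcomm : ∀ (z : ℂ) (R : X →L[ℂ] X), IsResolventAt A z R → ∀ t : ℝ, 0 ≤ t →
      Commute (T t) R := by
    intro z R hR t ht
    ext x
    refine tendsto_nhds_unique (hT' t ht (R x)) ?_
    refine ((R.continuous.tendsto _).comp (hT' t ht x)).congr fun n => ?_
    have : Commute (exp (t • yosida A ω n)) R :=
      ((h.commute_yosida hR n).smul_left t).exp_left
    exact congrArg (fun S : X →L[ℂ] X => S x) this.eq.symm
  have hsub : ∀ x : A.domain, ∀ s t : ℝ, 0 ≤ s → s ≤ t →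
      ‖T t x - T s x‖ ≤ Real.exp (|ω| * t) * ‖A x‖ * (t - s) := by
    intro x s t hs hst
    have h1 : Tendsto (fun n => ‖exp (t • yosida A ω n) (x : X) - exp (s • yosida A ω n) x‖)
        atTop (𝓝 ‖T t x - T s x‖) := ((hT' t (hs.trans hst) x).sub (hT' s hs x)).norm
    have h2 : Tendsto (fun n => Real.exp (|ω| * t) * ‖yosida A ω n x‖ * (t - s)) atTop
        (𝓝 (Real.exp (|ω| * t) * ‖A x‖ * (t - s))) :=
      ((h.yosida_tendsto x).norm.const_mul _).mul_const _
    refine le_of_tendsto_of_tendsto' h1 h2 fun n => ?_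
    refine norm_image_sub_le_of_norm_deriv_le_segment' (a := s) (b := t)
      (f := fun u : ℝ => exp (u • yosida A ω n) (x : X))
      (f' := fun u : ℝ => (exp (u • yosida A ω n) * yosida A ω n) (x : X))
      (fun u _ => ?_) (fun u hu => ?_) t ⟨hst, le_rfl⟩
    · exact (hasDerivAt_clm_apply (hasDerivAt_exp_smul_const (𝕂 := ℝ) (yosida A ω n) u)
        x).hasDerivWithinAt
    · refine ContinuousLinearMap.le_of_opNorm_le _ ((h.norm_exp_yosida_le n u
        (hs.trans hu.1)).trans (Real.exp_le_exp.2 ?_)) _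
      have := hs.trans hu.1
      calc ω * u ≤ |ω| * u := by gcongr; exact le_abs_self ω
        _ ≤ |ω| * t := by gcongr; exact hu.2.le
  have hcontOn : ∀ x : X, ∀ b : ℝ, ContinuousOn (fun t => T t x) (Icc 0 b) := by
    intro x b
    have hdom : ∀ y : A.domain, ContinuousOn (fun t => T t (y : X)) (Icc 0 b) := by
      intro y
      have hL : LipschitzOnWith (Real.toNNReal (Real.exp (|ω| * b) * ‖A y‖))
          (fun t => T t (y : X)) (Icc 0 b) := by
        refine LipschitzOnWith.of_dist_le_mul fun s hs t ht => ?_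
        rw [Real.coe_toNNReal _ (by positivity), dist_eq_norm, Real.dist_eq]
        rcases le_total s t with hst | hst
        · rw [norm_sub_rev, abs_sub_comm, abs_of_nonneg (by linarith : (0 : ℝ) ≤ t - s)]
          refine (hsub y s t hs.1 hst).trans ?_
          have : (0 : ℝ) ≤ t - s := by linarith
          gcongr
          exact ht.2
        · rw [abs_of_nonneg (by linarith : (0 : ℝ) ≤ s - t)]
          refine (hsub y t s ht.1 hst).trans ?_
          have : (0 : ℝ) ≤ s - t := by linarith
          gcongr
          exact hs.2
      exact hL.continuousOn
    rw [Metric.continuousOn_iff]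
    intro t ht ε hε
    set E := Real.exp (|ω| * b) with hE
    have hE0 : 0 < E := Real.exp_pos _
    have hTE : ∀ s ∈ Icc 0 b, ‖T s‖ ≤ E := by
      intro s hs
      refine (hnorm s hs.1).trans (Real.exp_le_exp.2 ?_)
      have := hs.1
      calc ω * s ≤ |ω| * s := by gcongr; exact le_abs_self ω
        _ ≤ |ω| * b := by gcongr; exact hs.2
    obtain ⟨y, hy, hxy⟩ := Metric.mem_closure_iff.1 (h.dense x) (ε / (3 * E)) (by positivity)
    obtain ⟨δ, hδ, hδ'⟩ := Metric.continuousOn_iff.1 (hdom ⟨y, hy⟩) t ht (ε / 3) (by positivity)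
    refine ⟨δ, hδ, fun s hs hst => ?_⟩
    have h1 := hδ' s hs hst
    rw [dist_eq_norm] at hxy h1 ⊢
    have h3 : ∀ k ∈ Icc 0 b, ‖T k (x - y)‖ < ε / 3 := by
      intro k hk
      calc _ ≤ E * ‖x - y‖ := ContinuousLinearMap.le_of_opNorm_le _ (hTE k hk) _
        _ < E * (ε / (3 * E)) := by gcongr
        _ = ε / 3 := by field_simp
    have h5 : T s x - T t x = T s (x - y) + (T s y - T t y) - T t (x - y) := by
      simp only [map_sub]; abel
    rw [h5]
    have := norm_sub_le (T s (x - y) + (T s y - T t y)) (T t (x - y))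
    have := norm_add_le (T s (x - y)) (T s y - T t y)
    have := h3 s hs
    have := h3 t ht
    linarith
  have hcont : ∀ x : X, Continuous fun t => T t x := by
    intro x
    have h1 : ContinuousOn (fun t => T t x) (Ici 0) := by
      intro t ht
      have h2 := hcontOn x (t + 1) t ⟨ht, by linarith⟩
      refine h2.mono_of_mem_nhdsWithin ?_
      rw [mem_nhdsWithin]
      exact ⟨Iio (t + 1), isOpen_Iio, by simp, fun u hu => ⟨hu.2, hu.1.le⟩⟩
    have h2 : (fun t => T t x) = (fun t => T t x) ∘ fun t => max t 0 := by
      ext t; simp only [Function.comp]; rw [← hmax t]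
    rw [h2]
    exact h1.comp_continuous (by fun_prop) fun t => le_max_right t 0
  -- What remains is the integral equation, obtained from the one for the approximating exponentials
  -- by dominated convergence.
  refine ⟨T, ⟨hzero, hadd, hnorm, hcont, ?_, hcomm⟩, hT'⟩
  intro x t ht
  have h1 : ∀ n, exp (t • yosida A ω n) (x : X) - x
      = ∫ s in (0 : ℝ)..t, exp (s • yosida A ω n) (yosida A ω n x) := by
    intro n
    have hd : ∀ u : ℝ, HasDerivAt (fun u : ℝ => exp (u • yosida A ω n) (x : X))
        (exp (u • yosida A ω n) (yosida A ω n x)) u := by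
      intro u
      exact hasDerivAt_clm_apply (hasDerivAt_exp_smul_const (𝕂 := ℝ) (yosida A ω n) u) x
    rw [intervalIntegral.integral_eq_sub_of_hasDerivAt (fun u _ => hd u)]
    · simp
    · apply Continuous.intervalIntegrable
      exact (continuous_exp_smul_clm _).clm_apply continuous_const
  have h2 : Tendsto (fun n => ∫ s in (0 : ℝ)..t, exp (s • yosida A ω n) (yosida A ω n x)) atTop
      (𝓝 (∫ s in (0 : ℝ)..t, T s (A x))) := by
    obtain ⟨M, hM⟩ := (h.yosida_tendsto x).norm.bddAbove_range
    refine intervalIntegral.tendsto_integral_filter_of_dominated_convergence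
      (fun _ => Real.exp (|ω| * t) * M) ?_ ?_ ?_ ?_
    · refine Eventually.of_forall fun n => ?_
      exact ((continuous_exp_smul_clm _).clm_apply continuous_const).aestronglyMeasurable
    · refine Eventually.of_forall fun n => MeasureTheory.ae_of_all _ fun s hs => ?_
      rw [uIoc_of_le ht] at hs
      have hs0 := hs.1.le
      refine (ContinuousLinearMap.le_of_opNorm_le _ (h.norm_exp_yosida_le n s hs0) _).trans ?_
      have : ω * s ≤ |ω| * t := by
        calc ω * s ≤ |ω| * s := by gcongr; exact le_abs_self ω
          _ ≤ |ω| * t := by gcongr; exact hs.2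
      gcongr
      exact hM ⟨n, rfl⟩
    · exact intervalIntegrable_const
    · refine MeasureTheory.ae_of_all _ fun s hs => ?_
      rw [uIoc_of_le ht] at hs
      have hs0 := hs.1.le
      have h3 : Tendsto (fun n => Real.exp (ω * s) * ‖yosida A ω n x - A x‖) atTop (𝓝 0) := by
        simpa using (tendsto_iff_norm_sub_tendsto_zero.1 (h.yosida_tendsto x)).const_mul
          (Real.exp (ω * s))
      have h4 : Tendsto (fun n => exp (s • yosida A ω n) (yosida A ω n x - A x)) atTop (𝓝 0) :=
        squeeze_zero_norm (fun n => ContinuousLinearMap.le_of_opNorm_le _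
          (h.norm_exp_yosida_le n s hs0) _) h3
      have h5 := (hT' s hs0 (A x)).add h4
      rw [add_zero] at h5
      refine h5.congr fun n => ?_
      rw [← map_add]; congr 1; abel
  refine tendsto_nhds_unique ((hT' t ht x).sub_const (x : X)) ?_
  exact h2.congr fun n => (h1 n).symm

end HilleYosida

end HilleYosida

/-! ### Resolvents as Laplace transforms, and L² identities on vertical lines. -/

section Laplace

open MeasureTheory FourierTransform

namespace Generates

section Banach

variable {X : Type*} [NormedAddCommGroup X] [NormedSpace ℂ X] [CompleteSpace X]
  {A : X →ₗ.[ℂ] X} {T : ℝ → X →L[ℂ] X} {ω : ℝ} {z : ℂ}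

theorem isC0Semigroup (h : Generates A T ω) : IsC0Semigroup T where
  map_zero := h.map_zero
  map_add := h.map_add
  strong_cont x := by
    have := (h.continuous x).tendsto 0
    rw [h.map_zero] at this
    exact this.mono_left nhdsWithin_le_nhds

theorem hasDerivAt_integral (h : Generates A T ω) (y : X) (t : ℝ) :
    HasDerivAt (fun t => ∫ s in (0 : ℝ)..t, T s y) (T t y) t :=
  intervalIntegral.integral_hasDerivAt_right ((h.continuous y).intervalIntegrable _ _)
    (h.continuous y).stronglyMeasurable.stronglyMeasurableAtFilter (h.continuous y).continuousAt

theorem hasDerivAt (h : Generates A T ω) (x : A.domain) {t : ℝ} (ht : 0 < t) :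
    HasDerivAt (fun t => T t x) (T t (A x)) t := by
  have h1 := (h.hasDerivAt_integral (A x) t).const_add (x : X)
  refine h1.congr_of_eventuallyEq ?_
  filter_upwards [lt_mem_nhds ht] with s hs
  rw [← h.integral_eq x s hs.le]
  abel

theorem tendsto_slope (h : Generates A T ω) (x : A.domain) :
    Tendsto (fun t : ℝ => ((t⁻¹ : ℝ) : ℂ) • (T t x - x)) (𝓝[>] 0) (𝓝 (A x)) := by
  have h1 := (h.hasDerivAt_integral (A x) 0).tendsto_slope_zero_right
  rw [h.map_zero] at h1
  refine h1.congr' ?_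
  filter_upwards [self_mem_nhdsWithin] with t ht
  rw [Complex.coe_smul, h.integral_eq x t (le_of_lt ht)]
  simp

/-- The hard direction is that a convergent difference quotient forces x into the domain. Applying
the commuting resolvent R gives ARx = Ry, whence x = R(zx - y). -/
theorem isGenerator (h : Generates A T ω) (hz : z ∈ rho A) : IsGenerator A T := by
  intro x y
  constructor
  · rintro ⟨hx, rfl⟩
    exact h.tendsto_slope ⟨x, hx⟩
  · intro hy
    have hR := isResolventAt_resolventOp hz
    set R := resolventOp A z
    have h1 := h.tendsto_slope ⟨R x, hR.mem_domain x⟩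
    have h2 := (R.continuous.tendsto y).comp hy
    have h3 : A ⟨R x, hR.mem_domain x⟩ = R y := by
      refine tendsto_nhds_unique h1 (h2.congr' ?_)
      filter_upwards [self_mem_nhdsWithin] with t ht
      have hc : T t (R x) = R (T t x) :=
        congrArg (fun S : X →L[ℂ] X => S x) (h.commute z R hR t (le_of_lt ht)).eq
      simp only [Function.comp, map_smul, map_sub, hc]
    rw [hR.apply_eq] at h3
    have h4 : x = R (z • x - y) := by
      rw [map_sub, map_smul, ← h3]; abel
    have hx : x ∈ A.domain := by rw [h4]; exact hR.mem_domain _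
    refine ⟨hx, ?_⟩
    rw [apply_congr_of_eq A hx (hR.mem_domain (z • x - y)) h4, hR.apply_eq, ← h4]
    abel

theorem norm_apply_le {M w : ℝ} (hM : ∀ t, 0 ≤ t → ‖T t‖ ≤ M * Real.exp (w * t)) (z : ℂ) (y : X)
    {t : ℝ} (ht : 0 ≤ t) :
    ‖Complex.exp (-z * t) • T t y‖ ≤ M * ‖y‖ * Real.exp (-(z.re - w) * t) := by
  rw [norm_smul, Complex.norm_exp]
  have h1 : (-z * t).re = -z.re * t := by simp
  rw [h1]
  calc _ ≤ Real.exp (-z.re * t) * (M * Real.exp (w * t) * ‖y‖) := by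
        gcongr
        exact ContinuousLinearMap.le_of_opNorm_le _ (hM t ht) _
    _ = M * ‖y‖ * (Real.exp (-z.re * t) * Real.exp (w * t)) := by ring
    _ = _ := by rw [← Real.exp_add]; ring_nf

theorem continuous_exp_smul (h : Generates A T ω) (z : ℂ) (y : X) :
    Continuous fun t : ℝ => Complex.exp (-z * t) • T t y :=
  Continuous.smul (by fun_prop) (h.continuous y)

theorem integrableOn_exp_smul (h : Generates A T ω) {M w : ℝ}
    (hM : ∀ t, 0 ≤ t → ‖T t‖ ≤ M * Real.exp (w * t)) (hw : w < z.re) (y : X) :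
    IntegrableOn (fun t : ℝ => Complex.exp (-z * t) • T t y) (Ioi 0) := by
  refine Integrable.mono' (g := fun t => M * ‖y‖ * Real.exp (-(z.re - w) * t)) ?_
    (h.continuous_exp_smul z y).aestronglyMeasurable ?_
  · exact (integrableOn_exp_mul_Ioi (by linarith) 0).const_mul _
  · exact (ae_restrict_mem measurableSet_Ioi).mono fun t ht => norm_apply_le hM z y (le_of_lt ht)

theorem tendsto_mul_exp_neg {c : ℝ} (hc : 0 < c) :
    Tendsto (fun t : ℝ => t * Real.exp (-c * t)) atTop (𝓝 0) := by
  have := (Real.tendsto_pow_mul_exp_neg_atTop_nhds_zero 1).comp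
    (tendsto_id.const_mul_atTop hc)
  have h2 := this.const_mul c⁻¹
  rw [mul_zero] at h2
  refine h2.congr fun t => ?_
  simp only [Function.comp, id, pow_one]
  field_simp

theorem mul_exp_le {c : ℝ} (hc : 0 < c) (t : ℝ) :
    t * Real.exp (-c * t) ≤ 2 / c * Real.exp (-(c / 2) * t) := by
  have h1 : Real.exp (-c * t) = Real.exp (-(c / 2) * t) * Real.exp (-(c / 2) * t) := by
    rw [← Real.exp_add]; ring_nf
  have h2 : t * Real.exp (-(c / 2) * t) ≤ 2 / c := by
    rw [neg_mul, Real.exp_neg, ← div_eq_mul_inv, div_le_iff₀ (Real.exp_pos _)]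
    have := Real.add_one_le_exp (c / 2 * t)
    calc t = 2 / c * (c / 2 * t) := by field_simp
      _ ≤ _ := by gcongr; linarith
  rw [h1, ← mul_assoc]
  gcongr

theorem integrableOn_mul_exp_smul (h : Generates A T ω) {M w : ℝ}
    (hM : ∀ t, 0 ≤ t → ‖T t‖ ≤ M * Real.exp (w * t)) (hw : w < z.re) (y : X) :
    IntegrableOn (fun t : ℝ => (t : ℂ) • Complex.exp (-z * t) • T t y) (Ioi 0) := by
  have hM0 : 0 ≤ M := by
    have := (norm_nonneg _).trans (hM 0 le_rfl)
    simpa using this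
  refine Integrable.mono' (g := fun t => M * ‖y‖ * (2 / (z.re - w) *
      Real.exp (-((z.re - w) / 2) * t))) ?_
    (Continuous.smul (by fun_prop) (h.continuous_exp_smul z y)).aestronglyMeasurable ?_
  · exact ((integrableOn_exp_mul_Ioi (by linarith) 0).const_mul _).const_mul _
  · refine (ae_restrict_mem measurableSet_Ioi).mono fun t ht => ?_
    have ht0 : (0 : ℝ) < t := ht
    rw [norm_smul, Complex.norm_real, Real.norm_of_nonneg ht0.le]
    calc _ ≤ t * (M * ‖y‖ * Real.exp (-(z.re - w) * t)) := by
          gcongr; exact norm_apply_le hM z y ht0.le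
      _ = M * ‖y‖ * (t * Real.exp (-(z.re - w) * t)) := by ring
      _ ≤ _ := mul_le_mul_of_nonneg_left (mul_exp_le (sub_pos.2 hw) t) (by positivity)

theorem hasDerivAt_exp_smul (h : Generates A T ω) (z : ℂ) (x : A.domain) {t : ℝ} (ht : 0 < t) :
    HasDerivAt (fun t : ℝ => Complex.exp (-z * t) • T t x)
      (Complex.exp (-z * t) • T t (A x - z • (x : X))) t := by
  have h1 : HasDerivAt (fun t : ℝ => Complex.exp (-z * t)) (Complex.exp (-z * t) * (-z)) t := by
    have := ((hasDerivAt_id (t : ℂ)).const_mul (-z)).cexp.comp_ofReal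
    simpa using this
  have h2 := h1.smul (h.hasDerivAt x ht)
  refine HasDerivAt.congr_deriv h2 ?_
  rw [map_sub, map_smul]
  module

/-- The resolvent is the Laplace transform of the semigroup. -/
theorem laplace (h : Generates A T ω) {M w : ℝ}
    (hM : ∀ t, 0 ≤ t → ‖T t‖ ≤ M * Real.exp (w * t)) (hw : w < z.re) (hz : z ∈ rho A) (y : X) :
    ∫ t in Ioi (0 : ℝ), Complex.exp (-z * t) • T t y = resolventOp A z y := by
  have hR := isResolventAt_resolventOp hz
  set R := resolventOp A z
  set x : A.domain := ⟨R y, hR.mem_domain y⟩ with hx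
  have h1 : A x - z • (x : X) = -y := by rw [hx, hR.apply_eq]; abel
  have h2 := integral_Ioi_of_hasDerivAt_of_tendsto (a := 0) (m := 0)
    (f := fun t : ℝ => Complex.exp (-z * t) • T t x)
    (f' := fun t : ℝ => Complex.exp (-z * t) • T t (A x - z • (x : X)))
    (h.continuous_exp_smul z x).continuousWithinAt
    (fun t ht => h.hasDerivAt_exp_smul z x ht)
    (h.integrableOn_exp_smul hM hw _) ?_
  · rw [h1] at h2
    simp only [map_neg, smul_neg, integral_neg, Complex.ofReal_zero, mul_zero, Complex.exp_zero,
      one_smul, h.map_zero, one_apply_eq_self, zero_sub, neg_inj] at h2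
    exact h2
  · have h3 : Tendsto (fun t : ℝ => M * ‖(x : X)‖ * Real.exp (-(z.re - w) * t)) atTop (𝓝 0) := by
      have h4 : Tendsto (fun t : ℝ => Real.exp (-(z.re - w) * t)) atTop (𝓝 0) :=
        Real.tendsto_exp_atBot.comp (tendsto_id.const_mul_atTop_of_neg (by linarith))
      simpa using h4.const_mul (M * ‖(x : X)‖)
    refine squeeze_zero_norm' ?_ h3
    filter_upwards [eventually_ge_atTop 0] with t ht
    exact norm_apply_le hM z _ ht

/-- Integrate the derivative of t e^(-zt) T(t)x with x = R(z)y: one term is the Laplace transform of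
T(t)x, the other is minus the integral wanted. It gives the time weight needed for decay, as
`laplace` gives the weight 1 needed for boundedness. -/
theorem laplace_sq (h : Generates A T ω) {M w : ℝ}
    (hM : ∀ t, 0 ≤ t → ‖T t‖ ≤ M * Real.exp (w * t)) (hw : w < z.re) (hz : z ∈ rho A) (y : X) :
    ∫ t in Ioi (0 : ℝ), (t : ℂ) • Complex.exp (-z * t) • T t y
      = resolventOp A z (resolventOp A z y) := by
  have hlap := h.laplace hM hw hz
  have hR := isResolventAt_resolventOp hz
  set R := resolventOp A z
  set x : A.domain := ⟨R y, hR.mem_domain y⟩ with hx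
  have h1 : A x - z • (x : X) = -y := by rw [hx, hR.apply_eq]; abel
  have hi1 := h.integrableOn_exp_smul hM hw (x : X)
  have hi2 := h.integrableOn_mul_exp_smul hM hw (A x - z • (x : X))
  have h2 := integral_Ioi_of_hasDerivAt_of_tendsto (a := 0) (m := 0)
    (f := fun t : ℝ => (t : ℂ) • Complex.exp (-z * t) • T t x)
    (f' := fun t : ℝ => Complex.exp (-z * t) • T t x +
      (t : ℂ) • Complex.exp (-z * t) • T t (A x - z • (x : X)))
    (Continuous.smul (by fun_prop) (h.continuous_exp_smul z x)).continuousWithinAt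
    (fun t ht => ?_) (hi1.add hi2) ?_
  · rw [integral_add hi1 hi2, h1] at h2
    simp only [map_neg, smul_neg, integral_neg, Complex.ofReal_zero, zero_smul, sub_zero] at h2
    rw [hlap x] at h2
    rw [← sub_eq_zero, ← neg_eq_zero, neg_sub]
    rw [← h2]
    abel
  · have h3 : HasDerivAt (fun t : ℝ => (t : ℂ)) 1 t := (hasDerivAt_id (t : ℂ)).comp_ofReal
    refine HasDerivAt.congr_deriv (h3.smul (h.hasDerivAt_exp_smul z x ht)) ?_
    rw [one_smul, add_comm]
  · have h3 : Tendsto (fun t : ℝ => M * ‖(x : X)‖ * (t * Real.exp (-(z.re - w) * t))) atTop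
        (𝓝 0) := by
      simpa using (tendsto_mul_exp_neg (by linarith : 0 < z.re - w)).const_mul (M * ‖(x : X)‖)
    refine squeeze_zero_norm' ?_ h3
    filter_upwards [eventually_ge_atTop 0] with t ht
    rw [norm_smul, Complex.norm_real, Real.norm_of_nonneg ht]
    calc _ ≤ t * (M * ‖(x : X)‖ * Real.exp (-(z.re - w) * t)) := by
          gcongr; exact norm_apply_le hM z _ ht
      _ = _ := by ring

end Banach

end Generates

variable {X : Type*} [NormedAddCommGroup X] [InnerProductSpace ℂ X] [CompleteSpace X]

/-- Plancherel's theorem for exponentially decaying functions on the half-line. -/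
theorem lintegral_laplace_sq {g : ℝ → X} (hg : Continuous g) {C c : ℝ} (hc : 0 < c)
    (hb : ∀ t, 0 < t → ‖g t‖ ≤ C * Real.exp (-c * t)) :
    ∫⁻ ξ : ℝ, ‖∫ t in Ioi (0 : ℝ), Complex.exp (-(2 * Real.pi * ξ * Complex.I) * t) • g t‖ₑ ^ 2
      = ∫⁻ t in Ioi (0 : ℝ), ‖g t‖ₑ ^ 2 := by
  have hI : IntegrableOn g (Ioi 0) := by
    refine Integrable.mono' ((integrableOn_exp_mul_Ioi (neg_lt_zero.2 hc) 0).const_mul C)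
      hg.aestronglyMeasurable ?_
    exact (ae_restrict_mem measurableSet_Ioi).mono fun t ht => hb t ht
  have h1 : Integrable (indicator (Ioi 0) g) := (integrable_indicator_iff measurableSet_Ioi).2 hI
  have hm : AEStronglyMeasurable (indicator (Ioi 0) g) volume := h1.1
  have h2 : MemLp (indicator (Ioi 0) g) 2 := by
    rw [memLp_two_iff_integrable_sq_norm hm]
    have h3 : (fun t => ‖indicator (Ioi 0) g t‖ ^ 2) = indicator (Ioi 0) fun t => ‖g t‖ ^ 2 := by
      ext t
      by_cases ht : t ∈ Ioi (0 : ℝ) <;> simp [ht]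
    rw [h3, integrable_indicator_iff measurableSet_Ioi]
    refine Integrable.mono' ((integrableOn_exp_mul_Ioi
      (by linarith : -(2 * c) < 0) 0).const_mul (C ^ 2)) (hg.norm.pow 2).aestronglyMeasurable ?_
    refine (ae_restrict_mem measurableSet_Ioi).mono fun t ht => ?_
    rw [norm_pow, norm_norm]
    calc ‖g t‖ ^ 2 ≤ (C * Real.exp (-c * t)) ^ 2 := by gcongr; exact hb t ht
      _ = C ^ 2 * (Real.exp (-c * t) * Real.exp (-c * t)) := by ring
      _ = _ := by rw [← Real.exp_add]; ring_nf
  have h4 := lintegral_enorm_fourier_sq h1 h2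
  have h5 : ∫⁻ t, ‖indicator (Ioi 0) g t‖ₑ ^ 2 = ∫⁻ t in Ioi (0 : ℝ), ‖g t‖ₑ ^ 2 := by
    rw [← lintegral_indicator measurableSet_Ioi]
    congr 1
    ext t
    by_cases ht : t ∈ Ioi (0 : ℝ) <;> simp [ht]
  rw [← h5, ← h4]
  congr 1
  ext ξ
  congr 2
  rw [Real.fourier_eq', ← integral_indicator measurableSet_Ioi]
  congr 1
  ext t
  by_cases ht : t ∈ Ioi (0 : ℝ)
  · simp only [ht, indicator_of_mem]
    congr 2
    simp
    ring
  · simp [ht]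

namespace Generates

variable {A : X →ₗ.[ℂ] X} {T : ℝ → X →L[ℂ] X} {ω : ℝ}

theorem lintegral_resolventOp_sq (h : Generates A T ω) {M w σ : ℝ}
    (hM : ∀ t, 0 ≤ t → ‖T t‖ ≤ M * Real.exp (w * t)) (hw : w < σ)
    (hz : ∀ z : ℂ, z.re = σ → z ∈ rho A) (y : X) :
    ∫⁻ ξ : ℝ, ‖resolventOp A (σ + 2 * Real.pi * ξ * Complex.I) y‖ₑ ^ 2
      = ∫⁻ t in Ioi (0 : ℝ), ‖Complex.exp (-σ * t) • T t y‖ₑ ^ 2 := by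
  rw [← lintegral_laplace_sq (h.continuous_exp_smul σ y) (sub_pos.2 hw) (C := M * ‖y‖)]
  · congr 1
    ext ξ
    have hre : ((σ : ℂ) + 2 * Real.pi * ξ * Complex.I).re = σ := by simp
    rw [← h.laplace hM (by rw [hre]; exact hw) (hz _ hre)]
    congr 2
    congr 1
    ext t
    rw [smul_smul, ← Complex.exp_add]
    congr 2
    ring
  · intro t ht
    have := norm_apply_le hM (σ : ℂ) y ht.le
    simpa using this

theorem lintegral_resolventOp_resolventOp_sq (h : Generates A T ω) {M w σ : ℝ}
    (hM : ∀ t, 0 ≤ t → ‖T t‖ ≤ M * Real.exp (w * t)) (hw : w < σ)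
    (hz : ∀ z : ℂ, z.re = σ → z ∈ rho A) (y : X) :
    ∫⁻ ξ : ℝ, ‖resolventOp A (σ + 2 * Real.pi * ξ * Complex.I)
        (resolventOp A (σ + 2 * Real.pi * ξ * Complex.I) y)‖ₑ ^ 2
      = ∫⁻ t in Ioi (0 : ℝ), ‖(t : ℂ) • Complex.exp (-σ * t) • T t y‖ₑ ^ 2 := by
  have hM0 : 0 ≤ M := by
    have := (norm_nonneg _).trans (hM 0 le_rfl)
    simpa using this
  rw [← lintegral_laplace_sq (g := fun t : ℝ => (t : ℂ) • Complex.exp (-σ * t) • T t y)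
    (Continuous.smul (by fun_prop) (h.continuous_exp_smul σ y)) (half_pos (sub_pos.2 hw))
    (C := M * ‖y‖ * (2 / (σ - w)))]
  · congr 1
    ext ξ
    have hre : ((σ : ℂ) + 2 * Real.pi * ξ * Complex.I).re = σ := by simp
    rw [← h.laplace_sq hM (by rw [hre]; exact hw) (hz _ hre)]
    congr 2
    congr 1
    ext t
    rw [smul_comm (Complex.exp (-(2 * Real.pi * ξ * Complex.I) * t)), smul_smul,
      smul_smul (Complex.exp (-(2 * Real.pi * ξ * Complex.I) * t)), ← Complex.exp_add, smul_smul]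
    congr 3
    ring
  · intro t ht
    have h1 := norm_apply_le hM (σ : ℂ) y ht.le
    rw [Complex.ofReal_re] at h1
    rw [norm_smul, Complex.norm_real, Real.norm_of_nonneg ht.le]
    calc _ ≤ t * (M * ‖y‖ * Real.exp (-(σ - w) * t)) := by gcongr
      _ = M * ‖y‖ * (t * Real.exp (-(σ - w) * t)) := by ring
      _ ≤ M * ‖y‖ * (2 / (σ - w) * Real.exp (-((σ - w) / 2) * t)) :=
          mul_le_mul_of_nonneg_left (mul_exp_le (sub_pos.2 hw) t) (by positivity)
      _ = _ := by ring

end Generates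

end Laplace

/-! ### Boundedness and decay of semigroups from square integrability of resolvents. -/

section Boundedness

open MeasureTheory

variable {X : Type*} [NormedAddCommGroup X] [InnerProductSpace ℂ X] [CompleteSpace X]

theorem integral_norm_sq_le_of_lintegral {g : ℝ → X} (hg : Continuous g) {c t : ℝ} (hc : 0 ≤ c)
    (ht : 0 ≤ t) (h : ∫⁻ s in Ioi (0 : ℝ), ‖g s‖ₑ ^ 2 ≤ ENNReal.ofReal c) :
    ∫ s in (0 : ℝ)..t, ‖g s‖ ^ 2 ≤ c := by
  rw [intervalIntegral.integral_of_le ht, ← ENNReal.ofReal_le_ofReal_iff hc,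
    ofReal_integral_eq_lintegral_ofReal]
  · refine le_trans ?_ h
    refine (lintegral_mono_set (Ioc_subset_Ioi_self : Ioc 0 t ⊆ Ioi 0)).trans (le_of_eq ?_)
    congr 1
    ext s
    rw [ENNReal.ofReal_pow (norm_nonneg _), ofReal_norm]
  · exact ((hg.norm.pow 2).integrableOn_Icc).mono_set Ioc_subset_Icc_self
  · exact ae_of_all _ fun s => by positivity

theorem opNorm_le_of_inner_le {L : X →L[ℂ] X} {c : ℝ} (hc : 0 ≤ c)
    (h : ∀ x y, ‖⟪L x, y⟫_ℂ‖ ≤ c / 2 * (‖x‖ ^ 2 + ‖y‖ ^ 2)) : ‖L‖ ≤ c := by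
  refine L.opNorm_le_bound hc fun x => ?_
  by_cases hL : L x = 0
  · rw [hL, norm_zero]; positivity
  have hx : x ≠ 0 := fun hx => hL (by rw [hx, map_zero])
  have hL' : 0 < ‖L x‖ := norm_pos_iff.2 hL
  have hx' : 0 < ‖x‖ := norm_pos_iff.2 hx
  -- The test vector is L x rescaled to norm ‖x‖, which makes the quadratic bound homogeneous.
  have h1 := h x (((‖x‖ / ‖L x‖ : ℝ) : ℂ) • L x)
  rw [inner_smul_right, norm_mul, norm_smul, Complex.norm_real, inner_self_eq_norm_sq_to_K,
    Real.norm_of_nonneg (by positivity), norm_pow] at h1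
  simp only [Complex.coe_algebraMap, Complex.norm_real, norm_norm] at h1
  have h2 : ‖x‖ / ‖L x‖ * ‖L x‖ ^ 2 = ‖x‖ * ‖L x‖ := by field_simp
  have h3 : ‖x‖ / ‖L x‖ * ‖L x‖ = ‖x‖ := by field_simp
  rw [h2, h3] at h1
  have h4 : ‖x‖ * ‖L x‖ ≤ ‖x‖ * (c * ‖x‖) := by linarith
  exact le_of_mul_le_mul_left h4 hx'

/-- The resolvent of `A` exists on the open right half-plane and is square integrable on vertical
lines, with the bound that is typical of bounded semigroups. -/
structure SquareBounded (A : X →ₗ.[ℂ] X) (C : ℝ) : Prop where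
  mem_rho : ∀ z : ℂ, 0 < z.re → z ∈ rho A
  lintegral_le : ∀ σ : ℝ, 0 < σ → ∀ x : X,
    ∫⁻ ξ : ℝ, ‖resolventOp A (σ + 2 * Real.pi * ξ * Complex.I) x‖ₑ ^ 2
      ≤ ENNReal.ofReal (C / σ * ‖x‖ ^ 2)

/-- A semigroup together with its adjoint semigroup. -/
structure AdjointPair (A : X →ₗ.[ℂ] X) (T : ℝ → X →L[ℂ] X) (A' : X →ₗ.[ℂ] X)
    (T' : ℝ → X →L[ℂ] X) (ω : ℝ) : Prop where
  left : Generates A T ω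
  right : Generates A' T' ω
  inner_eq : ∀ t : ℝ, 0 ≤ t → ∀ x y : X, ⟪T t x, y⟫_ℂ = ⟪x, T' t y⟫_ℂ

namespace AdjointPair

variable {A A' : X →ₗ.[ℂ] X} {T T' : ℝ → X →L[ℂ] X} {ω C : ℝ}

theorem norm_le_adjoint (h : AdjointPair A T A' T' ω) {t c : ℝ} (ht : 0 ≤ t) (hT : ‖T t‖ ≤ c) :
    ‖T' t‖ ≤ c := by
  have : T' t = ContinuousLinearMap.adjoint (T t) := by
    ext y
    refine ext_inner_left ℂ fun x => ?_
    rw [← h.inner_eq t ht, ContinuousLinearMap.adjoint_inner_right]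
  rw [this, LinearIsometryEquiv.norm_map]
  exact hT

/-- For every s in [0, t] the pairing equals ⟨T(s)x, T'(t - s)y⟩. Averaging against φ and splitting
each product by the weighted arithmetic-geometric mean inequality leaves two L² norms, which
Plancherel evaluates. The weight 1 is used for boundedness, the weight s for decay. -/
theorem mul_norm_inner_le (h : AdjointPair A T A' T' ω) {φ : ℝ → ℝ} (hφ : Continuous φ) {σ t : ℝ}
    (ht : 0 ≤ t) (hφ0 : ∀ s ∈ Icc 0 t, 0 ≤ φ s) {l : ℝ} (hl : 0 < l) (x y : X) :
    (∫ s in (0 : ℝ)..t, φ s) * (Real.exp (-σ * t) * ‖⟪T t x, y⟫_ℂ‖) ≤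
      1 / 2 * (l⁻¹ * (∫ s in (0 : ℝ)..t, ‖(φ s : ℂ) • Complex.exp (-σ * s) • T s x‖ ^ 2) +
        l * ∫ s in (0 : ℝ)..t, ‖Complex.exp (-σ * s) • T' s y‖ ^ 2) := by
  have c1 : Continuous fun s : ℝ => ‖(φ s : ℂ) • Complex.exp (-σ * s) • T s x‖ ^ 2 :=
    ((Continuous.smul (by fun_prop) (h.left.continuous_exp_smul σ x)).norm).pow 2
  have c2 : Continuous fun s : ℝ => ‖Complex.exp (-σ * s) • T' s y‖ ^ 2 :=
    (h.right.continuous_exp_smul σ y).norm.pow 2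
  have e1 : ∫ s in (0 : ℝ)..t, ‖Complex.exp (-σ * s) • T' s y‖ ^ 2
      = ∫ s in (0 : ℝ)..t, ‖Complex.exp (-σ * (t - s : ℝ)) • T' (t - s) y‖ ^ 2 := by
    rw [intervalIntegral.integral_comp_sub_left
      (fun s : ℝ => ‖Complex.exp (-σ * s) • T' s y‖ ^ 2) t]
    simp
  have c2' : Continuous fun s : ℝ => ‖Complex.exp (-σ * (t - s : ℝ)) • T' (t - s) y‖ ^ 2 :=
    c2.comp (continuous_const.sub continuous_id)
  rw [e1, ← intervalIntegral.integral_const_mul, ← intervalIntegral.integral_const_mul,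
    ← intervalIntegral.integral_add ((c1.const_mul _).intervalIntegrable _ _)
      ((c2'.const_mul _).intervalIntegrable _ _), ← intervalIntegral.integral_const_mul,
    ← intervalIntegral.integral_mul_const]
  refine intervalIntegral.integral_mono_on ht ((hφ.mul_const _).intervalIntegrable _ _)
    ((((c1.const_mul _).add (c2'.const_mul _)).const_mul _).intervalIntegrable _ _) fun s hs => ?_
  have e2 : ⟪T t x, y⟫_ℂ = ⟪T s x, T' (t - s) y⟫_ℂ := by
    have : T t = T (t - s) * T s := by
      rw [← h.left.map_add _ _ (by linarith [hs.2]) hs.1, sub_add_cancel]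
    rw [this]
    exact h.inner_eq _ (by linarith [hs.2]) _ _
  have e3 : φ s * (Real.exp (-σ * t) * ‖⟪T t x, y⟫_ℂ‖) ≤
      ‖(φ s : ℂ) • Complex.exp (-σ * s) • T s x‖ *
        ‖Complex.exp (-σ * (t - s : ℝ)) • T' (t - s) y‖ := by
    rw [norm_smul, norm_smul, norm_smul, Complex.norm_exp, Complex.norm_exp, Complex.norm_real,
      Real.norm_of_nonneg (hφ0 s hs)]
    have r1 : (-(σ : ℂ) * s).re = -σ * s := by simp
    have r2 : (-(σ : ℂ) * (t - s : ℝ)).re = -σ * (t - s) := by simp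
    rw [r1, r2]
    have r3 : Real.exp (-σ * t) = Real.exp (-σ * s) * Real.exp (-σ * (t - s)) := by
      rw [← Real.exp_add]; ring_nf
    rw [r3, e2]
    have := norm_inner_le_norm (𝕜 := ℂ) (T s x) (T' (t - s) y)
    have hφs := hφ0 s hs
    calc _ ≤ φ s * (Real.exp (-σ * s) * Real.exp (-σ * (t - s)) *
          (‖T s x‖ * ‖T' (t - s) y‖)) := by gcongr
      _ = _ := by ring
  refine e3.trans ?_
  set a := ‖(φ s : ℂ) • Complex.exp (-σ * s) • T s x‖
  set b := ‖Complex.exp (-σ * (t - s : ℝ)) • T' (t - s) y‖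
  have : 0 ≤ l⁻¹ * (a - l * b) ^ 2 := by positivity
  have e4 : l⁻¹ * (a - l * b) ^ 2 = l⁻¹ * a ^ 2 - 2 * (a * b) + l * b ^ 2 := by
    field_simp
    ring
  linarith

/-- Plancherel is available only on lines to the right of a known growth rate w, but the bound
obtained there does not involve M or w. This makes a bootstrap possible. -/
theorem norm_le_of_growth (h : AdjointPair A T A' T' ω) (hC : 0 ≤ C) (hA : SquareBounded A C)
    (hA' : SquareBounded A' C) {M w σ : ℝ} (hM : ∀ t, 0 ≤ t → ‖T t‖ ≤ M * Real.exp (w * t))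
    (hw : w < σ) (hσ : 0 < σ) {t : ℝ} (ht : 0 < t) :
    ‖T t‖ ≤ C / (σ * t) * Real.exp (σ * t) := by
  refine opNorm_le_of_inner_le (by positivity) fun x y => ?_
  have h1 := h.mul_norm_inner_le (φ := fun _ => 1) continuous_const (σ := σ) ht.le
    (fun _ _ => zero_le_one) one_pos x y
  have hre : ∀ z : ℂ, z.re = σ → 0 < z.re := fun z hz => by rw [hz]; exact hσ
  have h2 : ∫ s in (0 : ℝ)..t, ‖Complex.exp (-σ * s) • T s x‖ ^ 2 ≤ C / σ * ‖x‖ ^ 2 := by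
    refine integral_norm_sq_le_of_lintegral (h.left.continuous_exp_smul σ x) (by positivity) ht.le ?_
    rw [← h.left.lintegral_resolventOp_sq hM hw fun z hz => hA.mem_rho z (hre z hz)]
    exact hA.lintegral_le σ hσ x
  have h3 : ∫ s in (0 : ℝ)..t, ‖Complex.exp (-σ * s) • T' s y‖ ^ 2 ≤ C / σ * ‖y‖ ^ 2 := by
    refine integral_norm_sq_le_of_lintegral (h.right.continuous_exp_smul σ y) (by positivity)
      ht.le ?_
    rw [← h.right.lintegral_resolventOp_sq (fun t ht => h.norm_le_adjoint ht (hM t ht)) hw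
      fun z hz => hA'.mem_rho z (hre z hz)]
    exact hA'.lintegral_le σ hσ y
  simp only [intervalIntegral.integral_const, sub_zero, smul_eq_mul, mul_one, Complex.ofReal_one,
    one_smul, inv_one, one_mul] at h1
  have h4 : t * (Real.exp (-σ * t) * ‖⟪T t x, y⟫_ℂ‖) ≤ C / (2 * σ) * (‖x‖ ^ 2 + ‖y‖ ^ 2) := by
    calc _ ≤ 1 / 2 * (C / σ * ‖x‖ ^ 2 + C / σ * ‖y‖ ^ 2) := by linarith
      _ = _ := by field_simp
  have h5 : ‖⟪T t x, y⟫_ℂ‖ = t⁻¹ * Real.exp (σ * t) * (t * (Real.exp (-σ * t) * ‖⟪T t x, y⟫_ℂ‖)) := by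
    have : Real.exp (σ * t) * Real.exp (-σ * t) = 1 := by rw [← Real.exp_add]; simp
    calc _ = (Real.exp (σ * t) * Real.exp (-σ * t)) * ‖⟪T t x, y⟫_ℂ‖ := by rw [this, one_mul]
      _ = _ := by field_simp
  rw [h5]
  calc _ ≤ t⁻¹ * Real.exp (σ * t) * (C / (2 * σ) * (‖x‖ ^ 2 + ‖y‖ ^ 2)) := by gcongr
    _ = _ := by field_simp

end AdjointPair

/-- Write T(t) as a power of T(t₀) times T(r) with 0 ≤ r < t₀, and estimate the remainder by the
crude rate ω. -/
theorem Generates.exists_growth_of_norm_le {A : X →ₗ.[ℂ] X} {T : ℝ → X →L[ℂ] X} {ω : ℝ}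
    (h : Generates A T ω) {w t₀ : ℝ} (hω : 0 ≤ ω) (hw : 0 ≤ w) (ht₀ : 0 < t₀)
    (hT : ‖T t₀‖ ≤ Real.exp (w * t₀)) :
    ∃ M, ∀ t, 0 ≤ t → ‖T t‖ ≤ M * Real.exp (w * t) := by
  have hpow : ∀ n : ℕ, T (n * t₀) = T t₀ ^ n := by
    intro n
    induction n with
    | zero => simp [h.map_zero]
    | succ n ih =>
      push_cast
      rw [add_mul, one_mul, h.map_add _ _ (by positivity) ht₀.le, ih, pow_succ]
  refine ⟨Real.exp (ω * t₀), fun t ht => ?_⟩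
  set n := ⌊t / t₀⌋₊ with hn
  have h1 : (n : ℝ) ≤ t / t₀ := Nat.floor_le (by positivity)
  have h2 : t / t₀ < n + 1 := Nat.lt_floor_add_one _
  rw [le_div_iff₀ ht₀] at h1
  rw [div_lt_iff₀ ht₀] at h2
  have hr : 0 ≤ t - n * t₀ := by linarith
  have e1 : T t = T t₀ ^ n * T (t - n * t₀) := by
    rw [← hpow, ← h.map_add _ _ (by positivity) hr]; congr 1; ring
  have h3 : ‖T t₀ ^ n‖ ≤ Real.exp (w * t₀) ^ n := by
    rcases Nat.eq_zero_or_pos n with h0 | h0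
    · rw [h0, pow_zero, pow_zero]
      exact ContinuousLinearMap.norm_id_le
    · exact (norm_pow_le' _ h0).trans (by gcongr)
  rw [e1]
  calc _ ≤ ‖T t₀ ^ n‖ * ‖T (t - n * t₀)‖ := norm_mul_le _ _
    _ ≤ Real.exp (w * t₀) ^ n * Real.exp (ω * (t - n * t₀)) := by
        gcongr
        exact h.norm_le _ hr
    _ ≤ Real.exp (w * t) * Real.exp (ω * t₀) := by
        rw [← Real.exp_nat_mul]
        refine mul_le_mul (Real.exp_le_exp.2 ?_) (Real.exp_le_exp.2 ?_) (Real.exp_pos _).le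
          (Real.exp_pos _).le
        · calc n * (w * t₀) = w * (n * t₀) := by ring
            _ ≤ w * t := by gcongr
        · exact mul_le_mul_of_nonneg_left (by linarith) hω
    _ = _ := mul_comm _ _

namespace AdjointPair

variable {A A' : X →ₗ.[ℂ] X} {T T' : ℝ → X →L[ℂ] X} {ω C : ℝ}

/-- One bootstrap step: a rate w > 0 is multiplied by a factor below 1 that depends only on C. -/
theorem growth_improve (h : AdjointPair A T A' T' ω) (hω : 0 ≤ ω) (hC : 1 ≤ C)
    (hA : SquareBounded A C) (hA' : SquareBounded A' C) {M w : ℝ} (hw : 0 < w)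
    (hM : ∀ t, 0 ≤ t → ‖T t‖ ≤ M * Real.exp (w * t)) :
    ∃ M', ∀ t, 0 ≤ t →
      ‖T t‖ ≤ M' * Real.exp (w * (1 - (1 / (Real.exp 1 * C)) ^ 2) * t) := by
  set e := 1 / (Real.exp 1 * C) with he
  have hexp : 1 < Real.exp 1 := by simp
  have he0 : 0 < e := by positivity
  have he1 : e < 1 := by
    rw [he, div_lt_one (by positivity)]
    nlinarith
  -- With t₀ = 1/(eσ) the prefactor C/(σt₀) equals exp(-1), so ‖T(t₀)‖ ≤ exp(σt₀ - 1) = exp((σ -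
  -- eσ)t₀), and σ - eσ = w(1 - e²).
  set σ := w * (1 + e) with hσ
  have hσ0 : 0 < σ := by positivity
  have hwσ : w < σ := by rw [hσ]; nlinarith
  set t₀ := 1 / (e * σ) with ht₀
  have ht₀0 : 0 < t₀ := by positivity
  refine h.left.exists_growth_of_norm_le hω (mul_nonneg hw.le (by nlinarith)) ht₀0 ?_
  refine (h.norm_le_of_growth (by linarith) hA hA' hM hwσ hσ0 ht₀0).trans (le_of_eq ?_)
  have h1 : C / (σ * t₀) = Real.exp (-1) := by
    rw [Real.exp_neg, ht₀, he]
    field_simp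
  rw [h1, ← Real.exp_add]
  congr 1
  have h2 : e * σ * t₀ = 1 := by rw [ht₀]; field_simp
  have h3 : w * (1 - e ^ 2) = σ - e * σ := by rw [hσ]; ring
  rw [h3, sub_mul, h2]
  ring

theorem exists_norm_le (h : AdjointPair A T A' T' ω) (hω : 0 < ω) (hC : 1 ≤ C)
    (hA : SquareBounded A C) (hA' : SquareBounded A' C) :
    ∃ K, 1 ≤ K ∧ ∀ t, 0 ≤ t → ‖T t‖ ≤ K := by
  set q := 1 - (1 / (Real.exp 1 * C)) ^ 2 with hq
  have hexp : 1 < Real.exp 1 := by simp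
  have he0 : 0 < 1 / (Real.exp 1 * C) := by positivity
  have he1 : 1 / (Real.exp 1 * C) < 1 := by
    rw [div_lt_one (by positivity)]
    nlinarith
  have hq0 : 0 < q := by rw [hq]; nlinarith
  have hq1 : q < 1 := by rw [hq]; nlinarith [pow_pos he0 2]
  have hgrow : ∀ k : ℕ, ∃ M, ∀ t, 0 ≤ t → ‖T t‖ ≤ M * Real.exp (ω * q ^ k * t) := by
    intro k
    induction k with
    | zero => exact ⟨1, fun t ht => by simpa using h.left.norm_le t ht⟩
    | succ k ih =>
      obtain ⟨M, hM⟩ := ih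
      obtain ⟨M', hM'⟩ := h.growth_improve hω.le hC hA hA' (by positivity) hM
      refine ⟨M', fun t ht => ?_⟩
      have := hM' t ht
      rwa [← hq, mul_assoc ω, ← pow_succ] at this
  have hexpC : 1 ≤ C * Real.exp 1 := by nlinarith
  refine ⟨C * Real.exp 1, hexpC, fun t ht => ?_⟩
  rcases ht.eq_or_lt with h0 | h0
  · rw [← h0, h.left.map_zero]
    exact ContinuousLinearMap.norm_id_le.trans hexpC
  -- After k improvements, with k depending on t, the rate is below 1/t and the line σ = 1/t is
  -- admissible; the bound C/(σt) exp(σt) is then C exp(1), uniformly in t.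
  · obtain ⟨k, hk⟩ := exists_pow_lt_of_lt_one (show 0 < 1 / t / ω by positivity) hq1
    obtain ⟨M, hM⟩ := hgrow k
    have := h.norm_le_of_growth (by linarith) hA hA' hM (σ := 1 / t)
      (by rw [lt_div_iff₀ hω] at hk; linarith) (by positivity) h0
    rwa [one_div_mul_cancel h0.ne', div_one] at this

/-- The weight s turns the resolvent into its square, and commutation gives R²F = (RF)R, so the
uniform bound N on RF leaves one square-integrable resolvent. On the line σ = 1/t the weight
integrates to t²/2 against L² norms of order t, which yields the rate 1/t. -/
theorem norm_mul_le_div (h : AdjointPair A T A' T' ω) (hC : 0 ≤ C)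
    (hA : SquareBounded A C) (hA' : SquareBounded A' C) {K : ℝ} (hK : ∀ t, 0 ≤ t → ‖T t‖ ≤ K)
    {F : X →L[ℂ] X} {N : ℝ} (hN : 0 < N)
    (hcomm : ∀ z : ℂ, 0 < z.re → Commute (resolventOp A z) F)
    (hF : ∀ z : ℂ, 0 < z.re → ‖resolventOp A z * F‖ ≤ N) {t : ℝ} (ht : 0 < t) :
    ‖T t * F‖ ≤ 2 * Real.exp 1 * C * N / t := by
  refine opNorm_le_of_inner_le (by positivity) fun x y => ?_
  have hM : ∀ t, 0 ≤ t → ‖T t‖ ≤ K * Real.exp (0 * t) := by simpa using hK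
  have hσ : 0 < 1 / t := by positivity
  have h1 := h.mul_norm_inner_le (φ := fun s => s) continuous_id (σ := 1 / t) ht.le
    (fun _ hs => hs.1) hN (F x) y
  have hre : ∀ z : ℂ, z.re = 1 / t → 0 < z.re := fun z hz => by rw [hz]; exact hσ
  have h2 : ∫ s in (0 : ℝ)..t, ‖(s : ℂ) • Complex.exp (-(1 / t : ℝ) * s) • T s (F x)‖ ^ 2
      ≤ N ^ 2 * (C * t * ‖x‖ ^ 2) := by
    refine integral_norm_sq_le_of_lintegral
      (g := fun s : ℝ => (s : ℂ) • Complex.exp (-(1 / t : ℝ) * s) • T s (F x))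
      (Continuous.smul (by fun_prop) (h.left.continuous_exp_smul _ _)) (by positivity) ht.le ?_
    rw [← h.left.lintegral_resolventOp_resolventOp_sq hM hσ fun z hz => hA.mem_rho z (hre z hz)]
    have h3 : ∀ ξ : ℝ, ‖resolventOp A ((1 / t : ℝ) + 2 * Real.pi * ξ * Complex.I)
        (resolventOp A ((1 / t : ℝ) + 2 * Real.pi * ξ * Complex.I) (F x))‖ₑ ^ 2 ≤
        ENNReal.ofReal (N ^ 2) *
          ‖resolventOp A ((1 / t : ℝ) + 2 * Real.pi * ξ * Complex.I) x‖ₑ ^ 2 := by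
      intro ξ
      have hre' : 0 < ((1 / t : ℝ) + 2 * Real.pi * ξ * Complex.I : ℂ).re := by simpa using ht
      set R := resolventOp A ((1 / t : ℝ) + 2 * Real.pi * ξ * Complex.I)
      have h4 : R (R (F x)) = (R * F) (R x) := by
        change R (R (F x)) = R (F (R x))
        exact congrArg (fun S : X →L[ℂ] X => R (S x)) (hcomm _ hre').eq
      rw [h4, ENNReal.ofReal_pow hN.le, ← mul_pow]
      gcongr
      rw [← ofReal_norm, ← ofReal_norm (R x), ← ENNReal.ofReal_mul hN.le]
      exact ENNReal.ofReal_le_ofReal (ContinuousLinearMap.le_of_opNorm_le _ (hF _ hre') _)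
    refine (lintegral_mono h3).trans ?_
    rw [lintegral_const_mul', ENNReal.ofReal_mul (by positivity)]
    · gcongr
      refine (hA.lintegral_le _ hσ x).trans (le_of_eq ?_)
      congr 1
      field_simp
    · exact ENNReal.ofReal_ne_top
  have h3 : ∫ s in (0 : ℝ)..t, ‖Complex.exp (-(1 / t : ℝ) * s) • T' s y‖ ^ 2
      ≤ C * t * ‖y‖ ^ 2 := by
    refine integral_norm_sq_le_of_lintegral (h.right.continuous_exp_smul _ y) (by positivity)
      ht.le ?_
    rw [← h.right.lintegral_resolventOp_sq (fun t ht => h.norm_le_adjoint ht (hM t ht)) hσ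
      fun z hz => hA'.mem_rho z (hre z hz)]
    refine (hA'.lintegral_le _ hσ y).trans (le_of_eq ?_)
    congr 1
    field_simp
  rw [integral_id] at h1
  have h4 : -(1 / t) * t = -1 := by field_simp
  rw [h4] at h1
  have h5 : (t ^ 2 - 0 ^ 2) / 2 * (Real.exp (-1) * ‖⟪T t (F x), y⟫_ℂ‖) ≤
      1 / 2 * (N * C * t * (‖x‖ ^ 2 + ‖y‖ ^ 2)) := by
    calc _ ≤ 1 / 2 * (N⁻¹ * (N ^ 2 * (C * t * ‖x‖ ^ 2)) + N * (C * t * ‖y‖ ^ 2)) :=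
          h1.trans (by gcongr)
      _ = _ := by field_simp
  have h6 : ‖⟪T t (F x), y⟫_ℂ‖ = 2 * Real.exp 1 / t ^ 2 *
      ((t ^ 2 - 0 ^ 2) / 2 * (Real.exp (-1) * ‖⟪T t (F x), y⟫_ℂ‖)) := by
    have : Real.exp 1 * Real.exp (-1) = 1 := by rw [← Real.exp_add]; simp
    calc _ = (Real.exp 1 * Real.exp (-1)) * ‖⟪T t (F x), y⟫_ℂ‖ := by rw [this, one_mul]
      _ = _ := by field_simp; ring
  change ‖⟪T t (F x), y⟫_ℂ‖ ≤ _
  rw [h6]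
  calc _ ≤ 2 * Real.exp 1 / t ^ 2 * (1 / 2 * (N * C * t * (‖x‖ ^ 2 + ‖y‖ ^ 2))) := by gcongr
    _ = _ := by field_simp

end AdjointPair

end Boundedness

/-! ### Polynomial decay by frequency splitting. -/

section Decay

section Banach

variable {X : Type*} [NormedAddCommGroup X] [NormedSpace ℂ X] [CompleteSpace X]
  {A : X →ₗ.[ℂ] X}

/-- The low-frequency filter `a R(a, A)`. -/
def lowPass (A : X →ₗ.[ℂ] X) (a : ℝ) : X →L[ℂ] X := (a : ℂ) • resolventOp A a

theorem norm_clm_pow_le {S : X →L[ℂ] X} {K : ℝ} (h : ‖S‖ ≤ K) (n : ℕ) : ‖S ^ n‖ ≤ K ^ n := by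
  rcases Nat.eq_zero_or_pos n with h0 | h0
  · rw [h0, pow_zero, pow_zero]
    exact ContinuousLinearMap.norm_id_le
  · exact (norm_pow_le' _ h0).trans (by gcongr)

theorem commute_resolventOp {z w : ℂ} (hz : z ∈ rho A) (hw : w ∈ rho A) :
    Commute (resolventOp A z) (resolventOp A w) :=
  (isResolventAt_resolventOp hz).commute (isResolventAt_resolventOp hw)

theorem commute_lowPass {a : ℝ} (ha : (a : ℂ) ∈ rho A) {z : ℂ} (hz : z ∈ rho A) :
    Commute (resolventOp A z) (lowPass A a) :=
  (commute_resolventOp hz ha).smul_right _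

/-- The resolvent identity gives R(z)E = a/(a - z) (R(z) - R(a)) for the filter E = aR(a). Each
further power of E thus gains the factor a/s on the main term and adds a bounded error. -/
theorem norm_resolventOp_mul_lowPass_pow_le {a s K : ℝ} {z : ℂ} (ha : 1 ≤ a)
    (haρ : (a : ℂ) ∈ rho A) (hz : z ∈ rho A) (has : a ≤ s) (hs : s ≤ ‖(a : ℂ) - z‖) (hK : 1 ≤ K)
    (hE : ‖lowPass A a‖ ≤ K) (j : ℕ) :
    ‖resolventOp A z * lowPass A a ^ j‖ ≤ (a / s) ^ j * ‖resolventOp A z‖ + j * K ^ (j + 1) := by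
  have hs0 : 0 < s := by linarith
  have has1 : a / s ≤ 1 := (div_le_one hs0).2 has
  have has0 : 0 ≤ a / s := by positivity
  have hRa : ‖resolventOp A a‖ ≤ K := by
    have h1 : a * ‖resolventOp A a‖ ≤ K := by
      rw [lowPass, norm_smul, Complex.norm_real, Real.norm_of_nonneg (by linarith)] at hE
      exact hE
    have := norm_nonneg (resolventOp A a)
    nlinarith
  induction j with
  | zero => simp
  | succ j ih =>
    have hne : (a : ℂ) - z ≠ 0 := by
      intro h0; rw [h0, norm_zero] at hs; linarith
    have e1 : resolventOp A z * lowPass A a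
        = ((a : ℂ) / (a - z)) • (resolventOp A z - resolventOp A a) := by
      rw [(isResolventAt_resolventOp hz).sub_eq (isResolventAt_resolventOp haρ), smul_smul,
        div_mul_cancel₀ _ hne, lowPass, mul_smul_comm]
    have e2 : resolventOp A z * lowPass A a ^ (j + 1) = ((a : ℂ) / (a - z)) •
        (resolventOp A z * lowPass A a ^ j - resolventOp A a * lowPass A a ^ j) := by
      rw [pow_succ', ← mul_assoc, e1, smul_mul_assoc, sub_mul]
    have hn : ‖(a : ℂ) / (a - z)‖ ≤ a / s := by
      rw [norm_div, Complex.norm_real, Real.norm_of_nonneg (by linarith)]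
      gcongr
    rw [e2, norm_smul]
    have h3 : ‖resolventOp A a * lowPass A a ^ j‖ ≤ K ^ (j + 1) := by
      rw [pow_succ']
      exact (norm_mul_le _ _).trans (mul_le_mul hRa (norm_clm_pow_le hE j) (norm_nonneg _)
        (by linarith))
    have hK1 : K ^ (j + 1) ≤ K ^ (j + 1 + 1) := pow_le_pow_right₀ hK (by omega)
    have hKp : 0 ≤ K ^ (j + 1) := by positivity
    calc _ ≤ a / s * (((a / s) ^ j * ‖resolventOp A z‖ + j * K ^ (j + 1)) + K ^ (j + 1)) := by
          gcongr
          exact (norm_sub_le _ _).trans (add_le_add ih h3)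
      _ = (a / s) ^ (j + 1) * ‖resolventOp A z‖ + a / s * ((j + 1) * K ^ (j + 1)) := by ring
      _ ≤ (a / s) ^ (j + 1) * ‖resolventOp A z‖ + 1 * ((j + 1) * K ^ (j + 1 + 1)) := by gcongr
      _ = _ := by push_cast; ring

/-- If |Im z| ≤ a the growth of the resolvent is already at most of order a^α. If |Im z| ≥ a, the
gain (a/|Im z|)^⌈α⌉ ≤ (a/|Im z|)^α cancels the growth |Im z|^α. -/
theorem norm_resolventOp_mul_lowPass_le {α N K : ℝ} (hα : 0 < α) (hN : 0 ≤ N) (hK : 1 ≤ K)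
    (hρ : ∀ z : ℂ, 0 ≤ z.re → z ∈ rho A)
    (hR : ∀ z : ℂ, 0 ≤ z.re → ‖resolventOp A z‖ ≤ N * (1 + |z.im| ^ α))
    (hE : ∀ a : ℝ, 1 ≤ a → ‖lowPass A a‖ ≤ K) {a : ℝ} (ha : 1 ≤ a) {z : ℂ} (hz : 0 ≤ z.re) :
    ‖resolventOp A z * lowPass A a ^ ⌈α⌉₊‖ ≤
      (2 * N * K ^ ⌈α⌉₊ + ⌈α⌉₊ * K ^ (⌈α⌉₊ + 1)) * a ^ α := by
  set n := ⌈α⌉₊ with hn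
  have hnα : α ≤ n := Nat.le_ceil α
  have haα : 1 ≤ a ^ α := Real.one_le_rpow ha hα.le
  have ha0 : 0 < a := by linarith
  have hKn : 1 ≤ K ^ n := one_le_pow₀ hK
  rcases le_total |z.im| a with h | h
  · have h1 : |z.im| ^ α ≤ a ^ α := Real.rpow_le_rpow (abs_nonneg _) h hα.le
    calc _ ≤ ‖resolventOp A z‖ * ‖lowPass A a ^ n‖ := norm_mul_le _ _
      _ ≤ N * (1 + |z.im| ^ α) * K ^ n := by
          gcongr
          · exact hR z hz
          · exact norm_clm_pow_le (hE a ha) n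
      _ ≤ N * (a ^ α + a ^ α) * K ^ n := by gcongr
      _ = 2 * N * K ^ n * a ^ α := by ring
      _ ≤ _ := by
          gcongr
          have : 0 ≤ n * K ^ (n + 1) := by positivity
          linarith
  · set s := |z.im| with hs
    have hs0 : 0 < s := by linarith
    have h1 : s ≤ ‖(a : ℂ) - z‖ := by
      have := Complex.abs_im_le_norm ((a : ℂ) - z)
      simpa [abs_neg] using this
    refine (norm_resolventOp_mul_lowPass_pow_le ha (hρ _ (by simpa using ha0.le)) (hρ z hz) h h1 hK
      (hE a ha) n).trans ?_
    have h2 : (a / s) ^ n ≤ (a / s) ^ α := by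
      rw [← Real.rpow_natCast]
      exact Real.rpow_le_rpow_of_exponent_ge (by positivity) ((div_le_one hs0).2 h) hnα
    have h3 : 1 ≤ s ^ α := Real.one_le_rpow (by linarith) hα.le
    have h4 : (a / s) ^ n * ‖resolventOp A z‖ ≤ 2 * N * a ^ α := by
      calc _ ≤ (a / s) ^ α * (N * (1 + s ^ α)) := by
            gcongr
            exact hR z hz
        _ ≤ (a / s) ^ α * (N * (s ^ α + s ^ α)) := by gcongr
        _ = 2 * N * ((a / s) ^ α * s ^ α) := by ring
        _ = 2 * N * a ^ α := by
            rw [← Real.mul_rpow (by positivity) hs0.le, div_mul_cancel₀ _ hs0.ne']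
    calc _ ≤ 2 * N * 1 * a ^ α + n * K ^ (n + 1) * 1 := by linarith
      _ ≤ 2 * N * K ^ n * a ^ α + n * K ^ (n + 1) * a ^ α := by gcongr
      _ = _ := by ring

theorem sub_mul_lowPass {a : ℝ} (ha : (a : ℂ) ∈ rho A) (h0 : (0 : ℂ) ∈ rho A) :
    resolventOp A 0 * (1 - lowPass A a) = resolventOp A a := by
  have := (isResolventAt_resolventOp h0).sub_eq (isResolventAt_resolventOp ha)
  rw [sub_zero, ← mul_smul_comm] at this
  rw [mul_sub, mul_one, lowPass, ← this]
  abel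

/-- The derivative of bR(b) is (1 - bR(b))R(b), and R(0)(1 - bR(b)) = R(b), so R(0) is consumed:
only b⁻² times a pure power of the filter remains, to which the decay of T(t) times filter powers
applies. -/
theorem hasDerivAt_mul_lowPass_pow {a : ℝ} (ha0 : 0 < a) (ha : (a : ℂ) ∈ rho A)
    (h0 : (0 : ℂ) ∈ rho A) (m : ℕ) :
    HasDerivAt (fun b : ℝ => resolventOp A 0 * lowPass A b ^ m)
      (((m / a ^ 2 : ℝ) : ℂ) • lowPass A a ^ (m + 1)) a := by
  have hac : (a : ℂ) ≠ 0 := Complex.ofReal_ne_zero.2 ha0.ne'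
  have hE : HasDerivAt (fun b : ℝ => lowPass A b)
      (resolventOp A a - (a : ℂ) • (resolventOp A a * resolventOp A a)) a := by
    have h1 : HasDerivAt (fun b : ℝ => (b : ℂ)) 1 a := (hasDerivAt_id (a : ℂ)).comp_ofReal
    have h2 := (hasDerivAt_resolventOp ha).scomp a h1
    refine HasDerivAt.congr_deriv (h1.smul h2) ?_
    simp only [one_smul, smul_neg, Function.comp_apply]
    abel
  induction m with
  | zero => simpa using hasDerivAt_const a (resolventOp A 0)
  | succ m ih =>
    have h1 := ih.mul hE
    have e1 : (fun b : ℝ => resolventOp A 0 * lowPass A b ^ (m + 1))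
        = fun b => (resolventOp A 0 * lowPass A b ^ m) * lowPass A b := by
      ext1 b; rw [pow_succ, mul_assoc]
    rw [e1]
    refine HasDerivAt.congr_deriv h1 ?_
    have e2 : resolventOp A a - (a : ℂ) • (resolventOp A a * resolventOp A a)
        = (1 - lowPass A a) * resolventOp A a := by
      rw [sub_mul, one_mul, lowPass, smul_mul_assoc]
    have c1 : Commute (resolventOp A 0) (lowPass A a ^ m) := (commute_lowPass ha h0).pow_right m
    have e3 : resolventOp A 0 * lowPass A a ^ m *
        (resolventOp A a - (a : ℂ) • (resolventOp A a * resolventOp A a))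
        = lowPass A a ^ m * (resolventOp A a * resolventOp A a) := by
      rw [e2, c1.eq, mul_assoc, ← mul_assoc (resolventOp A 0), sub_mul_lowPass ha h0]
    have e4 : resolventOp A a * resolventOp A a
        = (((1 / a ^ 2 : ℝ)) : ℂ) • lowPass A a ^ 2 := by
      rw [pow_two (lowPass A a), lowPass, smul_mul_assoc, mul_smul_comm, smul_smul, smul_smul]
      push_cast
      have : 1 / (a : ℂ) ^ 2 * a * a = 1 := by field_simp
      rw [this, one_smul]
    rw [e3, e4, smul_mul_assoc, ← pow_succ, mul_smul_comm, ← pow_add, ← add_smul]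
    congr 1
    push_cast
    ring

end Banach

variable {X : Type*} [NormedAddCommGroup X] [InnerProductSpace ℂ X] [CompleteSpace X]
  {A A' : X →ₗ.[ℂ] X} {T T' : ℝ → X →L[ℂ] X} {ω C : ℝ}

theorem Generates.norm_lowPass_le (h : Generates A T ω) {K : ℝ} (hK : ∀ t, 0 ≤ t → ‖T t‖ ≤ K)
    {a : ℝ} (ha : 0 < a) (hρ : (a : ℂ) ∈ rho A) : ‖lowPass A a‖ ≤ K := by
  have hK0 : 0 ≤ K := (norm_nonneg _).trans (hK 0 le_rfl)
  have hM : ∀ t, 0 ≤ t → ‖T t‖ ≤ K * Real.exp (0 * t) := by simpa using hK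
  have hR : ‖resolventOp A a‖ ≤ K / a := by
    refine ContinuousLinearMap.opNorm_le_bound _ (by positivity) fun y => ?_
    rw [← h.laplace hM (by simpa using ha) hρ y]
    have h1 : ∀ t ∈ Ioi (0 : ℝ), ‖Complex.exp (-(a : ℂ) * t) • T t y‖
        ≤ K * ‖y‖ * Real.exp (-a * t) := fun t ht => by
      have := norm_apply_le hM (a : ℂ) y (le_of_lt ht)
      simpa using this
    refine (MeasureTheory.norm_integral_le_of_norm_le
      ((integrableOn_exp_mul_Ioi (neg_lt_zero.2 ha) 0).const_mul (K * ‖y‖))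
      ((MeasureTheory.ae_restrict_mem measurableSet_Ioi).mono h1)).trans (le_of_eq ?_)
    rw [MeasureTheory.integral_const_mul, integral_exp_mul_Ioi (neg_lt_zero.2 ha)]
    simp
    field_simp
  rw [lowPass, norm_smul, Complex.norm_real, Real.norm_of_nonneg ha.le]
  calc a * ‖resolventOp A a‖ ≤ a * (K / a) := by gcongr
    _ = K := by field_simp

/-- By commutation T(t)F^k = (T(t/k)F)^k. -/
theorem AdjointPair.norm_mul_pow_le (h : AdjointPair A T A' T' ω) {F : X →L[ℂ] X}
    (hc : ∀ t, 0 ≤ t → Commute (T t) F) {c : ℝ}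
    (hF : ∀ t, 0 < t → ‖T t * F‖ ≤ c / t) {k : ℕ} (hk : 0 < k) {t : ℝ} (ht : 0 < t) :
    ‖T t * F ^ k‖ ≤ (c * k / t) ^ k := by
  have hk' : (0 : ℝ) < k := by exact_mod_cast hk
  have hpow : ∀ (n : ℕ) (s : ℝ), 0 ≤ s → T (n * s) = T s ^ n := by
    intro n s hs
    induction n with
    | zero => simp [h.left.map_zero]
    | succ n ih =>
      push_cast
      rw [add_mul, one_mul, h.left.map_add _ _ (by positivity) hs, ih, pow_succ]
  have e1 : T t * F ^ k = (T (t / k) * F) ^ k := by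
    rw [(hc _ (by positivity)).mul_pow, ← hpow k _ (by positivity), mul_div_cancel₀ _ hk'.ne']
  rw [e1]
  refine norm_clm_pow_le ((hF _ (by positivity)).trans (le_of_eq ?_)) k
  field_simp

/-- The Borichev--Tomilov theorem: polynomial growth of the resolvent on the imaginary axis gives
polynomial decay of the semigroup. -/
theorem AdjointPair.polynomial_decay (h : AdjointPair A T A' T' ω) (hω : 0 < ω) (hC : 1 ≤ C)
    (hA : SquareBounded A C) (hA' : SquareBounded A' C) {α N : ℝ} (hα : 0 < α) (hN : 0 < N)
    (hρ : ∀ z : ℂ, 0 ≤ z.re → z ∈ rho A)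
    (hR : ∀ z : ℂ, 0 ≤ z.re → ‖resolventOp A z‖ ≤ N * (1 + |z.im| ^ α)) :
    ∃ M : ℝ, 0 < M ∧ ∀ t : ℝ, 0 < t → ‖T t * resolventOp A 0‖ ≤ M / t ^ (1 / α) := by
  obtain ⟨K, hK1, hK⟩ := h.exists_norm_le hω hC hA hA'
  have hK0 : 0 < K := by linarith
  have h0 : (0 : ℂ) ∈ rho A := hρ 0 (by simp)
  have hρr : ∀ a : ℝ, 0 ≤ a → (a : ℂ) ∈ rho A := fun a ha => hρ _ (by simpa using ha)
  have hE : ∀ a : ℝ, 0 < a → ‖lowPass A a‖ ≤ K := fun a ha =>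
    h.left.norm_lowPass_le hK ha (hρr a ha.le)
  have hcE : ∀ a : ℝ, 0 ≤ a → ∀ t, 0 ≤ t → Commute (T t) (lowPass A a) := fun a ha t ht =>
    (h.left.commute _ _ (isResolventAt_resolventOp (hρr a ha)) t ht).smul_right _
  set n := ⌈α⌉₊ with hn
  set N₁ := 2 * N * K ^ n + n * K ^ (n + 1) with hN₁
  have hN₁0 : 0 < N₁ := by positivity
  -- This k makes αk > 1. The function b^(αk - 2) then has a primitive of positive exponent, and the
  -- low-frequency integral is governed by its upper endpoint.
  set k := ⌊1 / α⌋₊ + 1 with hk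
  have hk0 : 0 < k := Nat.succ_pos _
  have hkα : 1 < α * k := by
    have := Nat.lt_floor_add_one (1 / α)
    rw [div_lt_iff₀ hα] at this
    rw [hk]; push_cast; linarith
  set m := n * k with hm
  set c := 2 * Real.exp 1 * C * N₁ * k with hc
  have hc0 : 0 < c := by positivity
  have hTE : ∀ a : ℝ, 1 ≤ a → ∀ t : ℝ, 0 < t → ‖T t * lowPass A a ^ m‖ ≤ (c * a ^ α / t) ^ k := by
    intro a ha t ht
    have ha0 : 0 < a := by linarith
    have h1 : ∀ t, 0 < t → ‖T t * lowPass A a ^ n‖ ≤ 2 * Real.exp 1 * C * (N₁ * a ^ α) / t := by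
      intro t ht
      refine h.norm_mul_le_div (by linarith) hA hA' hK (by positivity) (fun z hz => ?_)
        (fun z hz => ?_) ht
      · exact (commute_lowPass (hρr a ha0.le) (hρ z hz.le)).pow_right n
      · exact norm_resolventOp_mul_lowPass_le hα hN.le hK1 hρ hR (fun a ha => hE a (by linarith))
          ha hz.le
    have h2 := h.norm_mul_pow_le (fun t ht => (hcE a ha0.le t ht).pow_right n) h1 hk0 ht
    rw [← pow_mul, ← hm] at h2
    refine h2.trans (le_of_eq ?_)
    congr 1
    rw [hc]; ring
  set κ := ‖resolventOp A 0‖ with hκ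
  have hκ0 : 0 ≤ κ := norm_nonneg _
  set M := K * κ + c ^ k * κ + m * K * c ^ k / (α * k - 1) + m * K ^ (m + 2) + 1 with hM
  have hαk0 : 0 < α * k - 1 := by linarith
  have hM0 : 0 < M := by positivity
  refine ⟨M, hM0, fun t ht => ?_⟩
  rcases le_total t 1 with ht1 | ht1
  · have h1 : t ^ (1 / α) ≤ 1 := Real.rpow_le_one ht.le ht1 (by positivity)
    rw [le_div_iff₀ (Real.rpow_pos_of_pos ht _)]
    calc _ ≤ (K * κ) * 1 := by
          gcongr
          exact (norm_mul_le _ _).trans (mul_le_mul_of_nonneg_right (hK t ht.le) hκ0)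
      _ ≤ M := by
          have : 0 ≤ c ^ k * κ + m * K * c ^ k / (α * k - 1) + m * K ^ (m + 2) := by positivity
          rw [hM]; linarith
  -- The threshold with a^α = t: the high frequencies contribute O(1/a), and the low ones t^(-k)
  -- a^(αk - 1) = 1/a.
  · set a := t ^ (1 / α) with ha
    have ha1 : 1 ≤ a := Real.one_le_rpow ht1 (by positivity)
    have ha0 : 0 < a := by linarith
    have haα : a ^ α = t := by
      rw [ha, ← Real.rpow_mul ht.le, one_div_mul_cancel hα.ne', Real.rpow_one]
    -- high frequencies
    have hhigh : ‖T t * (resolventOp A 0 * (1 - lowPass A a ^ m))‖ ≤ m * K ^ (m + 2) / a := by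
      have e1 : resolventOp A 0 * (1 - lowPass A a ^ m)
          = resolventOp A a * ∑ i ∈ Finset.range m, lowPass A a ^ i := by
        rw [← sub_mul_lowPass (hρr a ha0.le) h0, mul_assoc, mul_neg_geom_sum]
      have h2 : ‖∑ i ∈ Finset.range m, lowPass A a ^ i‖ ≤ m * K ^ m := by
        refine (norm_sum_le_of_le (Finset.range m) fun i hi => (norm_clm_pow_le (hE a ha0) i).trans
          (pow_le_pow_right₀ hK1 (Finset.mem_range.1 hi).le)).trans (le_of_eq ?_)
        simp
      have h3 : ‖resolventOp A a‖ ≤ K / a := by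
        rw [le_div_iff₀ ha0]
        have := hE a ha0
        rw [lowPass, norm_smul, Complex.norm_real, Real.norm_of_nonneg ha0.le] at this
        linarith
      rw [e1]
      calc _ ≤ ‖T t‖ * (‖resolventOp A a‖ * ‖∑ i ∈ Finset.range m, lowPass A a ^ i‖) :=
            (norm_mul_le _ _).trans (by gcongr; exact norm_mul_le _ _)
        _ ≤ K * (K / a * (m * K ^ m)) := by
            gcongr
            exact hK t ht.le
        _ = _ := by ring
    -- low frequencies
    have hlow : ‖T t * (resolventOp A 0 * lowPass A a ^ m)‖ ≤
        (c ^ k * κ + m * K * c ^ k / (α * k - 1)) / a := by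
      have hd : ∀ b ∈ Icc 1 a, HasDerivAt (fun b : ℝ => T t * (resolventOp A 0 * lowPass A b ^ m))
          (T t * (((m / b ^ 2 : ℝ) : ℂ) • lowPass A b ^ (m + 1))) b := by
        intro b hb
        have hb0 : 0 < b := by linarith [hb.1]
        exact (hasDerivAt_mul_lowPass_pow hb0 (hρr b hb0.le) h0 m).const_mul (T t)
      -- B is a scalar majorant: its value at 1 dominates the initial norm, and its derivative
      -- dominates the norm of the derivative in b.
      set B : ℝ → ℝ := fun b => κ * (c / t) ^ k +
        m * K * (c / t) ^ k / (α * k - 1) * b ^ (α * k - 1) with hB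
      have hB' : ∀ b : ℝ, 0 < b → HasDerivAt B (m * K * (c / t) ^ k * b ^ (α * k - 2)) b := by
        intro b hb
        have h1 := ((Real.hasDerivAt_rpow_const (p := α * k - 1) (Or.inl hb.ne')).const_mul
          (m * K * (c / t) ^ k / (α * k - 1))).const_add (κ * (c / t) ^ k)
        refine HasDerivAt.congr_deriv h1 ?_
        have e1 : α * (k : ℝ) - 1 - 1 = α * k - 2 := by ring
        rw [e1]
        field_simp
      have hb : ‖T t * (resolventOp A 0 * lowPass A a ^ m)‖ ≤ B a := by
        refine image_norm_le_of_norm_deriv_right_le_deriv_boundary'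
          (f := fun b : ℝ => T t * (resolventOp A 0 * lowPass A b ^ m)) (a := 1) (b := a)
          (f' := fun b => T t * (((m / b ^ 2 : ℝ) : ℂ) • lowPass A b ^ (m + 1)))
          (B := B) (B' := fun b => m * K * (c / t) ^ k * b ^ (α * k - 2))
          (fun b hb => (hd b hb).continuousAt.continuousWithinAt)
          (fun b hb => (hd b ⟨hb.1, hb.2.le⟩).hasDerivWithinAt) ?_
          (fun b hb => (hB' b (by linarith [hb.1])).continuousAt.continuousWithinAt)
          (fun b hb => (hB' b (by linarith [hb.1])).hasDerivWithinAt) ?_ ⟨ha1, le_rfl⟩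
        · have h1 := hTE 1 le_rfl t ht
          rw [Real.one_rpow, mul_one] at h1
          have e1 : T t * (resolventOp A 0 * lowPass A 1 ^ m)
              = (T t * lowPass A 1 ^ m) * resolventOp A 0 := by
            rw [((commute_lowPass (hρr 1 zero_le_one) h0).pow_right m).eq, mul_assoc]
          rw [e1]
          calc _ ≤ (c / t) ^ k * κ :=
                (norm_mul_le _ _).trans (mul_le_mul_of_nonneg_right h1 hκ0)
            _ ≤ B 1 := by
                have : 0 ≤ m * K * (c / t) ^ k / (α * k - 1) * 1 ^ (α * k - 1) := by positivity
                simp only [hB]; linarith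
        · intro b hb
          have hb0 : 0 < b := by linarith [hb.1]
          rw [mul_smul_comm, norm_smul, Complex.norm_real, Real.norm_of_nonneg (by positivity),
            pow_succ (lowPass A b), ← mul_assoc]
          have e2 : (b ^ α) ^ k / b ^ 2 = b ^ (α * k - 2) := by
            rw [← Real.rpow_natCast, ← Real.rpow_mul hb0.le, Real.rpow_sub hb0]
            norm_num
          calc _ ≤ m / b ^ 2 * ((c * b ^ α / t) ^ k * K) := by
                gcongr
                exact (norm_mul_le _ _).trans (mul_le_mul (hTE b hb.1 t ht) (hE b hb0)
                  (norm_nonneg _) (by positivity))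
            _ = m * K * (c / t) ^ k * ((b ^ α) ^ k / b ^ 2) := by
                rw [mul_div_right_comm, mul_pow]; ring
            _ = _ := by rw [e2]
      refine hb.trans ?_
      have e3 : (1 / t) ^ k * a ^ (α * k - 1) = 1 / a := by
        rw [Real.rpow_sub ha0, Real.rpow_mul ha0.le, haα, Real.rpow_natCast, Real.rpow_one,
          mul_div_assoc', ← mul_pow, one_div_mul_cancel ht.ne', one_pow]
      have e4 : (1 / t) ^ k ≤ 1 / a := by
        rw [← e3]
        exact le_mul_of_one_le_right (by positivity) (Real.one_le_rpow ha1 hαk0.le)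
      have e5 : (c / t) ^ k = c ^ k * (1 / t) ^ k := by rw [← mul_pow]; ring
      simp only [hB]
      rw [e5]
      calc _ = κ * c ^ k * (1 / t) ^ k + m * K * c ^ k / (α * k - 1) *
            ((1 / t) ^ k * a ^ (α * k - 1)) := by ring
        _ ≤ κ * c ^ k * (1 / a) + m * K * c ^ k / (α * k - 1) * (1 / a) := by rw [e3]; gcongr
        _ = _ := by ring
    have e6 : T t * resolventOp A 0 = T t * (resolventOp A 0 * (1 - lowPass A a ^ m)) +
        T t * (resolventOp A 0 * lowPass A a ^ m) := by
      rw [← mul_add, ← mul_add, sub_add_cancel, mul_one]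
    rw [e6]
    refine (norm_add_le _ _).trans ((add_le_add hhigh hlow).trans ?_)
    rw [← add_div]
    gcongr
    have : 0 ≤ K * κ := by positivity
    rw [hM]; linarith

end Decay

/-! ### Adjoints, maximally dissipative operators and skew-adjoint generators. -/

section Dissipative

open MeasureTheory

variable {X : Type*} [NormedAddCommGroup X] [InnerProductSpace ℂ X] [CompleteSpace X]
  {A : X →ₗ.[ℂ] X} {z : ℂ} {R K : X →L[ℂ] X} {ω : ℝ}

theorem IsResolventAt.adjoint (h : IsResolventAt A z R) (hA : Dense (A.domain : Set X)) :
    IsResolventAt A.adjoint (starRingEnd ℂ z) (ContinuousLinearMap.adjoint R) := by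
  have key : ∀ y : X, ∀ x : A.domain,
      ⟪starRingEnd ℂ z • ContinuousLinearMap.adjoint R y - y, x⟫_ℂ
        = ⟪ContinuousLinearMap.adjoint R y, A x⟫_ℂ := by
    intro y x
    rw [ContinuousLinearMap.adjoint_inner_left, h.map_apply, inner_sub_left, inner_sub_right,
      inner_smul_left, inner_smul_right, ContinuousLinearMap.adjoint_inner_left, Complex.conj_conj]
  refine ⟨fun y => ?_, fun x => ?_⟩
  · have hmem : ContinuousLinearMap.adjoint R y ∈ A.adjoint.domain :=
      LinearPMap.mem_adjoint_domain_of_exists _ ⟨_, key y⟩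
    refine ⟨hmem, ?_⟩
    rw [LinearPMap.adjoint_apply_eq hA ⟨_, hmem⟩ (key y)]
    abel
  · refine ext_inner_right ℂ fun u => ?_
    have h1 := LinearPMap.adjoint_isFormalAdjoint hA x ⟨R u, h.mem_domain u⟩
    rw [ContinuousLinearMap.adjoint_inner_left, inner_sub_left, h1, inner_smul_left,
      Complex.conj_conj, h.apply_eq, inner_sub_right, inner_smul_right]
    ring

/-- The domain of the adjoint contains the range of R*, whose orthogonal complement is the kernel of
R, and R is injective. -/
theorem IsResolventAt.dense_adjoint_domain (h : IsResolventAt A z R)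
    (hA : Dense (A.domain : Set X)) : Dense (A.adjoint.domain : Set X) := by
  rw [Submodule.dense_iff_topologicalClosure_eq_top,
    Submodule.topologicalClosure_eq_top_iff, Submodule.eq_bot_iff]
  intro x hx
  have h1 : R x = 0 := by
    refine ext_inner_left ℂ fun y => ?_
    rw [inner_zero_right, ← ContinuousLinearMap.adjoint_inner_left]
    exact (Submodule.mem_orthogonal _ _).1 hx _ ((h.adjoint hA).mem_domain y)
  exact h.injective (h1.trans (map_zero R).symm)

theorem resolventOp_adjoint (hA : Dense (A.domain : Set X)) (hz : z ∈ rho A) :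
    resolventOp A.adjoint (starRingEnd ℂ z) = ContinuousLinearMap.adjoint (resolventOp A z) :=
  ((isResolventAt_resolventOp hz).adjoint hA).resolventOp_eq

theorem resolventOp_adjoint_ofReal (hA : Dense (A.domain : Set X)) {a : ℝ} (ha : (a : ℂ) ∈ rho A) :
    resolventOp A.adjoint a = ContinuousLinearMap.adjoint (resolventOp A a) := by
  have := resolventOp_adjoint hA ha
  rwa [Complex.conj_ofReal] at this

theorem mem_rho_adjoint (hA : Dense (A.domain : Set X)) (hz : starRingEnd ℂ z ∈ rho A) :
    z ∈ rho A.adjoint := by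
  have := ((isResolventAt_resolventOp hz).adjoint hA).mem_rho
  rwa [Complex.conj_conj] at this

/-- `A - ω` is maximally dissipative. -/
structure MDissipative (A : X →ₗ.[ℂ] X) (ω : ℝ) : Prop where
  dense : Dense (A.domain : Set X)
  re_inner_le : ∀ x : A.domain, (⟪(x : X), A x⟫_ℂ).re ≤ ω * ‖(x : X)‖ ^ 2
  mem_rho : ∀ z : ℂ, ω < z.re → z ∈ rho A

theorem lower_bound_of_re_inner_le {x y : X} (h : (⟪x, y⟫_ℂ).re ≤ ω * ‖x‖ ^ 2) (z : ℂ) :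
    (z.re - ω) * ‖x‖ ≤ ‖z • x - y‖ := by
  by_cases hx : x = 0
  · simp [hx]
  have hx' : 0 < ‖x‖ := norm_pos_iff.2 hx
  have h1 : (⟪x, z • x - y⟫_ℂ).re = z.re * ‖x‖ ^ 2 - (⟪x, y⟫_ℂ).re := by
    rw [inner_sub_right, inner_smul_right, inner_self_eq_norm_sq_to_K, Complex.sub_re]
    congr 1
    rw [Complex.mul_re]
    simp [← Complex.ofReal_pow]
  have h2 : (⟪x, z • x - y⟫_ℂ).re ≤ ‖x‖ * ‖z • x - y‖ :=
    (Complex.re_le_norm _).trans (norm_inner_le_norm _ _)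
  refine le_of_mul_le_mul_left ?_ hx'
  calc ‖x‖ * ((z.re - ω) * ‖x‖) = z.re * ‖x‖ ^ 2 - ω * ‖x‖ ^ 2 := by ring
    _ ≤ _ := by linarith

/-- Dissipativity bounds u - A below by Re u - ω. This is uniform on the segment from z₀ to z, along
which the resolvent can be continued. -/
theorem MDissipative.of_exists (hd : Dense (A.domain : Set X))
    (hre : ∀ x : A.domain, (⟪(x : X), A x⟫_ℂ).re ≤ ω * ‖(x : X)‖ ^ 2) {z₀ : ℂ} (hz₀ : ω < z₀.re)
    (hρ : z₀ ∈ rho A) : MDissipative A ω := by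
  refine ⟨hd, hre, fun z hz => ?_⟩
  refine mem_rho_of_lower_bound hρ (c := min z₀.re z.re - ω)
    (sub_pos.2 (lt_min hz₀ hz)) fun u hu x => ?_
  refine le_trans ?_ (lower_bound_of_re_inner_le (hre x) u)
  gcongr
  obtain ⟨a, b, ha, hb, hab, rfl⟩ := hu
  have h1 : (a • z₀ + b • z).re = a * z₀.re + b * z.re := by simp
  rw [h1]
  have h2 := min_le_left z₀.re z.re
  have h3 := min_le_right z₀.re z.re
  calc min z₀.re z.re = a * min z₀.re z.re + b * min z₀.re z.re := by rw [← add_mul, hab, one_mul]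
    _ ≤ _ := by gcongr

namespace MDissipative

theorem norm_resolventOp_le (h : MDissipative A ω) (hz : ω < z.re) :
    ‖resolventOp A z‖ ≤ 1 / (z.re - ω) :=
  (isResolventAt_resolventOp (h.mem_rho z hz)).norm_le (sub_pos.2 hz) fun x =>
    lower_bound_of_re_inner_le (h.re_inner_le x) z

theorem hilleYosida (h : MDissipative A ω) : HilleYosida A ω where
  dense := h.dense
  mem_rho μ hμ := h.mem_rho _ (by simpa using hμ)
  norm_le μ hμ := by
    have := h.norm_resolventOp_le (z := ((ω + μ : ℝ) : ℂ)) (by simpa using hμ)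
    simpa using this

theorem exists_mem_rho_addBounded (h : MDissipative A ω) (K : X →L[ℂ] X) {z : ℂ}
    (hz : ω + ‖K‖ < z.re) : z ∈ rho (PolyStab.addBounded A K) := by
  have hz' : ω < z.re := by linarith [norm_nonneg K]
  have h0 : 0 < z.re - ω := by linarith
  obtain ⟨S, h1, h2, -⟩ := exists_inverse_one_sub (K * resolventOp A z) (by
    calc _ ≤ ‖K‖ * (1 / (z.re - ω)) := (norm_mul_le _ _).trans (by
            gcongr; exact h.norm_resolventOp_le hz')
      _ < 1 := by rw [mul_one_div, div_lt_one h0]; linarith)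
  exact ((isResolventAt_resolventOp (h.mem_rho z hz')).addBounded h1 h2).mem_rho

theorem addBounded (h : MDissipative A ω) (K : X →L[ℂ] X) :
    MDissipative (PolyStab.addBounded A K) (ω + ‖K‖) := by
  refine .of_exists (z₀ := ((ω + ‖K‖ + 1 : ℝ) : ℂ)) h.dense (fun x => ?_) (by simp)
    (h.exists_mem_rho_addBounded K (by simp))
  change (⟪(x : X), K x + A ⟨x, x.2⟩⟫_ℂ).re ≤ _
  rw [inner_add_right, Complex.add_re]
  have h1 : (⟪(x : X), K x⟫_ℂ).re ≤ ‖K‖ * ‖(x : X)‖ ^ 2 := by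
    refine (Complex.re_le_norm _).trans ((norm_inner_le_norm _ _).trans ?_)
    calc ‖(x : X)‖ * ‖K x‖ ≤ ‖(x : X)‖ * (‖K‖ * ‖(x : X)‖) := by gcongr; exact K.le_opNorm _
      _ = _ := by ring
  have h2 := h.re_inner_le ⟨x, x.2⟩
  rw [add_mul]
  linarith

theorem mem_rho_adjoint (h : MDissipative A ω) (hz : ω < z.re) : z ∈ rho A.adjoint :=
  PolyStab.mem_rho_adjoint h.dense (h.mem_rho _ (by simpa using hz))

theorem adjoint_hilleYosida (h : MDissipative A ω) : HilleYosida A.adjoint ω where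
  dense := (isResolventAt_resolventOp (h.mem_rho ((ω + 1 : ℝ) : ℂ)
    (by simp))).dense_adjoint_domain h.dense
  mem_rho μ hμ := h.mem_rho_adjoint (by simpa using hμ)
  norm_le μ hμ := by
    rw [resolventOp_adjoint_ofReal h.dense (h.hilleYosida.mem_rho μ hμ),
      LinearIsometryEquiv.norm_map]
    exact h.hilleYosida.norm_le μ hμ

theorem yosida_adjoint (h : MDissipative A ω) (n : ℕ) :
    yosida A.adjoint ω n = star (yosida A ω n) := by
  rw [yosida, yosida, resolventOp_adjoint_ofReal h.dense (h.hilleYosida.mem_rho _ (by positivity)),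
    star_add, star_smul, star_smul, star_one, ContinuousLinearMap.star_eq_adjoint]
  simp

/-- The Yosida approximations of A* are the adjoints of those of A. Exponentials preserve this
relation, and it survives the strong limits once paired with vectors. -/
theorem exists_adjointPair (h : MDissipative A ω) :
    ∃ T T', AdjointPair A T A.adjoint T' ω := by
  obtain ⟨T, hT, hlim⟩ := h.hilleYosida.exists_generates
  obtain ⟨T', hT', hlim'⟩ := h.adjoint_hilleYosida.exists_generates
  refine ⟨T, T', hT, hT', fun t ht x y => ?_⟩
  refine tendsto_nhds_unique ((hlim t ht x).inner tendsto_const_nhds)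
    ((tendsto_const_nhds.inner (hlim' t ht y)).congr fun n => ?_)
  rw [h.yosida_adjoint]
  have e1 : t • star (yosida A ω n) = star (t • yosida A ω n) := by
    rw [star_smul, star_trivial t]
  rw [e1, ← NormedSpace.star_exp, ContinuousLinearMap.star_eq_adjoint,
    ContinuousLinearMap.adjoint_inner_right]

end MDissipative

/-- By Plancherel the integral is ∫ e^(-2σt)‖T(t)x‖² dt ≤ ‖x‖²/(2σ) for a contraction semigroup; the
constant 1 is not sharp. -/
theorem Generates.squareBounded {T : ℝ → X →L[ℂ] X} (h : Generates A T 0)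
    (hρ : ∀ z : ℂ, 0 < z.re → z ∈ rho A) : SquareBounded A 1 where
  mem_rho := hρ
  lintegral_le σ hσ x := by
    have hT : ∀ t, 0 ≤ t → ‖T t‖ ≤ 1 * Real.exp (0 * t) := by simpa using h.norm_le
    rw [h.lintegral_resolventOp_sq hT hσ fun z hz => hρ z (by rw [hz]; exact hσ)]
    have h1 : ∀ t ∈ Ioi (0 : ℝ), ‖Complex.exp (-σ * t) • T t x‖ₑ ^ 2
        ≤ ENNReal.ofReal (‖x‖ ^ 2 * Real.exp (-(2 * σ) * t)) := by
      intro t ht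
      rw [← ofReal_norm, ← ENNReal.ofReal_pow (norm_nonneg _)]
      refine ENNReal.ofReal_le_ofReal ?_
      have h2 := norm_apply_le hT (σ : ℂ) x (le_of_lt ht)
      rw [Complex.ofReal_re, one_mul, sub_zero] at h2
      calc _ ≤ (‖x‖ * Real.exp (-σ * t)) ^ 2 := by gcongr
        _ = ‖x‖ ^ 2 * (Real.exp (-σ * t) * Real.exp (-σ * t)) := by ring
        _ = _ := by rw [← Real.exp_add]; ring_nf
    refine (setLIntegral_mono' measurableSet_Ioi h1).trans ?_
    rw [← ofReal_integral_eq_lintegral_ofReal]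
    · refine ENNReal.ofReal_le_ofReal ?_
      rw [integral_const_mul, integral_exp_mul_Ioi (by linarith)]
      simp only [mul_zero, Real.exp_zero]
      rw [neg_div_neg_eq, mul_comm]
      gcongr
      linarith
    · exact (integrableOn_exp_mul_Ioi (by linarith) 0).const_mul _
    · exact ae_of_all _ fun t => by positivity

/-! ### Skew-adjoint operators -/

namespace IsSkewAdjoint

variable {A₀ : X →ₗ.[ℂ] X}

theorem inner_apply (h : IsSkewAdjoint A₀) (x y : A₀.domain) :
    ⟪(x : X), A₀ y⟫_ℂ = -⟪A₀ x, (y : X)⟫_ℂ := by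
  have hdom : A₀.adjoint.domain = A₀.domain := by rw [h.2]; rfl
  have hx : (x : X) ∈ A₀.adjoint.domain := by rw [hdom]; exact x.2
  have h1 := LinearPMap.adjoint_isFormalAdjoint h.1 ⟨x, hx⟩ y
  have h2 : A₀.adjoint ⟨x, hx⟩ = -A₀ x := by
    have : ∀ (B : X →ₗ.[ℂ] X) (_ : B = -A₀) (hx : (x : X) ∈ B.domain), B ⟨x, hx⟩ = -A₀ x := by
      rintro B rfl hx
      rfl
    exact this _ h.2 hx
  rw [h2, inner_neg_left] at h1
  exact h1.symm

theorem re_inner_eq_zero (h : IsSkewAdjoint A₀) (x : A₀.domain) : (⟪(x : X), A₀ x⟫_ℂ).re = 0 := by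
  have h1 := h.inner_apply x x
  have h2 : (⟪A₀ x, (x : X)⟫_ℂ).re = (⟪(x : X), A₀ x⟫_ℂ).re := by
    rw [← inner_conj_symm, Complex.conj_re]
  have h3 := congrArg Complex.re h1
  rw [Complex.neg_re, h2] at h3
  linarith

theorem isClosed (h : IsSkewAdjoint A₀) : A₀.IsClosed := by
  have h1 : A₀.adjoint.IsClosed := LinearPMap.adjoint_isClosed h.1
  rw [h.2] at h1
  have h2 : (A₀.graph : Set (X × X)) = (fun p : X × X => (p.1, -p.2)) ⁻¹' ((-A₀).graph) := by
    ext ⟨x, y⟩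
    simp only [SetLike.mem_coe, LinearPMap.mem_graph_iff, mem_preimage]
    constructor
    · rintro ⟨u, hu, hv⟩
      exact ⟨u, hu, by rw [← hv]; rfl⟩
    · rintro ⟨u, hu, hv⟩
      exact ⟨u, hu, neg_injective hv⟩
  change IsClosed (A₀.graph : Set (X × X))
  rw [h2]
  exact IsClosed.preimage (by fun_prop) h1

theorem lower_bound (h : IsSkewAdjoint A₀) (x : A₀.domain) :
    ‖(x : X)‖ ≤ ‖(1 : ℂ) • (x : X) - A₀ x‖ := by
  have := lower_bound_of_re_inner_le (ω := 0) (x := (x : X)) (y := A₀ x)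
    (by rw [h.re_inner_eq_zero]; simp) 1
  simpa using this

/-- The range of 1 - A₀ is closed, because A₀ is closed and 1 - A₀ is bounded below. A vector y
orthogonal to it lies in dom A₀* = dom A₀ and satisfies ⟨y, y⟩ = ⟨y, A₀y⟩, which has real part 0. -/
theorem surjective (h : IsSkewAdjoint A₀) (y : X) : ∃ x : A₀.domain, (1 : ℂ) • (x : X) - A₀ x = y := by
  set L : A₀.domain →ₗ[ℂ] X := (1 : ℂ) • A₀.domain.subtype - A₀.toFun with hL
  have hLa : ∀ x, L x = (1 : ℂ) • (x : X) - A₀ x := fun x => rfl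
  set V := LinearMap.range L with hV
  have hclosed : IsClosed (V : Set X) := by
    rw [← isSeqClosed_iff_isClosed]
    intro u y hu hy
    choose x hx using hu
    have hc : CauchySeq fun n => ((x n : A₀.domain) : X) := by
      rw [Metric.cauchySeq_iff]
      intro ε hε
      obtain ⟨N, hN⟩ := Metric.cauchySeq_iff.1 hy.cauchySeq ε hε
      refine ⟨N, fun m hm n hn => lt_of_le_of_lt ?_ (hN m hm n hn)⟩
      rw [dist_eq_norm, dist_eq_norm, ← hx m, ← hx n, ← map_sub, hLa]
      exact h.lower_bound (x m - x n)
    obtain ⟨v, hv⟩ := cauchySeq_tendsto_of_complete hc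
    have h1 : Tendsto (fun n => A₀ (x n)) atTop (𝓝 (v - y)) := by
      refine (hv.sub hy).congr fun n => ?_
      rw [← hx n, hLa, one_smul]; abel
    have h2 : (v, v - y) ∈ A₀.graph :=
      h.isClosed.isSeqClosed (fun n => A₀.mem_graph (x n)) (hv.prodMk_nhds h1)
    obtain ⟨w, hw1, hw2⟩ := (LinearPMap.mem_graph_iff _).1 h2
    refine ⟨w, ?_⟩
    rw [hLa, hw2, hw1, one_smul]
    exact sub_sub_cancel v y
  have htop : V = ⊤ := by
    have hVc : V.topologicalClosure = V := hclosed.submodule_topologicalClosure_eq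
    rw [← hVc, Submodule.topologicalClosure_eq_top_iff, Submodule.eq_bot_iff]
    intro y hy
    have hy' : ∀ x : A₀.domain, ⟪y, (x : X)⟫_ℂ = ⟪y, A₀ x⟫_ℂ := by
      intro x
      have h1 := (Submodule.mem_orthogonal' _ _).1 hy (L x) ⟨x, rfl⟩
      rw [hLa, one_smul, inner_sub_right, sub_eq_zero] at h1
      exact h1
    have hmem : y ∈ A₀.adjoint.domain := LinearPMap.mem_adjoint_domain_of_exists _ ⟨y, hy'⟩
    have hdom : A₀.adjoint.domain = A₀.domain := by rw [h.2]; rfl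
    rw [hdom] at hmem
    have h2 := congrArg Complex.re (hy' ⟨y, hmem⟩)
    rw [h.re_inner_eq_zero ⟨y, hmem⟩, inner_self_eq_norm_sq_to_K] at h2
    have h3 : ‖y‖ ^ 2 = 0 := by simpa [← Complex.ofReal_pow] using h2
    exact norm_eq_zero.1 (pow_eq_zero_iff two_ne_zero |>.1 h3)
  have : y ∈ V := by rw [htop]; trivial
  obtain ⟨x, hx⟩ := this
  exact ⟨x, hx⟩

theorem one_mem_rho (h : IsSkewAdjoint A₀) : (1 : ℂ) ∈ rho A₀ := by
  set L : A₀.domain →ₗ[ℂ] X := (1 : ℂ) • A₀.domain.subtype - A₀.toFun with hL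
  have hLa : ∀ x, L x = (1 : ℂ) • (x : X) - A₀ x := fun x => rfl
  have hinj : Function.Injective L := by
    rw [injective_iff_map_eq_zero]
    intro x hx
    have := h.lower_bound x
    rw [← hLa, hx, norm_zero] at this
    exact Subtype.ext (norm_le_zero_iff.1 this)
  let e := LinearEquiv.ofBijective L ⟨hinj, h.surjective⟩
  have he : ∀ y, L (e.symm y) = y := fun y => e.apply_symm_apply y
  refine ⟨LinearMap.mkContinuous (A₀.domain.subtype ∘ₗ e.symm.toLinearMap) 1 fun y => ?_,
    fun y => ⟨(e.symm y).2, ?_⟩, fun x => ?_⟩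
  · have := h.lower_bound (e.symm y)
    rw [← hLa, he] at this
    simpa using this
  · exact he y
  · change ((e.symm (L x) : A₀.domain) : X) = x
    rw [show L x = e x from rfl, e.symm_apply_apply]

theorem mDissipative (h : IsSkewAdjoint A₀) : MDissipative A₀ 0 :=
  .of_exists h.1 (fun x => by rw [h.re_inner_eq_zero]; simp) (by simp) h.one_mem_rho

end IsSkewAdjoint

/-! ### Dissipativity of A₀ - DD*. -/

section Damped

variable {U : Type*} [NormedAddCommGroup U] [InnerProductSpace ℂ U] [CompleteSpace U]
  {A₀ : X →ₗ.[ℂ] X} {D : U →L[ℂ] X}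

theorem damped_apply (x : A₀.domain) :
    damped A₀ D x = A₀ x - D (ContinuousLinearMap.adjoint D x) := by
  change -(D (ContinuousLinearMap.adjoint D x)) + A₀ x = _
  abel

theorem IsSkewAdjoint.re_inner_damped (h : IsSkewAdjoint A₀) (x : A₀.domain) :
    (⟪(x : X), damped A₀ D x⟫_ℂ).re = -‖ContinuousLinearMap.adjoint D x‖ ^ 2 := by
  rw [damped_apply, inner_sub_right, Complex.sub_re, h.re_inner_eq_zero,
    ← ContinuousLinearMap.adjoint_inner_left, inner_self_eq_norm_sq_to_K]
  simp [← Complex.ofReal_pow]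

theorem IsSkewAdjoint.mDissipative_damped (h : IsSkewAdjoint A₀) :
    MDissipative (damped A₀ D) 0 := by
  have h1 := h.mDissipative.addBounded (-(D ∘L ContinuousLinearMap.adjoint D))
  set K := -(D ∘L ContinuousLinearMap.adjoint D)
  refine .of_exists (z₀ := ((‖K‖ + 1 : ℝ) : ℂ)) h1.dense (fun x => ?_) ?_
    (h1.mem_rho _ (by simp))
  · rw [h.re_inner_damped x, zero_mul]
    exact neg_nonpos.2 (by positivity)
  · rw [Complex.ofReal_re]; positivity

end Damped

end Dissipative

/-! ### Spectral subspaces of A₀ and the spectral gap. -/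

section Spectral

variable {X : Type*} [NormedAddCommGroup X] [InnerProductSpace ℂ X] [CompleteSpace X]
  {A₀ : X →ₗ.[ℂ] X}

theorem IsResolventAt.neg {A : X →ₗ.[ℂ] X} {z : ℂ} {R : X →L[ℂ] X} (h : IsResolventAt A z R) :
    IsResolventAt (-A) (-z) (-R) := by
  have hmem : ∀ y, (-R) y ∈ A.domain := fun y => A.domain.neg_mem (h.mem_domain y)
  refine ⟨fun y => ⟨hmem y, ?_⟩, fun x => ?_⟩
  · change (-z) • (-(R y)) - -(A ⟨-(R y), hmem y⟩) = y
    have h1 : A ⟨-(R y), hmem y⟩ = -A ⟨R y, h.mem_domain y⟩ := A.map_neg ⟨R y, h.mem_domain y⟩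
    rw [h1, h.apply_eq]
    module
  · change -(R ((-z) • (x : X) - -(A ⟨x, x.2⟩))) = x
    have h1 := h.left_inv ⟨x, x.2⟩
    rw [← map_neg]
    convert h1 using 2
    module

namespace IsSkewAdjoint

/-- R(1, A₀)* is the resolvent of A₀* = -A₀ at 1. Normality of R(1, A₀) and the location of its
spectrum both come from this. -/
theorem isResolventAt_neg_one (h : IsSkewAdjoint A₀) :
    IsResolventAt A₀ (-1) (-star (resolventOp A₀ 1)) := by
  have h1 := (isResolventAt_resolventOp h.one_mem_rho).adjoint h.1
  rw [h.2, map_one] at h1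
  simpa [ContinuousLinearMap.star_eq_adjoint] using h1.neg

theorem isStarNormal_resolventOp (h : IsSkewAdjoint A₀) : IsStarNormal (resolventOp A₀ 1) := by
  have h1 := (isResolventAt_resolventOp h.one_mem_rho).commute h.isResolventAt_neg_one
  exact ⟨by simpa using h1.symm⟩

theorem resolventOp_add_star (h : IsSkewAdjoint A₀) :
    resolventOp A₀ 1 + star (resolventOp A₀ 1)
      = (2 : ℂ) • (resolventOp A₀ 1 * star (resolventOp A₀ 1)) := by
  have h1 := (isResolventAt_resolventOp h.one_mem_rho).sub_eq h.isResolventAt_neg_one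
  rw [mul_neg, sub_neg_eq_add] at h1
  rw [h1]
  module

/-- The resolvent identity between 1 and -1 reads N + N* = 2NN*. By the functional calculus every
spectral point satisfies Re z = |z|², a circle that 1 - z⁻¹ maps to the imaginary axis. -/
theorem spectrum_resolventOp (h : IsSkewAdjoint A₀) {z : ℂ}
    (hz : z ∈ spectrum ℂ (resolventOp A₀ 1)) (hz0 : z ≠ 0) :
    1 - z⁻¹ = (1 - z⁻¹).im * Complex.I := by
  have := h.isStarNormal_resolventOp
  have h1 : cfc (fun z : ℂ => z + star z) (resolventOp A₀ 1)
      = cfc (fun z : ℂ => 2 * (z * star z)) (resolventOp A₀ 1) := by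
    rw [cfc_add (resolventOp A₀ 1) (fun z : ℂ => z) (fun z => star z),
      cfc_const_mul (2 : ℂ) (fun z : ℂ => z * star z) (resolventOp A₀ 1),
      cfc_mul (fun z : ℂ => z) (fun z => star z), cfc_star_id (R := ℂ) (resolventOp A₀ 1),
      cfc_id' ℂ (resolventOp A₀ 1), h.resolventOp_add_star]
  have h2 : z + star z = 2 * (z * star z) := eqOn_of_cfc_eq_cfc h1 (by fun_prop) (by fun_prop) this hz
  simp only [Complex.star_def, Complex.mul_conj] at h2
  have h3 : z.re = Complex.normSq z := by
    have := congrArg Complex.re h2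
    simp [Complex.ofReal_re] at this
    linarith
  have h4 : Complex.normSq z ≠ 0 := by simpa using hz0
  apply Complex.ext <;> simp [Complex.inv_re, h3, h4]

/-- In the coordinate `ξ` with `z = (1 - iξ)⁻¹`. -/
theorem norm_one_add_mul (h : IsSkewAdjoint A₀) {z : ℂ}
    (hz : z ∈ spectrum ℂ (resolventOp A₀ 1)) (hz0 : z ≠ 0) (s : ℝ) :
    ‖1 + (Complex.I * s - 1) * z‖ = ‖z‖ * |s - (1 - z⁻¹).im| := by
  have h1 := h.spectrum_resolventOp hz hz0
  have h2 : 1 + (Complex.I * s - 1) * z = z * (((s - (1 - z⁻¹).im : ℝ) : ℂ) * Complex.I) := by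
    have : z * z⁻¹ = 1 := mul_inv_cancel₀ hz0
    rw [Complex.ofReal_sub]
    linear_combination -z * h1 - this
  rw [h2, norm_mul, norm_mul, Complex.norm_I, mul_one, Complex.norm_real, Real.norm_eq_abs]

/-- Only the point 0 needs care: near it |1 - z⁻¹| is large, so the coordinate ξ has left (a, b) and
the symbol vanishes. Continuity must be checked because `cfc` of a discontinuous symbol is 0 by
default. -/
theorem continuousOn_symbol (h : IsSkewAdjoint A₀) {f : ℝ → ℂ} (hf : Continuous f) {a b : ℝ}
    (hs : tsupport f ⊆ Ioo a b) :
    ContinuousOn (fun z : ℂ => if z = 0 then 0 else f (1 - z⁻¹).im)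
      (spectrum ℂ (resolventOp A₀ 1)) := by
  intro z hz
  by_cases hz0 : z = 0
  · subst hz0
    set M := |a| + |b| with hM
    have hM0 : 0 ≤ M := by positivity
    have hev : ∀ᶠ w in 𝓝[spectrum ℂ (resolventOp A₀ 1)] (0 : ℂ),
        (if w = 0 then 0 else f (1 - w⁻¹).im) = 0 := by
      have hball : Metric.ball (0 : ℂ) (M + 1)⁻¹ ∈ 𝓝[spectrum ℂ (resolventOp A₀ 1)] (0 : ℂ) :=
        mem_nhdsWithin_of_mem_nhds (Metric.ball_mem_nhds _ (by positivity))
      filter_upwards [hball, self_mem_nhdsWithin] with w hw hwσ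
      by_cases hw0 : w = 0
      · simp [hw0]
      · rw [if_neg hw0]
        by_contra hne
        have hmem : (1 - w⁻¹).im ∈ Ioo a b := hs (subset_tsupport _ hne)
        have h1 : ‖1 - w⁻¹‖ ≤ M := by
          rw [h.spectrum_resolventOp hwσ hw0, norm_mul, Complex.norm_I, mul_one, Complex.norm_real,
            Real.norm_eq_abs, abs_le]
          constructor <;> linarith [hmem.1, hmem.2, neg_abs_le a, le_abs_self b, abs_nonneg a,
            abs_nonneg b]
        have h2 : ‖w⁻¹‖ ≤ M + 1 := by
          calc ‖w⁻¹‖ = ‖1 - (1 - w⁻¹)‖ := by rw [sub_sub_cancel]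
            _ ≤ ‖(1 : ℂ)‖ + ‖1 - w⁻¹‖ := norm_sub_le _ _
            _ ≤ M + 1 := by rw [norm_one]; linarith
        rw [norm_inv] at h2
        have h3 : (M + 1)⁻¹ ≤ ‖w‖ := by
          rw [inv_le_comm₀ (by positivity) (norm_pos_iff.2 hw0)]; exact h2
        rw [mem_ball_zero_iff] at hw
        linarith
    refine Tendsto.congr' (EventuallyEq.symm hev) ?_
    simp only [if_true]
    exact tendsto_const_nhds
  · have h1 : ContinuousAt (fun w : ℂ => f (1 - w⁻¹).im) z :=
      hf.continuousAt.comp (Complex.continuous_im.continuousAt.comp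
        (continuousAt_const.sub (continuousAt_inv₀ hz0)))
    refine (h1.congr ?_).continuousWithinAt
    filter_upwards [isOpen_ne.mem_nhds hz0] with w hw
    rw [if_neg hw]

theorem commute_funcCalc (h : IsSkewAdjoint A₀) (f : ℝ → ℂ) :
    Commute (resolventOp A₀ 1) (funcCalc A₀ f) := by
  have := h.isStarNormal_resolventOp
  have h1 := cfc_commute_cfc (fun z : ℂ => z) (fun z => if z = 0 then 0 else f (1 - z⁻¹).im)
    (resolventOp A₀ 1)
  rwa [cfc_id' ℂ (resolventOp A₀ 1)] at h1

theorem commute_star_funcCalc (h : IsSkewAdjoint A₀) (f : ℝ → ℂ) :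
    Commute (star (resolventOp A₀ 1)) (funcCalc A₀ f) := by
  have := h.isStarNormal_resolventOp
  have h1 := cfc_commute_cfc (fun z : ℂ => star z) (fun z => if z = 0 then 0 else f (1 - z⁻¹).im)
    (resolventOp A₀ 1)
  rwa [cfc_star_id (R := ℂ) (resolventOp A₀ 1)] at h1

end IsSkewAdjoint

theorem mem_spectralSubspace {f : ℝ → ℂ} (hf : Continuous f) {a b : ℝ} (hs : tsupport f ⊆ Ioo a b)
    (x : X) : funcCalc A₀ f x ∈ spectralSubspace A₀ a b := by
  apply Submodule.le_topologicalClosure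
  exact Submodule.mem_iSup_of_mem (⟨f, hf, hs⟩ : {f : ℝ → ℂ // Continuous f ∧ tsupport f ⊆ Ioo a b})
    ⟨x, rfl⟩

theorem map_mem_spectralSubspace {T : X →L[ℂ] X} (hT : ∀ f, Commute T (funcCalc A₀ f)) {a b : ℝ}
    {x : X} (hx : x ∈ spectralSubspace A₀ a b) : T x ∈ spectralSubspace A₀ a b := by
  set V := (⨆ f : {f : ℝ → ℂ // Continuous f ∧ tsupport f ⊆ Ioo a b},
    LinearMap.range (funcCalc A₀ f.1 : X →ₗ[ℂ] X)) with hV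
  have h1 : V ≤ V.comap (T : X →ₗ[ℂ] X) := by
    rw [hV]
    refine iSup_le fun f => ?_
    rintro _ ⟨y, rfl⟩
    have h2 : T (funcCalc A₀ f.1 y) = funcCalc A₀ f.1 (T y) :=
      congrArg (fun S : X →L[ℂ] X => S y) (hT f.1)
    change T (funcCalc A₀ f.1 y) ∈ (iSup _ : Submodule ℂ X)
    rw [h2]
    exact Submodule.mem_iSup_of_mem f (LinearMap.mem_range_self _ _)
  have h3 : MapsTo T (V : Set X) (V : Set X) := fun y hy => h1 hy
  exact map_mem_closure T.continuous hx h3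

namespace IsSkewAdjoint

/-- Both N and N* leave the spectral subspace invariant, so N also preserves its orthogonal
complement. -/
theorem spectralProj_commute (h : IsSkewAdjoint A₀) (a b : ℝ) (x : X) :
    spectralProj A₀ a b (resolventOp A₀ 1 x) = resolventOp A₀ 1 (spectralProj A₀ a b x) := by
  refine (Submodule.eq_starProjection_of_mem_orthogonal (K := spectralSubspace A₀ a b)
    (map_mem_spectralSubspace h.commute_funcCalc (Submodule.coe_mem _)) ?_)
  rw [← map_sub, Submodule.mem_orthogonal]
  intro u hu
  rw [← ContinuousLinearMap.adjoint_inner_left]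
  exact (Submodule.mem_orthogonal (spectralSubspace A₀ a b) _).1
    (Submodule.sub_starProjection_mem_orthogonal (K := spectralSubspace A₀ a b) x) _
    (map_mem_spectralSubspace h.commute_star_funcCalc hu)

/-- The spectral projection maps `dom A₀` to itself. -/
theorem spectralProj_mem (h : IsSkewAdjoint A₀) (a b : ℝ) (x : A₀.domain) :
    spectralProj A₀ a b x ∈ A₀.domain := by
  have hR := isResolventAt_resolventOp h.one_mem_rho
  rw [← hR.left_inv x, h.spectralProj_commute]
  exact hR.mem_domain _

theorem apply_spectralProj (h : IsSkewAdjoint A₀) (a b : ℝ) (x : A₀.domain) :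
    A₀ ⟨spectralProj A₀ a b x, h.spectralProj_mem a b x⟩ = spectralProj A₀ a b (A₀ x) := by
  have hR := isResolventAt_resolventOp h.one_mem_rho
  have h1 : spectralProj A₀ a b x
      = resolventOp A₀ 1 (spectralProj A₀ a b ((1 : ℂ) • (x : X) - A₀ x)) := by
    rw [← h.spectralProj_commute, hR.left_inv]
  rw [apply_congr_of_eq A₀ _ (hR.mem_domain _) h1, hR.apply_eq, ← h1, map_sub, map_smul]
  module

/-- The function which is `1` on `[s - r, s + r]`, vanishes outside `[s - R, s + R]`, and is affine
in between. -/
def tent (s r R : ℝ) (ξ : ℝ) : ℝ := max 0 (min 1 ((R - |ξ - s|) / (R - r)))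

theorem continuous_tent (s r R : ℝ) : Continuous (tent s r R) := by
  unfold tent
  fun_prop

theorem tent_nonneg (s r R ξ : ℝ) : 0 ≤ tent s r R ξ := le_max_left _ _

theorem tent_eq_one {s r R ξ : ℝ} (h : r < R) (hξ : |s - ξ| ≤ r) : tent s r R ξ = 1 := by
  rw [abs_sub_comm] at hξ
  have : 1 ≤ (R - |ξ - s|) / (R - r) := by rw [le_div_iff₀ (by linarith)]; linarith
  rw [tent, min_eq_left this, max_eq_right zero_le_one]

theorem tsupport_tent_subset {s r R R' : ℝ} (h : r < R) (h' : R < R') :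
    tsupport (fun ξ => (tent s r R ξ : ℂ)) ⊆ Ioo (s - R') (s + R') := by
  have h1 : tsupport (fun ξ => (tent s r R ξ : ℂ)) ⊆ Icc (s - R) (s + R) := by
    refine closure_minimal (fun ξ hξ => ?_) isClosed_Icc
    by_contra hn
    apply hξ
    have h2 : R < |ξ - s| := by
      by_contra hle
      rw [not_lt, abs_le] at hle
      exact hn ⟨by linarith, by linarith⟩
    have h3 : (R - |ξ - s|) / (R - r) ≤ 0 := div_nonpos_of_nonpos_of_nonneg (by linarith) (by linarith)
    simp only [tent]
    rw [min_eq_right (h3.trans zero_le_one), max_eq_left h3, Complex.ofReal_zero]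
  exact h1.trans fun ξ hξ => ⟨by linarith [hξ.1], by linarith [hξ.2]⟩

theorem star_funcCalc_ofReal (A₀ : X →ₗ.[ℂ] X) (f : ℝ → ℝ) :
    star (funcCalc A₀ fun ξ => (f ξ : ℂ)) = funcCalc A₀ fun ξ => (f ξ : ℂ) := by
  rw [funcCalc, ← cfc_star]
  congr 1
  ext z
  split_ifs <;> simp

/-- In the spectral variable, |s - ξ|² + r²φ(ξ) ≥ r² for a cutoff φ equal to 1 on |s - ξ| ≤ r. The
strict inequality r < ρ leaves room for a continuous φ supported inside the window, and φ(-iA₀)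
annihilates x. -/
theorem norm_sub_ge_of_lt (h : IsSkewAdjoint A₀) {s r ρ : ℝ} (hr : 0 < r) (hρ : r < ρ)
    (x : A₀.domain) (hx : (x : X) ∈ (spectralSubspace A₀ (s - ρ) (s + ρ))ᗮ) :
    r * ‖(x : X)‖ ≤ ‖(Complex.I * s) • (x : X) - A₀ x‖ := by
  have hn := h.isStarNormal_resolventOp
  have hR := isResolventAt_resolventOp h.one_mem_rho
  set N := resolventOp A₀ 1 with hN
  set φ : ℝ → ℝ := tent s r ((r + ρ) / 2) with hφ
  set F : ℂ → ℂ := fun z => if z = 0 then 0 else (φ (1 - z⁻¹).im : ℂ) with hF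
  have hφc : Continuous fun ξ => (φ ξ : ℂ) := Complex.continuous_ofReal.comp (continuous_tent _ _ _)
  have hφs : tsupport (fun ξ => (φ ξ : ℂ)) ⊆ Ioo (s - ρ) (s + ρ) :=
    tsupport_tent_subset (by linarith) (by linarith)
  have hFc : ContinuousOn F (spectrum ℂ N) := h.continuousOn_symbol hφc hφs
  set P := funcCalc A₀ fun ξ => (φ ξ : ℂ) with hP
  have hPF : P = cfc F N := rfl
  have hPx : P x = 0 := by
    refine ext_inner_left ℂ fun y => ?_
    have h1 : star P = P := star_funcCalc_ofReal A₀ φ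
    rw [inner_zero_right, ← ContinuousLinearMap.adjoint_inner_left,
      ← ContinuousLinearMap.star_eq_adjoint, h1]
    exact (Submodule.mem_orthogonal _ _).1 hx _ (mem_spectralSubspace hφc hφs y)
  set c : ℂ := Complex.I * s - 1 with hc
  set w : X := (1 : ℂ) • (x : X) - A₀ x with hw
  have hNw : N w = x := hR.left_inv x
  set L : X →L[ℂ] X := 1 + c • N with hL
  have hLw : L w = (Complex.I * s) • (x : X) - A₀ x := by
    change w + c • N w = _
    rw [hNw, hw, hc]
    module
  -- This is the pointwise inequality multiplied by |z|², which makes every term a bounded function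
  -- of N. As g ≥ 0, its square root H turns the inequality into the identity L*L + r²N*PN = H*H +
  -- r²N*N, to be evaluated at w = (1 - A₀)x, where Nw = x and Px = 0.
  set g : ℂ → ℝ := fun z => ‖1 + c * z‖ ^ 2 + r ^ 2 * ((F z).re * ‖z‖ ^ 2) - r ^ 2 * ‖z‖ ^ 2 with hg
  have hg0 : ∀ z ∈ spectrum ℂ N, 0 ≤ g z := by
    intro z hz
    by_cases hz0 : z = 0
    · simp [hg, hz0]
    · simp only [hg, hF, if_neg hz0, Complex.ofReal_re]
      rw [h.norm_one_add_mul hz hz0, mul_pow, sq_abs]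
      by_cases hle : |s - (1 - z⁻¹).im| ≤ r
      · rw [hφ, tent_eq_one (by linarith) hle]
        nlinarith [sq_nonneg (‖z‖ * (s - (1 - z⁻¹).im))]
      · have h1 : r ^ 2 ≤ (s - (1 - z⁻¹).im) ^ 2 := by
          rw [← sq_abs (s - _)]
          exact pow_le_pow_left₀ hr.le (not_le.1 hle).le 2
        have h2 := tent_nonneg s r ((r + ρ) / 2) (1 - z⁻¹).im
        nlinarith [mul_le_mul_of_nonneg_left h1 (sq_nonneg ‖z‖),
          mul_nonneg (sq_nonneg r) (mul_nonneg h2 (sq_nonneg ‖z‖))]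
  have hgc : ContinuousOn g (spectrum ℂ N) := by
    have : ContinuousOn (fun z => (F z).re) (spectrum ℂ N) :=
      Complex.continuous_re.comp_continuousOn hFc
    fun_prop
  set q : ℂ → ℂ := fun z => (Real.sqrt (g z) : ℂ) with hq
  have hqc : ContinuousOn q (spectrum ℂ N) :=
    Complex.continuous_ofReal.comp_continuousOn hgc.sqrt
  set H := cfc q N with hH
  have hid : cfc (fun z : ℂ => z) N = N := cfc_id' ℂ N
  have hstar : cfc (fun z : ℂ => star z) N = star N := cfc_star_id (R := ℂ) N
  have hLc : cfc (fun z : ℂ => 1 + c * z) N = L := by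
    rw [cfc_add N (fun _ => (1 : ℂ)) (fun z => c * z), cfc_const_one ℂ N,
      cfc_const_mul c (fun z => z) N, hid]
  have e1 : cfc (fun z : ℂ => star (1 + c * z) * (1 + c * z) + (r : ℂ) ^ 2 * (star z * (F z * z))) N
      = star L * L + (r : ℂ) ^ 2 • (star N * (P * N)) := by
    rw [cfc_add N (fun z : ℂ => star (1 + c * z) * (1 + c * z))
        (fun z : ℂ => (r : ℂ) ^ 2 * (star z * (F z * z))),
      cfc_mul (fun z : ℂ => star (1 + c * z)) (fun z => 1 + c * z) N, cfc_star, hLc,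
      cfc_const_mul ((r : ℂ) ^ 2) (fun z : ℂ => star z * (F z * z)) N,
      cfc_mul (fun z : ℂ => star z) (fun z => F z * z) N, hstar, cfc_mul F (fun z => z) N, hid, hPF]
  have e2 : cfc (fun z : ℂ => star (q z) * q z + (r : ℂ) ^ 2 * (star z * z)) N
      = star H * H + (r : ℂ) ^ 2 • (star N * N) := by
    rw [cfc_add N (fun z : ℂ => star (q z) * q z) (fun z : ℂ => (r : ℂ) ^ 2 * (star z * z)),
      cfc_mul (fun z : ℂ => star (q z)) q N, cfc_star,
      cfc_const_mul ((r : ℂ) ^ 2) (fun z : ℂ => star z * z) N,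
      cfc_mul (fun z : ℂ => star z) (fun z => z) N, hstar, hid]
  have e3 : star L * L + (r : ℂ) ^ 2 • (star N * (P * N))
      = star H * H + (r : ℂ) ^ 2 • (star N * N) := by
    rw [← e1, ← e2]
    refine cfc_congr fun z hz => ?_
    have h1 : ∀ u : ℂ, star u * u = ((‖u‖ ^ 2 : ℝ) : ℂ) := fun u => by
      rw [mul_comm, Complex.star_def, Complex.mul_conj, Complex.normSq_eq_norm_sq]
    have h2 : F z = ((F z).re : ℂ) := by
      simp only [hF]
      split_ifs <;> simp
    have h3 : star z * (F z * z) = (((F z).re * ‖z‖ ^ 2 : ℝ) : ℂ) := by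
      rw [mul_left_comm, h1, h2]
      push_cast
      simp
    have h4 : star (q z) * q z = (g z : ℂ) := by
      rw [h1, hq, Complex.norm_real, Real.norm_eq_abs, sq_abs, Real.sq_sqrt (hg0 z hz)]
    simp only [h1, h3]
    rw [← h1 (q z), h4, hg]
    push_cast
    ring
  have e4 : ∀ T : X →L[ℂ] X, (⟪w, (star T * T) w⟫_ℂ).re = ‖T w‖ ^ 2 := by
    intro T
    change (⟪w, (star T) (T w)⟫_ℂ).re = _
    rw [ContinuousLinearMap.star_eq_adjoint, ContinuousLinearMap.adjoint_inner_right,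
      inner_self_eq_norm_sq_to_K]
    simp [← Complex.ofReal_pow]
  have e5 := congrArg (fun T : X →L[ℂ] X => (⟪w, T w⟫_ℂ).re) e3
  have e6 : (star N * (P * N)) w = 0 := by
    change star N (P (N w)) = 0
    rw [hNw, hPx, map_zero]
  simp only [add_apply, smul_apply, inner_add_right,
    inner_smul_right, Complex.add_re, e6, inner_zero_right, mul_zero, e4,
    add_zero, ← Complex.ofReal_pow, Complex.re_ofReal_mul] at e5
  rw [hLw, hNw] at e5
  refine le_of_sq_le_sq ?_ (norm_nonneg _)
  rw [mul_pow, e5]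
  nlinarith [sq_nonneg ‖H w‖]

/-- The spectral gap: off the spectral subspace of `(s - ρ, s + ρ)`, the operator `is - A₀` is
bounded below by `ρ`. -/
theorem norm_sub_ge (h : IsSkewAdjoint A₀) {s ρ : ℝ} (hρ : 0 < ρ)
    (x : A₀.domain) (hx : (x : X) ∈ (spectralSubspace A₀ (s - ρ) (s + ρ))ᗮ) :
    ρ * ‖(x : X)‖ ≤ ‖(Complex.I * s) • (x : X) - A₀ x‖ := by
  have h1 : Tendsto (fun r : ℝ => r * ‖(x : X)‖) (𝓝[<] ρ) (𝓝 (ρ * ‖(x : X)‖)) :=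
    (tendsto_id.mono_left nhdsWithin_le_nhds).mul_const _
  refine le_of_tendsto h1 ?_
  filter_upwards [Ioo_mem_nhdsLT hρ] with r hr
  exact h.norm_sub_ge_of_lt hr.1 hr.2 x hx

/-- The vector (i Im z - A₀)x has real inner product 0 with x, so adding (Re z)x can only increase
the norm, by Pythagoras. -/
theorem norm_sub_im_le (h : IsSkewAdjoint A₀) (x : A₀.domain) (z : ℂ) :
    ‖(Complex.I * z.im) • (x : X) - A₀ x‖ ≤ ‖z • (x : X) - A₀ x‖ := by
  set v := (Complex.I * z.im) • (x : X) - A₀ x with hv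
  have h1 : z • (x : X) - A₀ x = (z.re : ℂ) • (x : X) + v := by
    conv_lhs => rw [← Complex.re_add_im z]
    rw [hv]
    module
  have h2 : (⟪(x : X), v⟫_ℂ).re = 0 := by
    rw [hv, inner_sub_right, inner_smul_right, inner_self_eq_norm_sq_to_K, Complex.sub_re,
      h.re_inner_eq_zero]
    simp [← Complex.ofReal_pow]
  have h3 : ‖z • (x : X) - A₀ x‖ ^ 2 = ‖(z.re : ℂ) • (x : X)‖ ^ 2 + ‖v‖ ^ 2 := by
    rw [h1, @norm_add_sq ℂ, inner_smul_left]
    simp [h2]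
  refine le_of_sq_le_sq ?_ (norm_nonneg _)
  rw [h3]
  nlinarith [sq_nonneg ‖(z.re : ℂ) • (x : X)‖]

end IsSkewAdjoint

theorem constMR_nonneg (η₀ δ₀ d : ℝ) : 0 ≤ constMR η₀ δ₀ d := by
  unfold constMR
  positivity

/-- Here x, y, a, b, q stand for ‖x‖, ‖(z - A)x‖, ‖x₁‖, ‖x₀‖, ‖D*x‖. Eliminating a, b and q leaves a
quadratic inequality in x. Put w = η²δ²x: the mixed term 2Kyw is absorbed through (w - 2Ky)² ≥ 0,
which produces the factor 2 in front of the root and the summand K² under it. -/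
theorem le_constMR_mul {η₀ δ₀ d η δ x y q a b : ℝ} (hη : η ∈ Ioc 0 η₀) (hδ : δ ∈ Ioc 0 δ₀)
    (hy : 0 ≤ y) (ha : 0 ≤ a) (hb : 0 ≤ b)
    (hqxy : q ^ 2 ≤ y * x) (ha' : δ * a ≤ y + d * q) (hb' : η * b ≤ q + d * a)
    (hab : x ^ 2 = a ^ 2 + b ^ 2) : η ^ 2 * δ ^ 2 * x ≤ constMR η₀ δ₀ d * y := by
  obtain ⟨hη0, hη1⟩ := hη
  obtain ⟨hδ0, hδ1⟩ := hδ
  have h1 : (δ * a) ^ 2 ≤ 2 * (y ^ 2 + d ^ 2 * q ^ 2) := by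
    have : (δ * a) ^ 2 ≤ (y + d * q) ^ 2 := pow_le_pow_left₀ (by positivity) ha' 2
    nlinarith [sq_nonneg (y - d * q)]
  have h2 : (η * b) ^ 2 ≤ 2 * (q ^ 2 + d ^ 2 * a ^ 2) := by
    have : (η * b) ^ 2 ≤ (q + d * a) ^ 2 := pow_le_pow_left₀ (by positivity) hb' 2
    nlinarith [sq_nonneg (q - d * a)]
  set K := δ₀ ^ 2 + η₀ ^ 2 * d ^ 2 + 2 * d ^ 4 with hK
  have hηsq : η ^ 2 ≤ η₀ ^ 2 := pow_le_pow_left₀ hη0.le hη1 2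
  have hδsq : δ ^ 2 ≤ δ₀ ^ 2 := pow_le_pow_left₀ hδ0.le hδ1 2
  have h3 : η ^ 2 * δ ^ 2 * x ^ 2 ≤ 2 * K * (y * x) + 2 * (η ^ 2 + 2 * d ^ 2) * y ^ 2 := by
    have e1 : η ^ 2 * δ ^ 2 * x ^ 2 = η ^ 2 * (δ * a) ^ 2 + δ ^ 2 * (η * b) ^ 2 := by
      rw [hab]; ring
    have e2 : δ ^ 2 * (η * b) ^ 2 ≤ 2 * δ ^ 2 * q ^ 2 + 2 * d ^ 2 * (δ * a) ^ 2 := by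
      nlinarith [mul_le_mul_of_nonneg_left h2 (sq_nonneg δ)]
    have e3 : (η ^ 2 + 2 * d ^ 2) * (δ * a) ^ 2
        ≤ (η ^ 2 + 2 * d ^ 2) * (2 * (y ^ 2 + d ^ 2 * q ^ 2)) := by gcongr
    have e4 : (δ ^ 2 + η ^ 2 * d ^ 2 + 2 * d ^ 4) * q ^ 2 ≤ K * (y * x) := by
      rw [hK]; gcongr
    nlinarith
  have h4 : (η ^ 2 * δ ^ 2 * x) ^ 2
      ≤ 4 * (η₀ ^ 4 * δ₀ ^ 2 + 2 * η₀ ^ 2 * δ₀ ^ 2 * d ^ 2 + K ^ 2) * y ^ 2 := by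
    have e1 := mul_le_mul_of_nonneg_left h3 (show 0 ≤ η ^ 2 * δ ^ 2 by positivity)
    have e2 := sq_nonneg (η ^ 2 * δ ^ 2 * x - 2 * K * y)
    have e3 : (η ^ 4 * δ ^ 2 + 2 * η ^ 2 * δ ^ 2 * d ^ 2) * y ^ 2
        ≤ (η₀ ^ 4 * δ₀ ^ 2 + 2 * η₀ ^ 2 * δ₀ ^ 2 * d ^ 2) * y ^ 2 := by gcongr
    nlinarith
  refine le_of_sq_le_sq (h4.trans_eq ?_) (mul_nonneg (constMR_nonneg _ _ _) hy)
  rw [constMR, mul_pow, mul_pow, Real.sq_sqrt (by positivity),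
    show (2 : ℝ) ^ 2 = 4 by norm_num]

/-! ### The resolvent estimate for A₀ - DD*. -/

section DampedResolvent

variable {U : Type*} [NormedAddCommGroup U] [InnerProductSpace ℂ U] [CompleteSpace U]
  {D : U →L[ℂ] X}

theorem IsSkewAdjoint.damped_lower_bound (h : IsSkewAdjoint A₀) {η₀ δ₀ η δ : ℝ}
    (hη : η ∈ Ioc 0 η₀) (hδ : δ ∈ Ioc 0 δ₀) {z : ℂ} (hz : 0 ≤ z.re)
    (hD : ∀ x ∈ range (spectralProj A₀ (z.im - δ) (z.im + δ)),
      η * ‖x‖ ≤ ‖ContinuousLinearMap.adjoint D x‖) (x : A₀.domain) :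
    η ^ 2 * δ ^ 2 * ‖(x : X)‖ ≤ constMR η₀ δ₀ ‖D‖ * ‖z • (x : X) - damped A₀ D x‖ := by
  set Q := spectralProj A₀ (z.im - δ) (z.im + δ) with hQ
  set q := ContinuousLinearMap.adjoint D (x : X) with hq
  set y := z • (x : X) - damped A₀ D x with hy
  have hDn : ‖ContinuousLinearMap.adjoint D‖ = ‖D‖ := LinearIsometryEquiv.norm_map _ _
  set x₀ := Q x with hx₀
  have hx₀m : x₀ ∈ A₀.domain := h.spectralProj_mem _ _ x
  set x₁ := (x : X) - x₀ with hx₁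
  have hx₁m : x₁ ∈ A₀.domain := A₀.domain.sub_mem x.2 hx₀m
  have hx₁o : x₁ ∈ (spectralSubspace A₀ (z.im - δ) (z.im + δ))ᗮ :=
    Submodule.sub_starProjection_mem_orthogonal (K := spectralSubspace A₀ (z.im - δ) (z.im + δ)) _
  -- The projection commutes with A₀, so the gap estimate on x₁ involves only the projected part of
  -- (z - A₀)x = y - DD*x.
  have hres : z • x₁ - A₀ ⟨x₁, hx₁m⟩ = (y - D q) - Q (y - D q) := by
    have e1 : A₀ ⟨x₁, hx₁m⟩ = A₀ x - Q (A₀ x) := by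
      rw [hQ, ← h.apply_spectralProj _ _ x, ← A₀.map_sub]
      rfl
    have e2 : y - D q = z • (x : X) - A₀ x := by
      rw [hy, damped_apply]
      module
    rw [e1, e2, map_sub, map_smul, hx₁, hx₀]
    module
  refine le_constMR_mul (a := ‖x₁‖) (b := ‖x₀‖) (q := ‖q‖) hη hδ (norm_nonneg _) (norm_nonneg _)
    (norm_nonneg _) ?_ ?_ ?_ ?_
  · have e1 : (⟪(x : X), y⟫_ℂ).re = z.re * ‖(x : X)‖ ^ 2 + ‖q‖ ^ 2 := by
      rw [hy, inner_sub_right, Complex.sub_re, h.re_inner_damped, inner_smul_right,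
        inner_self_eq_norm_sq_to_K]
      simp [← Complex.ofReal_pow, hq]
    have e2 : (⟪(x : X), y⟫_ℂ).re ≤ ‖(x : X)‖ * ‖y‖ :=
      (Complex.re_le_norm _).trans (norm_inner_le_norm _ _)
    have e3 : 0 ≤ z.re * ‖(x : X)‖ ^ 2 := by positivity
    linarith [mul_comm ‖y‖ ‖(x : X)‖]
  · calc δ * ‖x₁‖ ≤ ‖(Complex.I * z.im) • x₁ - A₀ ⟨x₁, hx₁m⟩‖ :=
          h.norm_sub_ge hδ.1 ⟨x₁, hx₁m⟩ hx₁o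
      _ ≤ ‖z • x₁ - A₀ ⟨x₁, hx₁m⟩‖ := h.norm_sub_im_le ⟨x₁, hx₁m⟩ z
      _ ≤ ‖y - D q‖ := by
          rw [hres]
          refine le_of_sq_le_sq ?_ (norm_nonneg _)
          have e1 := Submodule.norm_sq_eq_add_norm_sq_starProjection (y - D q)
            (spectralSubspace A₀ (z.im - δ) (z.im + δ))
          rw [Submodule.starProjection_orthogonal_val] at e1
          change ‖y - D q‖ ^ 2 = ‖Q (y - D q)‖ ^ 2 + ‖(y - D q) - Q (y - D q)‖ ^ 2 at e1
          rw [e1]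
          linarith [sq_nonneg ‖Q (y - D q)‖]
      _ ≤ ‖y‖ + ‖D‖ * ‖q‖ := (norm_sub_le _ _).trans (by gcongr; exact D.le_opNorm q)
  · calc η * ‖x₀‖ ≤ ‖ContinuousLinearMap.adjoint D x₀‖ := hD _ ⟨x, rfl⟩
      _ = ‖q - ContinuousLinearMap.adjoint D x₁‖ := by
          rw [hx₁, map_sub, hq, sub_sub_cancel]
      _ ≤ ‖q‖ + ‖D‖ * ‖x₁‖ := (norm_sub_le _ _).trans (by
          gcongr; rw [← hDn]; exact (ContinuousLinearMap.adjoint D).le_opNorm x₁)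
  · have e1 := Submodule.norm_sq_eq_add_norm_sq_starProjection (x : X)
      (spectralSubspace A₀ (z.im - δ) (z.im + δ))
    rw [Submodule.starProjection_orthogonal_val] at e1
    change ‖(x : X)‖ ^ 2 = ‖x₀‖ ^ 2 + ‖x₁‖ ^ 2 at e1
    linarith

theorem constMR_pos {η₀ δ₀ d : ℝ} (hη : 0 < η₀) (hδ : 0 < δ₀) :
    0 < constMR η₀ δ₀ d := by
  unfold constMR
  positivity

/-- The resolvent estimate on the closed right half-plane. -/
theorem IsSkewAdjoint.damped_resolvent (h : IsSkewAdjoint A₀) {η₀ δ₀ : ℝ} {η δ : ℝ → ℝ}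
    (hη : ∀ s, η s ∈ Ioc 0 η₀) (hδ : ∀ s, δ s ∈ Ioc 0 δ₀)
    (hD : ∀ s : ℝ, ∀ x ∈ range (spectralProj A₀ (s - δ s) (s + δ s)),
      η s * ‖x‖ ≤ ‖ContinuousLinearMap.adjoint D x‖) {z : ℂ} (hz : 0 ≤ z.re) :
    z ∈ rho (damped A₀ D) ∧
      ‖resolventOp (damped A₀ D) z‖ ≤ constMR η₀ δ₀ ‖D‖ / (η z.im ^ 2 * δ z.im ^ 2) := by
  have hM : 0 < constMR η₀ δ₀ ‖D‖ :=
    constMR_pos ((hη 0).1.trans_le (hη 0).2) ((hδ 0).1.trans_le (hδ 0).2)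
  have hpos : 0 < η z.im ^ 2 * δ z.im ^ 2 := by
    have := (hη z.im).1; have := (hδ z.im).1; positivity
  have hlow : ∀ u : ℂ, 0 ≤ u.re → u.im = z.im → ∀ x : A₀.domain,
      η z.im ^ 2 * δ z.im ^ 2 / constMR η₀ δ₀ ‖D‖ * ‖(x : X)‖ ≤ ‖u • (x : X) - damped A₀ D x‖ := by
    intro u hu him x
    rw [div_mul_eq_mul_div, div_le_iff₀' hM, ← him]
    exact h.damped_lower_bound (hη _) (hδ _) hu (hD _) x
  have hρ : z ∈ rho (damped A₀ D) := by
    -- The continuation starts at z + 1, inside the open half-plane, and runs horizontally, so Im z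
    -- and hence the constants η, δ do not change along the way.
    refine mem_rho_of_lower_bound (z := z + 1)
      (h.mDissipative_damped.mem_rho _ (by simpa using by linarith)) (div_pos hpos hM) ?_
    rintro u ⟨a, b, ha, hb, hab, rfl⟩ x
    have hb' : b = 1 - a := by linarith
    refine hlow _ ?_ ?_ x
    · simp only [Complex.add_re, Complex.real_smul, Complex.re_ofReal_mul, Complex.one_re]
      nlinarith
    · simp only [Complex.add_im, Complex.real_smul, Complex.im_ofReal_mul, Complex.one_im, hb']
      ring
  refine ⟨hρ, ?_⟩
  have := (isResolventAt_resolventOp hρ).norm_le (div_pos hpos hM) (hlow z hz rfl)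
  rwa [one_div_div] at this

end DampedResolvent

end Spectral

/-! ### Balakrishnan's integrals and complementary fractional powers. -/

section PseudoResolvent

open MeasureTheory

/-- Functions on `[0, ∞)` which satisfy the resolvent identity and decay like `(1 + t)⁻¹`. -/
structure PseudoResolvent {E : Type*} [NormedRing E] [NormedAlgebra ℝ E] (r : ℝ → E) (c : ℝ) :
    Prop where
  sub_eq : ∀ s t : ℝ, 0 ≤ s → 0 ≤ t → r s - r t = (t - s) • (r s * r t)
  norm_le : ∀ t : ℝ, 0 ≤ t → ‖r t‖ ≤ c * (1 + t)⁻¹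

theorem integrableOn_rpow_mul_inv {θ : ℝ} (h0 : 0 < θ) (h1 : θ < 1) :
    IntegrableOn (fun t : ℝ => t ^ (-θ) * (1 + t)⁻¹) (Ioi 0) := by
  have hm : ∀ s : Set ℝ, MeasurableSet s → s ⊆ Ioi 0 →
      AEStronglyMeasurable (fun t : ℝ => t ^ (-θ) * (1 + t)⁻¹) (volume.restrict s) := by
    intro s hs hs0
    refine ContinuousOn.aestronglyMeasurable (fun t ht => ?_) hs
    have ht0 : 0 < t := hs0 ht
    exact ((Real.continuousAt_rpow_const _ _ (Or.inl ht0.ne')).mul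
      ((continuousAt_const.add continuousAt_id).inv₀ (by simp; positivity))).continuousWithinAt
  rw [← Ioc_union_Ioi_eq_Ioi zero_le_one]
  refine IntegrableOn.union ?_ ?_
  · have h2 : IntegrableOn (fun t : ℝ => t ^ (-θ)) (Ioc 0 1) := by
      rw [← intervalIntegrable_iff_integrableOn_Ioc_of_le zero_le_one]
      exact intervalIntegral.intervalIntegrable_rpow' (by linarith)
    refine h2.mono' (hm _ measurableSet_Ioc fun t ht => ht.1) ?_
    filter_upwards [ae_restrict_mem measurableSet_Ioc] with t ht
    have ht0 : 0 < t := ht.1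
    rw [Real.norm_of_nonneg (by positivity)]
    refine mul_le_of_le_one_right (by positivity) (inv_le_one_of_one_le₀ (by linarith))
  · have h2 : IntegrableOn (fun t : ℝ => t ^ (-θ - 1)) (Ioi 1) :=
      integrableOn_Ioi_rpow_of_lt (by linarith) one_pos
    refine h2.mono' (hm _ measurableSet_Ioi fun t ht =>
      lt_trans zero_lt_one (show (1 : ℝ) < t from ht)) ?_
    filter_upwards [ae_restrict_mem measurableSet_Ioi] with t ht
    have ht0 : 0 < t := zero_lt_one.trans ht
    rw [Real.norm_of_nonneg (by positivity), Real.rpow_sub_one ht0.ne', div_eq_mul_inv]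
    gcongr
    linarith

/-- Write (1 + t)⁻¹ as an integral of exponentials and exchange the integrals: the value is Γ(θ)Γ(1
- θ), and Euler's reflection formula applies. -/
theorem integral_rpow_mul_inv {θ : ℝ} (h0 : 0 < θ) (h1 : θ < 1) :
    ∫ t in Ioi (0 : ℝ), t ^ (-θ) * (1 + t)⁻¹ = Real.pi / Real.sin (Real.pi * θ) := by
  have hG1 : 0 < Real.Gamma (1 - θ) := Real.Gamma_pos_of_pos (by linarith)
  have hexp : ∀ t : ℝ, 0 < t → ∫⁻ x in Ioi (0 : ℝ), ENNReal.ofReal (Real.exp (-((1 + t) * x)))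
      = ENNReal.ofReal ((1 + t)⁻¹) := by
    intro t ht
    have e1 := Real.integral_rpow_mul_exp_neg_mul_Ioi one_pos (show 0 < 1 + t by linarith)
    simp only [sub_self, Real.rpow_zero, one_mul, Real.rpow_one, Real.Gamma_one, mul_one,
      one_div] at e1
    rw [← e1, ofReal_integral_eq_lintegral_ofReal _ (ae_of_all _ fun x => (Real.exp_pos _).le)]
    -- Integrability comes for free: the integral would be 0 by default otherwise, while its value
    -- is positive.
    by_contra hn
    rw [integral_undef hn] at e1
    have : 0 < (1 + t)⁻¹ := by positivity
    linarith
  have hpow : ∀ x : ℝ, 0 < x → ∫⁻ t in Ioi (0 : ℝ), ENNReal.ofReal (t ^ (-θ) * Real.exp (-(x * t)))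
      = ENNReal.ofReal (x ^ (θ - 1) * Real.Gamma (1 - θ)) := by
    intro x hx
    have e1 := Real.integral_rpow_mul_exp_neg_mul_Ioi (show 0 < 1 - θ by linarith) hx
    rw [show 1 - θ - 1 = -θ by ring, one_div, Real.inv_rpow hx.le, ← Real.rpow_neg hx.le,
      neg_sub] at e1
    rw [← e1, ofReal_integral_eq_lintegral_ofReal]
    · by_contra hn
      rw [integral_undef hn] at e1
      have : 0 < x ^ (θ - 1) * Real.Gamma (1 - θ) := by positivity
      linarith
    · filter_upwards [ae_restrict_mem measurableSet_Ioi] with t ht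
      have : 0 < t := ht
      positivity
  have hmain : ∫⁻ t in Ioi (0 : ℝ), ENNReal.ofReal (t ^ (-θ) * (1 + t)⁻¹)
      = ENNReal.ofReal (Real.pi / Real.sin (Real.pi * θ)) := by
    calc ∫⁻ t in Ioi (0 : ℝ), ENNReal.ofReal (t ^ (-θ) * (1 + t)⁻¹)
        = ∫⁻ t in Ioi (0 : ℝ), ∫⁻ x in Ioi (0 : ℝ),
            ENNReal.ofReal (t ^ (-θ)) * ENNReal.ofReal (Real.exp (-((1 + t) * x))) := by
          refine setLIntegral_congr_fun measurableSet_Ioi fun t ht => ?_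
          have ht0 : 0 < t := ht
          rw [lintegral_const_mul _ (by fun_prop), hexp t ht0, ← ENNReal.ofReal_mul (by positivity)]
      _ = ∫⁻ x in Ioi (0 : ℝ), ∫⁻ t in Ioi (0 : ℝ),
            ENNReal.ofReal (t ^ (-θ)) * ENNReal.ofReal (Real.exp (-((1 + t) * x))) := by
          refine lintegral_lintegral_swap (Measurable.aemeasurable ?_)
          change Measurable fun p : ℝ × ℝ =>
            ENNReal.ofReal (p.1 ^ (-θ)) * ENNReal.ofReal (Real.exp (-((1 + p.1) * p.2)))
          fun_prop
      _ = ∫⁻ x in Ioi (0 : ℝ), ENNReal.ofReal (Real.Gamma (1 - θ)) *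
            ENNReal.ofReal (x ^ (θ - 1) * Real.exp (-(1 * x))) := by
          refine setLIntegral_congr_fun measurableSet_Ioi fun x hx => ?_
          have hx0 : 0 < x := hx
          have e1 : ∀ t : ℝ, t ∈ Ioi (0 : ℝ) →
              ENNReal.ofReal (t ^ (-θ)) * ENNReal.ofReal (Real.exp (-((1 + t) * x)))
                = ENNReal.ofReal (Real.exp (-x)) *
                  ENNReal.ofReal (t ^ (-θ) * Real.exp (-(x * t))) := by
            intro t ht
            have ht0 : 0 < t := ht
            rw [← ENNReal.ofReal_mul (by positivity), ← ENNReal.ofReal_mul (by positivity),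
              show -((1 + t) * x) = -x + -(x * t) by ring, Real.exp_add]
            congr 1
            ring
          rw [setLIntegral_congr_fun measurableSet_Ioi e1, lintegral_const_mul _ (by fun_prop),
            hpow x hx0, ← ENNReal.ofReal_mul (by positivity), ← ENNReal.ofReal_mul hG1.le]
          congr 1
          rw [one_mul]
          ring
      _ = ENNReal.ofReal (Real.Gamma (1 - θ)) * ENNReal.ofReal (Real.Gamma θ) := by
          rw [lintegral_const_mul _ (by fun_prop)]
          congr 1
          have e1 := Real.integral_rpow_mul_exp_neg_mul_Ioi h0 one_pos
          rw [div_one, Real.one_rpow, one_mul] at e1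
          rw [← e1, ofReal_integral_eq_lintegral_ofReal]
          · by_contra hn
            rw [integral_undef hn] at e1
            linarith [Real.Gamma_pos_of_pos h0]
          · filter_upwards [ae_restrict_mem measurableSet_Ioi] with t ht
            have : 0 < t := ht
            positivity
      _ = _ := by
          rw [← ENNReal.ofReal_mul hG1.le, mul_comm, Real.Gamma_mul_Gamma_one_sub]
  have hnn : ∀ᵐ t ∂volume.restrict (Ioi (0 : ℝ)), 0 ≤ t ^ (-θ) * (1 + t)⁻¹ := by
    filter_upwards [ae_restrict_mem measurableSet_Ioi] with t ht
    have : 0 < t := ht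
    positivity
  have hsin : 0 < Real.sin (Real.pi * θ) :=
    Real.sin_pos_of_pos_of_lt_pi (by positivity) (by nlinarith [Real.pi_pos])
  rw [← ofReal_integral_eq_lintegral_ofReal (integrableOn_rpow_mul_inv h0 h1) hnn] at hmain
  exact (ENNReal.ofReal_eq_ofReal_iff (integral_nonneg_of_ae hnn) (by positivity)).1 hmain

namespace PseudoResolvent

variable {E : Type*} [NormedRing E] [NormedAlgebra ℝ E] [CompleteSpace E] {r : ℝ → E} {c : ℝ}

theorem nonneg (h : PseudoResolvent r c) : 0 ≤ c := by
  have := (norm_nonneg _).trans (h.norm_le 0 le_rfl)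
  simpa using this

theorem norm_le' (h : PseudoResolvent r c) {t : ℝ} (ht : 0 ≤ t) : ‖r t‖ ≤ c :=
  (h.norm_le t ht).trans (mul_le_of_le_one_right h.nonneg (inv_le_one_of_one_le₀ (by linarith)))

theorem norm_sub_le (h : PseudoResolvent r c) {s t : ℝ} (hs : 0 ≤ s) (ht : 0 ≤ t) :
    ‖r s - r t‖ ≤ c ^ 2 * |s - t| := by
  rw [h.sub_eq s t hs ht, norm_smul, Real.norm_eq_abs, abs_sub_comm, mul_comm]
  gcongr
  calc ‖r s * r t‖ ≤ ‖r s‖ * ‖r t‖ := norm_mul_le _ _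
    _ ≤ c * c := mul_le_mul (h.norm_le' hs) (h.norm_le' ht) (norm_nonneg _) h.nonneg
    _ = c ^ 2 := (sq c).symm

theorem continuousOn (h : PseudoResolvent r c) : ContinuousOn r (Ici 0) := by
  have : LipschitzOnWith (⟨c ^ 2, sq_nonneg c⟩ : NNReal) r (Ici 0) :=
    LipschitzOnWith.of_dist_le_mul fun s hs t ht => by
      rw [dist_eq_norm, Real.dist_eq]
      exact h.norm_sub_le hs ht
  exact this.continuousOn

theorem integrableOn_rpow_smul (h : PseudoResolvent r c) {θ : ℝ} (h0 : 0 < θ) (h1 : θ < 1) :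
    IntegrableOn (fun t : ℝ => t ^ (-θ) • r t) (Ioi 0) := by
  refine ((integrableOn_rpow_mul_inv h0 h1).const_mul c).mono' ?_ ?_
  · refine ContinuousOn.aestronglyMeasurable (fun t ht => ?_) measurableSet_Ioi
    have ht0 : 0 < t := ht
    exact ((Real.continuousAt_rpow_const _ _ (Or.inl ht0.ne')).smul
      (h.continuousOn.continuousAt (Ici_mem_nhds ht0))).continuousWithinAt
  · filter_upwards [ae_restrict_mem measurableSet_Ioi] with t ht
    have ht0 : 0 < t := ht
    rw [norm_smul, Real.norm_of_nonneg (by positivity), mul_left_comm]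
    gcongr
    exact h.norm_le t ht0.le

theorem integrableOn_mul_comp_mul (h : PseudoResolvent r c) {u : ℝ} (hu : 0 < u) :
    IntegrableOn (fun t : ℝ => r t * r (t * u)) (Ioi 0) := by
  have hm : 0 < min 1 u := lt_min one_pos hu
  refine ((integrable_inv_one_add_sq.integrableOn (s := Ioi (0 : ℝ))).const_mul
    (c ^ 2 * (min 1 u)⁻¹)).mono' ?_ ?_
  · refine ContinuousOn.aestronglyMeasurable (h.continuousOn.mono Ioi_subset_Ici_self |>.mul ?_)
      measurableSet_Ioi
    exact h.continuousOn.comp (by fun_prop) fun t ht => (mul_pos ht hu).le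
  · filter_upwards [ae_restrict_mem measurableSet_Ioi] with t ht
    have ht0 : 0 < t := ht
    have e1 : min 1 u * (1 + t ^ 2) ≤ (1 + t) * (1 + t * u) := by
      have := min_le_left 1 u
      have := min_le_right 1 u
      nlinarith [mul_pos ht0 hu, sq_nonneg t]
    calc ‖r t * r (t * u)‖ ≤ ‖r t‖ * ‖r (t * u)‖ := norm_mul_le _ _
      _ ≤ (c * (1 + t)⁻¹) * (c * (1 + t * u)⁻¹) :=
          mul_le_mul (h.norm_le t ht0.le) (h.norm_le _ (by positivity)) (norm_nonneg _)
            (mul_nonneg h.nonneg (by positivity))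
      _ = c ^ 2 * ((1 + t) * (1 + t * u))⁻¹ := by rw [mul_inv]; ring
      _ ≤ c ^ 2 * (min 1 u * (1 + t ^ 2))⁻¹ := by
          gcongr
      _ = _ := by rw [mul_inv]; ring

/-- A Frullani integral. -/
theorem integral_mul_comp_mul (h : PseudoResolvent r c) {u : ℝ} (hu : 0 < u) :
    (u - 1) • ∫ t in Ioi (0 : ℝ), r t * r (t * u) = Real.log u • r 0 := by
  have hc : ContinuousOn (fun s : ℝ => s⁻¹ • r s) (Ioi 0) :=
    (continuousOn_inv₀.mono fun s hs => ne_of_gt hs).smul (h.continuousOn.mono Ioi_subset_Ici_self)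
  have hint : ∀ a b : ℝ, 0 < a → 0 < b →
      IntervalIntegrable (fun s : ℝ => s⁻¹ • r s) volume a b := fun a b ha hb =>
    (hc.mono fun s hs => (lt_min ha hb).trans_le hs.1).intervalIntegrable
  set H : ℝ → E := fun x => ∫ s in (1 : ℝ)..x, s⁻¹ • r s with hH
  have hHd : ∀ x : ℝ, 0 < x → HasDerivAt H (x⁻¹ • r x) x := fun x hx =>
    intervalIntegral.integral_hasDerivAt_right (hint 1 x one_pos hx)
      (hc.stronglyMeasurableAtFilter isOpen_Ioi x hx) (hc.continuousAt (Ioi_mem_nhds hx))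
  -- G(t) is the integral of r(s)/s over [t, tu]. Its derivative (r(tu) - r(t))/t equals (1 - u)
  -- r(t) r(tu) by the resolvent identity, so the integral sought is read off from the limits of G
  -- at 0 and ∞.
  set G : ℝ → E := fun t => H (t * u) - H t with hG
  have hGi : ∀ t : ℝ, 0 < t → G t = ∫ s in t..(t * u), s⁻¹ • r s := fun t ht =>
    intervalIntegral.integral_interval_sub_left (hint 1 _ one_pos (mul_pos ht hu))
      (hint 1 _ one_pos ht)
  have hGd : ∀ t : ℝ, 0 < t → HasDerivAt G ((1 - u) • (r t * r (t * u))) t := by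
    intro t ht
    have h1 : HasDerivAt (fun t => t * u) u t := by simpa using (hasDerivAt_id t).mul_const u
    have h2 := (HasDerivAt.scomp t (hHd (t * u) (mul_pos ht hu)) h1).sub (hHd t ht)
    refine h2.congr_deriv ?_
    have e1 : u • (t * u)⁻¹ • r (t * u) = t⁻¹ • r (t * u) := by
      rw [smul_smul]; congr 1; field_simp
    have e2 : r (t * u) = r t - (t * u - t) • (r t * r (t * u)) := by
      rw [← h.sub_eq t _ ht.le (mul_pos ht hu).le]; abel
    rw [e1, ← smul_sub]
    conv_lhs => rw [e2]
    rw [sub_sub_cancel_left, smul_neg, smul_smul, ← neg_smul]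
    congr 1
    field_simp
    ring
  have hmem : ∀ t s : ℝ, 0 < t → s ∈ uIoc t (t * u) → t * min 1 u ≤ s := by
    intro t s ht hs
    have h1 : min t (t * u) < s := hs.1
    have h2 : min t (t * u) = t * min 1 u := by
      rw [mul_min_of_nonneg _ _ ht.le, mul_one]
    linarith
  have hm : 0 < min 1 u := lt_min one_pos hu
  have hG0 : Tendsto G (𝓝[>] 0) (𝓝 (Real.log u • r 0)) := by
    rw [tendsto_iff_norm_sub_tendsto_zero]
    have h1 : Tendsto (fun t : ℝ => c ^ 2 * |t * u - t|) (𝓝[>] 0) (𝓝 0) := by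
      have : Continuous fun t : ℝ => c ^ 2 * |t * u - t| := by fun_prop
      have h2 := (this.tendsto 0).mono_left (nhdsWithin_le_nhds (s := Ioi 0))
      simpa using h2
    refine squeeze_zero' (Eventually.of_forall fun t => norm_nonneg _) ?_ h1
    filter_upwards [self_mem_nhdsWithin] with t ht
    have ht0 : 0 < t := ht
    have e1 : Real.log u • r 0 = ∫ s in t..(t * u), s⁻¹ • r 0 := by
      rw [intervalIntegral.integral_smul_const, integral_inv_of_pos ht0 (mul_pos ht0 hu),
        mul_div_cancel_left₀ _ ht0.ne']
    have hint0 : IntervalIntegrable (fun s : ℝ => s⁻¹ • r 0) volume t (t * u) := by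
      refine ContinuousOn.intervalIntegrable
        ((continuousOn_inv₀.mono fun s hs => ?_).smul continuousOn_const)
      exact ne_of_gt ((lt_min ht0 (mul_pos ht0 hu)).trans_le hs.1)
    rw [e1, hGi t ht0, ← intervalIntegral.integral_sub (hint _ _ ht0 (mul_pos ht0 hu)) hint0]
    refine intervalIntegral.norm_integral_le_of_norm_le_const fun s hs => ?_
    have hs0 : 0 < s := (mul_pos ht0 hm).trans_le (hmem t s ht0 hs)
    rw [← smul_sub, norm_smul, norm_inv, Real.norm_of_nonneg hs0.le]
    have h3 := h.norm_sub_le hs0.le le_rfl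
    rw [sub_zero, abs_of_pos hs0] at h3
    rw [inv_mul_le_iff₀ hs0, mul_comm]
    exact h3
  have hGinf : Tendsto G atTop (𝓝 0) := by
    have h1 : Tendsto (fun t : ℝ => c * (min 1 u)⁻¹ ^ 2 * |u - 1| * t⁻¹) atTop (𝓝 0) := by
      have := (tendsto_inv_atTop_zero (𝕜 := ℝ)).const_mul (c * (min 1 u)⁻¹ ^ 2 * |u - 1|)
      rwa [mul_zero] at this
    refine squeeze_zero_norm' ?_ h1
    filter_upwards [eventually_gt_atTop 0] with t ht0
    rw [hGi t ht0]
    have h2 : ‖∫ s in t..(t * u), s⁻¹ • r s‖ ≤ c * (min 1 u)⁻¹ ^ 2 * t⁻¹ ^ 2 * |t * u - t| := by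
      refine intervalIntegral.norm_integral_le_of_norm_le_const fun s hs => ?_
      have hs1 := hmem t s ht0 hs
      have hs0 : 0 < s := (mul_pos ht0 hm).trans_le hs1
      rw [norm_smul, norm_inv, Real.norm_of_nonneg hs0.le]
      calc s⁻¹ * ‖r s‖ ≤ s⁻¹ * (c * s⁻¹) := by
            gcongr
            refine (h.norm_le s hs0.le).trans ?_
            have := h.nonneg
            gcongr
            linarith
        _ = c * s⁻¹ ^ 2 := by ring
        _ ≤ c * (t * min 1 u)⁻¹ ^ 2 := by
            have := h.nonneg
            gcongr
        _ = _ := by rw [mul_inv]; ring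
    refine h2.trans_eq ?_
    rw [show t * u - t = t * (u - 1) by ring, abs_mul, abs_of_pos ht0]
    field_simp
  -- G is not continuous at 0 as it stands, so its value there is replaced by the right limit.
  have hFTC := integral_Ioi_of_hasDerivAt_of_tendsto
    (f := Function.update G 0 (Real.log u • r 0)) (f' := fun t => (1 - u) • (r t * r (t * u)))
    (a := 0) (m := 0) (by
      rw [continuousWithinAt_update_same, Ici_sdiff_left]
      exact hG0)
    (fun t ht => by
      refine (hGd t ht).congr_of_eventuallyEq ?_
      filter_upwards [isOpen_ne.mem_nhds (ne_of_gt ht)] with s hs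
      rw [Function.update_of_ne hs])
    ((h.integrableOn_mul_comp_mul hu).smul (1 - u))
    (by
      refine hGinf.congr' ?_
      filter_upwards [eventually_gt_atTop 0] with t ht
      rw [Function.update_of_ne ht.ne'])
  rw [integral_smul, Function.update_self, zero_sub] at hFTC
  rw [← neg_sub 1 u, neg_smul, hFTC, neg_neg]

/-- The norm is at most c²(1 + t)⁻¹ u^(-(1 - θ)) (1 + tu)⁻¹. Scaling turns its u-integral into a
constant times t^(-θ)(1 + t)⁻¹, which is integrable. -/
theorem integrable_prod (h : PseudoResolvent r c) {θ : ℝ} (h0 : 0 < θ) (h1 : θ < 1) :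
    Integrable (fun p : ℝ × ℝ => p.2 ^ (-(1 - θ)) • (r p.1 * r (p.1 * p.2)))
      ((volume.restrict (Ioi 0)).prod (volume.restrict (Ioi 0))) := by
  have hc0 := h.nonneg
  have hsc : ∀ t : ℝ, 0 < t → IntegrableOn (fun u => u ^ (-(1 - θ)) * (1 + t * u)⁻¹) (Ioi 0) ∧
      ∫ u in Ioi (0 : ℝ), u ^ (-(1 - θ)) * (1 + t * u)⁻¹
        = t ^ (-θ) * ∫ s in Ioi (0 : ℝ), s ^ (-(1 - θ)) * (1 + s)⁻¹ := by
    intro t ht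
    have e0 : ∀ u ∈ Ioi (0 : ℝ), t ^ (1 - θ) * ((t * u) ^ (-(1 - θ)) * (1 + t * u)⁻¹)
        = u ^ (-(1 - θ)) * (1 + t * u)⁻¹ := by
      intro u hu
      have hu0 : 0 < u := hu
      rw [Real.mul_rpow ht.le hu0.le, ← mul_assoc, ← mul_assoc, ← Real.rpow_add ht]
      simp
    have e1 := (integrableOn_rpow_mul_inv (θ := 1 - θ) (by linarith) (by linarith))
    have e2 := (integrableOn_Ioi_comp_mul_left_iff
      (fun s : ℝ => s ^ (-(1 - θ)) * (1 + s)⁻¹) 0 ht).2 (by rwa [mul_zero])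
    have e3 := integral_comp_mul_left_Ioi (fun s : ℝ => s ^ (-(1 - θ)) * (1 + s)⁻¹) 0 ht
    refine ⟨IntegrableOn.congr_fun (e2.const_mul (t ^ (1 - θ))) e0 measurableSet_Ioi, ?_⟩
    rw [← setIntegral_congr_fun measurableSet_Ioi e0, integral_const_mul, e3, mul_zero, smul_eq_mul,
      ← mul_assoc]
    congr 1
    rw [← Real.rpow_neg_one t, ← Real.rpow_add ht]
    congr 1
    ring
  have hpt : ∀ t u : ℝ, 0 < t → 0 < u → ‖u ^ (-(1 - θ)) • (r t * r (t * u))‖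
      ≤ c ^ 2 * (1 + t)⁻¹ * (u ^ (-(1 - θ)) * (1 + t * u)⁻¹) := by
    intro t u ht hu
    rw [norm_smul, Real.norm_of_nonneg (by positivity)]
    calc u ^ (-(1 - θ)) * ‖r t * r (t * u)‖
        ≤ u ^ (-(1 - θ)) * ((c * (1 + t)⁻¹) * (c * (1 + t * u)⁻¹)) := by
          gcongr
          exact (norm_mul_le _ _).trans (mul_le_mul (h.norm_le t ht.le) (h.norm_le _ (by positivity))
            (norm_nonneg _) (by positivity))
      _ = _ := by ring
  have hmeas : AEStronglyMeasurable (fun p : ℝ × ℝ => p.2 ^ (-(1 - θ)) • (r p.1 * r (p.1 * p.2)))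
      ((volume.restrict (Ioi 0)).prod (volume.restrict (Ioi 0))) := by
    rw [Measure.prod_restrict]
    refine ContinuousOn.aestronglyMeasurable ?_ (measurableSet_Ioi.prod measurableSet_Ioi)
    refine ContinuousOn.smul ?_ (ContinuousOn.mul ?_ ?_)
    · exact ContinuousOn.rpow_const continuousOn_snd fun p hp => Or.inl (ne_of_gt hp.2)
    · exact h.continuousOn.comp continuousOn_fst fun p hp =>
        show 0 ≤ p.1 from le_of_lt hp.1
    · exact h.continuousOn.comp (by fun_prop) fun p hp =>
        show 0 ≤ p.1 * p.2 from le_of_lt (mul_pos hp.1 hp.2)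
  have hslice : ∀ t : ℝ, 0 < t →
      IntegrableOn (fun u => u ^ (-(1 - θ)) • (r t * r (t * u))) (Ioi 0) := by
    intro t ht
    refine ((hsc t ht).1.const_mul (c ^ 2 * (1 + t)⁻¹)).mono' ?_ ?_
    · refine ContinuousOn.aestronglyMeasurable ?_ measurableSet_Ioi
      refine ContinuousOn.smul ?_ (continuousOn_const.mul ?_)
      · exact ContinuousOn.rpow_const continuousOn_id fun p hp => Or.inl (ne_of_gt hp)
      · exact h.continuousOn.comp (by fun_prop) fun p hp => le_of_lt (mul_pos ht hp)
    · filter_upwards [ae_restrict_mem measurableSet_Ioi] with u hu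
      exact hpt t u ht hu
  rw [integrable_prod_iff hmeas]
  constructor
  · filter_upwards [ae_restrict_mem measurableSet_Ioi] with t ht
    exact hslice t ht
  · refine ((integrableOn_rpow_mul_inv h0 h1).const_mul
      (c ^ 2 * ∫ s in Ioi (0 : ℝ), s ^ (-(1 - θ)) * (1 + s)⁻¹)).mono'
      hmeas.norm.integral_prod_right' ?_
    filter_upwards [ae_restrict_mem measurableSet_Ioi] with t ht
    have ht0 : 0 < t := ht
    rw [Real.norm_of_nonneg (integral_nonneg fun _ => norm_nonneg _)]
    calc ∫ u in Ioi (0 : ℝ), ‖u ^ (-(1 - θ)) • (r t * r (t * u))‖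
        ≤ ∫ u in Ioi (0 : ℝ), c ^ 2 * (1 + t)⁻¹ * (u ^ (-(1 - θ)) * (1 + t * u)⁻¹) :=
          setIntegral_mono_on (hslice t ht0).norm ((hsc t ht0).1.const_mul _) measurableSet_Ioi
            fun u hu => hpt t u ht0 hu
      _ = _ := by
          rw [integral_const_mul, (hsc t ht0).2]
          ring

/-- Substitute s = tu in the second factor: the powers of t cancel because the exponents are
complementary. After Fubini the t-integral is the Frullani integral, so the product is a scalar
multiple of r(0). -/
theorem integral_mul_integral (h : PseudoResolvent r c) {θ : ℝ} (h0 : 0 < θ) (h1 : θ < 1) :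
    (∫ t in Ioi (0 : ℝ), t ^ (-θ) • r t) * (∫ t in Ioi (0 : ℝ), t ^ (-(1 - θ)) • r t)
      = (∫ u in Ioi (0 : ℝ), u ^ (-(1 - θ)) * (Real.log u / (u - 1))) • r 0 := by
  rw [← integral_mul_const_of_integrable (h.integrableOn_rpow_smul h0 h1)]
  have e1 : ∀ t ∈ Ioi (0 : ℝ), (t ^ (-θ) • r t) * (∫ s in Ioi (0 : ℝ), s ^ (-(1 - θ)) • r s)
      = ∫ u in Ioi (0 : ℝ), u ^ (-(1 - θ)) • (r t * r (t * u)) := by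
    intro t ht
    have ht0 : 0 < t := ht
    have e2 := integral_comp_mul_left_Ioi' (fun s : ℝ => s ^ (-(1 - θ)) • r s) 0 ht0
    have e3 := (integrableOn_Ioi_comp_mul_left_iff (fun s : ℝ => s ^ (-(1 - θ)) • r s) 0 ht0).2
      (by rw [mul_zero]; exact h.integrableOn_rpow_smul (by linarith) (by linarith))
    rw [mul_zero] at e2
    rw [← e2, mul_smul_comm, smul_mul_assoc, ← integral_const_mul_of_integrable e3, smul_smul,
      ← integral_smul]
    refine setIntegral_congr_fun measurableSet_Ioi fun u hu => ?_
    have hu0 : 0 < u := hu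
    rw [mul_smul_comm, smul_smul, Real.mul_rpow ht0.le hu0.le]
    congr 1
    have e4 : t * t ^ (-θ) * t ^ (-(1 - θ)) = 1 := by
      nth_rewrite 1 [← Real.rpow_one t]
      rw [← Real.rpow_add ht0, ← Real.rpow_add ht0]
      rw [show 1 + -θ + -(1 - θ) = (0 : ℝ) by ring, Real.rpow_zero]
    rw [← mul_assoc, e4, one_mul]
  rw [setIntegral_congr_fun measurableSet_Ioi e1, integral_integral_swap (h.integrable_prod h0 h1),
    ← integral_smul_const]
  refine integral_congr_ae ?_
  have hne : ∀ᵐ u ∂volume.restrict (Ioi (0 : ℝ)), u ≠ 1 :=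
    ae_restrict_of_ae (Measure.ae_ne volume 1)
  filter_upwards [ae_restrict_mem measurableSet_Ioi, hne] with u hu hu1
  have hu1' : u - 1 ≠ 0 := sub_ne_zero.2 hu1
  rw [integral_smul, mul_smul]
  congr 1
  rw [div_eq_inv_mul, mul_smul, ← h.integral_mul_comp_mul hu, smul_smul, inv_mul_cancel₀ hu1',
    one_smul]

/-- The scalar in `integral_mul_integral` depends only on θ, so this one-dimensional example
determines it. -/
theorem scalar : PseudoResolvent (fun t : ℝ => (1 + t)⁻¹) 1 where
  sub_eq s t hs ht := by
    have : 1 + s ≠ 0 := by positivity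
    have : 1 + t ≠ 0 := by positivity
    rw [smul_eq_mul]
    field_simp
    ring
  norm_le t ht := by
    rw [Real.norm_of_nonneg (by positivity), one_mul]

/-- Balakrishnan's formula defines complementary powers. -/
theorem balakrishnan_mul (h : PseudoResolvent r c) {θ : ℝ} (h0 : 0 < θ) (h1 : θ < 1) :
    ((Real.sin (Real.pi * θ) / Real.pi) • ∫ t in Ioi (0 : ℝ), t ^ (-θ) • r t) *
      ((Real.sin (Real.pi * (1 - θ)) / Real.pi) • ∫ t in Ioi (0 : ℝ), t ^ (-(1 - θ)) • r t)
      = r 0 := by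
  have e1 := scalar.integral_mul_integral h0 h1
  simp only [smul_eq_mul, add_zero, inv_one, mul_one] at e1
  rw [integral_rpow_mul_inv h0 h1, integral_rpow_mul_inv (by linarith) (by linarith)] at e1
  rw [smul_mul_smul_comm, h.integral_mul_integral h0 h1, ← e1, smul_smul]
  have hs : 0 < Real.sin (Real.pi * θ) :=
    Real.sin_pos_of_pos_of_lt_pi (by positivity) (by nlinarith [Real.pi_pos])
  have hs' : 0 < Real.sin (Real.pi * (1 - θ)) :=
    Real.sin_pos_of_pos_of_lt_pi (mul_pos Real.pi_pos (by linarith)) (by nlinarith [Real.pi_pos])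
  have : Real.sin (Real.pi * θ) / Real.pi * (Real.sin (Real.pi * (1 - θ)) / Real.pi) *
      (Real.pi / Real.sin (Real.pi * θ) * (Real.pi / Real.sin (Real.pi * (1 - θ)))) = 1 := by
    field_simp
  rw [this, one_smul]

end PseudoResolvent

end PseudoResolvent

/-! ### Fractional powers and the moment inequality. -/

section FractionalPowers

open MeasureTheory

/-- The half-line `[0, ∞)` lies in the resolvent set, with `‖R(t, A)‖ ≤ c / (1 + t)`. -/
structure PositiveResolvent {X : Type*} [NormedAddCommGroup X] [NormedSpace ℂ X]
    (A : X →ₗ.[ℂ] X) (c : ℝ) : Prop where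
  mem_rho : ∀ t : ℝ, 0 ≤ t → (t : ℂ) ∈ rho A
  norm_le : ∀ t : ℝ, 0 ≤ t → ‖resolventOp A t‖ ≤ c * (1 + t)⁻¹

variable {X : Type*} [NormedAddCommGroup X] [NormedSpace ℂ X] [CompleteSpace X]
  {A : X →ₗ.[ℂ] X} {c : ℝ}

theorem exists_positiveResolvent (h0 : (0 : ℂ) ∈ rho A)
    (hρ : ∀ t : ℝ, 0 < t → (t : ℂ) ∈ rho A) (hn : ∀ t : ℝ, 0 < t → ‖resolventOp A t‖ ≤ 1 / t) :
    ∃ c, PositiveResolvent A c := by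
  have hmem : ∀ t : ℝ, 0 ≤ t → (t : ℂ) ∈ rho A := fun t ht => by
    rcases ht.eq_or_lt with rfl | h
    · simpa using h0
    · exact hρ t h
  have hc : ContinuousOn (fun t : ℝ => ‖resolventOp A t‖) (Icc 0 1) :=
    (continuousOn_resolventOp.comp Complex.continuous_ofReal.continuousOn
      fun t ht => hmem t ht.1).norm
  obtain ⟨M, hM⟩ := isCompact_Icc.bddAbove_image hc
  refine ⟨2 * max M 1, hmem, fun t ht => ?_⟩
  rw [← div_eq_mul_inv, le_div_iff₀ (by linarith)]
  by_cases h1 : t ≤ 1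
  · have h2 : ‖resolventOp A t‖ ≤ max M 1 :=
      (hM (mem_image_of_mem _ ⟨ht, h1⟩)).trans (le_max_left _ _)
    nlinarith [norm_nonneg (resolventOp A t)]
  · have h1' : 0 < t := by linarith
    have h2 := hn t h1'
    rw [le_div_iff₀ h1'] at h2
    nlinarith [le_max_right M 1, norm_nonneg (resolventOp A t)]

namespace PositiveResolvent

theorem pseudoResolvent (h : PositiveResolvent A c) :
    PseudoResolvent (fun t : ℝ => resolventOp A t) c where
  sub_eq s t hs ht := by
    rw [(isResolventAt_resolventOp (h.mem_rho s hs)).sub_eq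
      (isResolventAt_resolventOp (h.mem_rho t ht)), ← Complex.ofReal_sub, Complex.coe_smul]
  norm_le := h.norm_le

theorem zero_mem (h : PositiveResolvent A c) : (0 : ℂ) ∈ rho A := by
  simpa using h.mem_rho 0 le_rfl

theorem isResolventAt_zero (h : PositiveResolvent A c) : IsResolventAt A 0 (resolventOp A 0) :=
  isResolventAt_resolventOp h.zero_mem

theorem mul_norm_le (h : PositiveResolvent A c) {t : ℝ} (ht : 0 ≤ t) :
    t * ‖resolventOp A t‖ ≤ c := by
  have h1 := h.norm_le t ht
  rw [← div_eq_mul_inv, le_div_iff₀ (by linarith)] at h1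
  nlinarith [norm_nonneg (resolventOp A t)]

end PositiveResolvent

theorem negFracPow_of_fract_eq_zero {β : ℝ} (hβ : Int.fract β = 0) :
    negFracPow A β = resolventOp A 0 ^ ⌊β⌋₊ := by
  rw [negFracPow, if_pos hβ, mul_one]

theorem negFracPow_natCast (n : ℕ) : negFracPow A n = resolventOp A 0 ^ n := by
  rw [negFracPow_of_fract_eq_zero (Int.fract_natCast n), Nat.floor_natCast]

variable (A) in
/-- Balakrishnan's formula for `(-A)^(-θ)`, `0 < θ < 1`. -/
def balakrishnan (θ : ℝ) : X →L[ℂ] X :=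
  (Real.sin (Real.pi * θ) / Real.pi) • ∫ t in Ioi (0 : ℝ), t ^ (-θ) • resolventOp A t

theorem negFracPow_of_fract_ne_zero {β : ℝ} (hβ : Int.fract β ≠ 0) :
    negFracPow A β = resolventOp A 0 ^ ⌊β⌋₊ * balakrishnan A (Int.fract β) := by
  rw [negFracPow, if_neg hβ, balakrishnan]
  simp only [Complex.coe_smul]

theorem fract_pos {β : ℝ} (hβ : Int.fract β ≠ 0) : 0 < Int.fract β :=
  (Int.fract_nonneg β).lt_of_ne' hβ

theorem natFloor_add_fract {β : ℝ} (hβ : 0 ≤ β) : (⌊β⌋₊ : ℝ) + Int.fract β = β := by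
  rw [natCast_floor_eq_intCast_floor hβ, Int.floor_add_fract]

theorem commute_balakrishnan (h : PositiveResolvent A c) {θ : ℝ} (h0 : 0 < θ) (h1 : θ < 1)
    {S : X →L[ℂ] X} (hS : ∀ t : ℝ, 0 ≤ t → Commute S (resolventOp A t)) :
    Commute S (balakrishnan A θ) := by
  refine Commute.smul_right ?_ _
  have hi := h.pseudoResolvent.integrableOn_rpow_smul h0 h1
  rw [commute_iff_eq, ← integral_const_mul_of_integrable hi, ← integral_mul_const_of_integrable hi]
  refine setIntegral_congr_fun measurableSet_Ioi fun t ht => ?_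
  exact (hS t (le_of_lt ht)).smul_right _

theorem commute_negFracPow (h : PositiveResolvent A c) {S : X →L[ℂ] X}
    (hS : ∀ t : ℝ, 0 ≤ t → Commute S (resolventOp A t)) (β : ℝ) : Commute S (negFracPow A β) := by
  have hK : Commute S (resolventOp A 0 ^ ⌊β⌋₊) := by
    have := hS 0 le_rfl
    rw [Complex.ofReal_zero] at this
    exact this.pow_right _
  by_cases hβ : Int.fract β = 0
  · rwa [negFracPow_of_fract_eq_zero hβ]
  · rw [negFracPow_of_fract_ne_zero hβ]
    exact hK.mul_right (commute_balakrishnan h (fract_pos hβ) (Int.fract_lt_one β) hS)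

theorem commute_resolventOp_negFracPow (h : PositiveResolvent A c) {z : ℂ} (hz : z ∈ rho A)
    (β : ℝ) : Commute (resolventOp A z) (negFracPow A β) :=
  commute_negFracPow h (fun t ht =>
    (isResolventAt_resolventOp hz).commute (isResolventAt_resolventOp (h.mem_rho t ht))) β

/-- If β is not an integer, the fractional parts of β and γ add up to 1, so the two Balakrishnan
factors multiply to R(0) and supply the power missing from ⌊β⌋ + ⌊γ⌋ = n - 1. -/
theorem negFracPow_mul_negFracPow (h : PositiveResolvent A c) {β γ : ℝ} (hβ : 0 ≤ β) (hγ : 0 ≤ γ)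
    {n : ℕ} (hn : β + γ = n) : negFracPow A β * negFracPow A γ = resolventOp A 0 ^ n := by
  by_cases hf : Int.fract β = 0
  · have h1 : (⌊β⌋₊ : ℝ) = β := by
      have := natFloor_add_fract hβ
      rwa [hf, add_zero] at this
    have h2 : γ = ((n - ⌊β⌋₊ : ℕ) : ℝ) := by
      have : ⌊β⌋₊ ≤ n := by
        have : (⌊β⌋₊ : ℝ) ≤ n := by rw [h1]; linarith
        exact_mod_cast this
      rw [Nat.cast_sub this, h1]
      linarith
    have h3 : ⌊β⌋₊ ≤ n := by
      have : (⌊β⌋₊ : ℝ) ≤ n := by rw [h1]; linarith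
      exact_mod_cast this
    rw [negFracPow_of_fract_eq_zero hf, h2, negFracPow_natCast, ← pow_add, Nat.add_sub_cancel' h3]
  · have hθ0 := fract_pos hf
    have hθ1 := Int.fract_lt_one β
    have hγf : Int.fract γ = 1 - Int.fract β := by
      rw [Int.fract_eq_iff]
      refine ⟨by linarith, by linarith, n - 1 - ⌊β⌋, ?_⟩
      have := Int.floor_add_fract β
      push_cast
      linarith
    have hsum : ⌊β⌋₊ + ⌊γ⌋₊ + 1 = n := by
      have h1 := natFloor_add_fract hβ
      have h2 := natFloor_add_fract hγ
      have : ((⌊β⌋₊ + ⌊γ⌋₊ + 1 : ℕ) : ℝ) = n := by push_cast; linarith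
      exact_mod_cast this
    have hγ0 : Int.fract γ ≠ 0 := by rw [hγf]; linarith
    rw [negFracPow_of_fract_ne_zero hf, negFracPow_of_fract_ne_zero hγ0, hγf]
    have hcomm : Commute (balakrishnan A (Int.fract β)) (resolventOp A 0 ^ ⌊γ⌋₊) :=
      (((commute_balakrishnan h hθ0 hθ1 fun t ht => h.isResolventAt_zero.commute
        (isResolventAt_resolventOp (h.mem_rho t ht)))).symm.pow_right _)
    rw [mul_assoc, ← mul_assoc (balakrishnan A _), hcomm.eq, mul_assoc, ← mul_assoc, ← pow_add]
    have hb := h.pseudoResolvent.balakrishnan_mul hθ0 hθ1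
    simp only [Complex.ofReal_zero] at hb
    rw [balakrishnan, balakrishnan, hb, ← pow_succ, hsum]

theorem injective_negFracPow (h : PositiveResolvent A c) {β γ : ℝ} (hβ : 0 ≤ β) (hγ : 0 ≤ γ)
    {n : ℕ} (hn : β + γ = n) : Function.Injective (negFracPow A β) := by
  have h1 := negFracPow_mul_negFracPow h hγ hβ (by rw [add_comm]; exact hn)
  have h2 : ∀ m : ℕ, Function.Injective (resolventOp A 0 ^ m) := by
    intro m
    induction m with
    | zero => exact fun x y hxy => hxy
    | succ m ih =>
      rw [pow_succ]
      exact ih.comp h.isResolventAt_zero.injective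
  have h3 := h2 n
  rw [← h1] at h3
  exact Function.Injective.of_comp (f := negFracPow A γ) h3

theorem IsCompOf.eq_comp {Y : Type*} [NormedAddCommGroup Y] [NormedSpace ℂ Y] {β : ℝ}
    (hinj : Function.Injective (negFracPow A β)) {B B' : Y →L[ℂ] X}
    (hB : IsCompOf (fracPow A β) B B') : B = negFracPow A β ∘L B' := by
  ext y
  obtain ⟨hy, h1⟩ := hB y
  set f : X →ₗ.[ℂ] X := (negFracPow A β : X →ₗ[ℂ] X).toPMap ⊤ with hf
  have hker : LinearMap.ker f.toFun = ⊥ := by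
    rw [LinearMap.ker_eq_bot]
    intro u v huv
    exact Subtype.ext (hinj huv)
  have hdom : B y ∈ LinearMap.range f.toFun := by
    rw [← LinearPMap.inverse_domain]; exact hy
  obtain ⟨x, hx⟩ := hdom
  have h2 := LinearPMap.inverse_apply_eq hker (y := ⟨B y, hy⟩) (x := x) hx
  have h3 : (x : X) = B' y := h2.symm.trans h1
  have h4 : negFracPow A β (x : X) = B y := hx
  rw [ContinuousLinearMap.comp_apply, ← h3, h4]

theorem norm_pow_mul_pow_le {G H : X →L[ℂ] X} {b : ℝ} (hb : 0 ≤ b) (hG : ‖G‖ ≤ b) (hH : ‖H‖ ≤ b)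
    (i j : ℕ) : ‖G ^ i * H ^ j‖ ≤ b ^ (i + j) := by
  rw [pow_add]
  refine (norm_mul_le _ _).trans (mul_le_mul ?_ ?_ (norm_nonneg _) (by positivity))
  · exact norm_clm_pow_le hG i
  · exact norm_clm_pow_le hH j

/-- The moment inequality for integer exponents, in additive form. -/
theorem exists_norm_pow_apply_le (h : PositiveResolvent A c) (k m : ℕ) :
    ∃ C : ℝ, 0 ≤ C ∧ ∀ τ : ℝ, 0 < τ → ∀ v : X, ‖(resolventOp A 0 ^ k) v‖
      ≤ C * ((τ⁻¹) ^ k * ‖v‖ + τ ^ m * ‖(resolventOp A 0 ^ (k + m)) v‖) := by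
  have hc := h.pseudoResolvent.nonneg
  refine ⟨2 ^ (k + m) * (1 + c) ^ (k + m), by positivity, fun τ hτ v => ?_⟩
  set K := resolventOp A 0 with hK
  set R := resolventOp A τ with hR
  set G : X →L[ℂ] X := τ • R with hG
  set H : X →L[ℂ] X := 1 - G with hH
  set b := 1 + c with hb
  have hb0 : 0 ≤ b := by positivity
  have hRn : τ * ‖R‖ ≤ c := h.mul_norm_le hτ.le
  have hGn' : ‖G‖ ≤ c := by rwa [hG, norm_smul, Real.norm_of_nonneg hτ.le]
  have hGn : ‖G‖ ≤ b := by linarith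
  have hHn : ‖H‖ ≤ b := by
    refine (norm_sub_le _ _).trans ?_
    have := ContinuousLinearMap.norm_id_le (𝕜 := ℂ) (E := X)
    exact add_le_add this hGn'
  have cKR : Commute K R := h.isResolventAt_zero.commute (isResolventAt_resolventOp (h.mem_rho τ hτ.le))
  have cKG : Commute K G := cKR.smul_right _
  have cKH : Commute K H := (Commute.one_right K).sub_right cKG
  have cGH : Commute G H := (Commute.one_right G).sub_right (Commute.refl G)
  have hKH : K * H = R := by
    have h1 := h.pseudoResolvent.sub_eq 0 τ le_rfl hτ.le
    simp only [Complex.ofReal_zero, sub_zero] at h1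
    rw [hH, mul_sub, mul_one, hG, mul_smul_comm, ← h1, sub_sub_cancel]
  -- With K = R(0), G = τR(τ) and H = 1 - G, the relation KH = R(τ) allows conversions in both
  -- directions. Expand K^k (G + H)^(k + m): terms with at least m factors G yield τ^m K^(k + m),
  -- and all others contain H^k, which turns K^k into R(τ)^k of size τ^(-k).
  have hGK : ∀ j : ℕ, G ^ j = τ ^ j • (K ^ j * H ^ j) := fun j => by
    rw [← cKH.mul_pow, hKH, hG, smul_pow]
  set n := k + m with hn
  set B := (τ⁻¹) ^ k * ‖v‖ + τ ^ m * ‖(K ^ n) v‖ with hB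
  have hterm : ∀ i ∈ Finset.range (n + 1), ‖(K ^ k * (G ^ i * H ^ (n - i))) v‖ ≤ b ^ n * B := by
    intro i hi
    have hin : i ≤ n := Nat.lt_succ_iff.1 (Finset.mem_range.1 hi)
    by_cases him : m ≤ i
    · obtain ⟨i', rfl⟩ := Nat.exists_eq_add_of_le him
      have e1 : K ^ k * (G ^ (m + i') * H ^ (n - (m + i')))
          = τ ^ m • ((G ^ i' * H ^ (m + (n - (m + i')))) * K ^ n) := by
        set j := n - (m + i')
        have c1 : Commute (K ^ m) (H ^ m * (G ^ i' * H ^ j)) :=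
          (cKH.pow_pow _ _).mul_right ((cKG.pow_pow _ _).mul_right (cKH.pow_pow _ _))
        have c2 : Commute (K ^ k) (H ^ m * (G ^ i' * H ^ j)) :=
          (cKH.pow_pow _ _).mul_right ((cKG.pow_pow _ _).mul_right (cKH.pow_pow _ _))
        have c3 : Commute (H ^ m) (G ^ i') := (cGH.pow_pow _ _).symm
        rw [pow_add G, hGK m, smul_mul_assoc, smul_mul_assoc, mul_smul_comm]
        congr 1
        rw [mul_assoc (K ^ m), mul_assoc (K ^ m), mul_assoc (H ^ m), c1.eq, ← mul_assoc, c2.eq,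
          mul_assoc, ← pow_add, ← mul_assoc (H ^ m), c3.eq, mul_assoc (G ^ i'), ← pow_add]
      rw [e1]
      change ‖τ ^ m • (G ^ i' * H ^ (m + (n - (m + i')))) ((K ^ n) v)‖ ≤ _
      rw [norm_smul, Real.norm_of_nonneg (by positivity)]
      have e2 := norm_pow_mul_pow_le hb0 hGn hHn i' (m + (n - (m + i')))
      rw [show i' + (m + (n - (m + i'))) = n by omega] at e2
      calc τ ^ m * ‖(G ^ i' * H ^ (m + (n - (m + i')))) ((K ^ n) v)‖
          ≤ τ ^ m * (b ^ n * ‖(K ^ n) v‖) := by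
            gcongr
            exact ContinuousLinearMap.le_of_opNorm_le _ e2 _
        _ = b ^ n * (τ ^ m * ‖(K ^ n) v‖) := by ring
        _ ≤ b ^ n * B := by
            gcongr
            exact le_add_of_nonneg_left (by positivity)
    · have e1 : K ^ k * (G ^ i * H ^ (n - i)) = (G ^ i * H ^ (n - i - k)) * R ^ k := by
        have c1 : Commute (K ^ k) (G ^ i * H ^ (n - i - k)) :=
          (cKG.pow_pow _ _).mul_right (cKH.pow_pow _ _)
        rw [show n - i = (n - i - k) + k by omega, pow_add, ← mul_assoc (G ^ i), ← mul_assoc,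
          Nat.add_sub_cancel, c1.eq, mul_assoc, ← cKH.mul_pow, hKH]
      rw [e1]
      change ‖(G ^ i * H ^ (n - i - k)) ((R ^ k) v)‖ ≤ _
      have e2 := norm_pow_mul_pow_le hb0 hGn hHn i (n - i - k)
      have e3 : ‖R ^ k‖ ≤ b ^ k * (τ⁻¹) ^ k := by
        rw [← mul_pow]
        refine norm_clm_pow_le ?_ k
        rw [← div_eq_mul_inv, le_div_iff₀ hτ, mul_comm]
        linarith
      calc ‖(G ^ i * H ^ (n - i - k)) ((R ^ k) v)‖
          ≤ b ^ (i + (n - i - k)) * (b ^ k * (τ⁻¹) ^ k * ‖v‖) :=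
            ContinuousLinearMap.le_of_opNorm_le_of_le _ e2
              (ContinuousLinearMap.le_of_opNorm_le _ e3 _)
        _ = b ^ n * ((τ⁻¹) ^ k * ‖v‖) := by
            rw [mul_assoc (b ^ k), ← mul_assoc, ← pow_add]
            congr 2
            omega
        _ ≤ b ^ n * B := by
            gcongr
            exact le_add_of_nonneg_right (by positivity)
  have hsum : K ^ k = ∑ i ∈ Finset.range (n + 1),
      (n.choose i : ℝ) • (K ^ k * (G ^ i * H ^ (n - i))) := by
    have h1 : G + H = 1 := by rw [hH]; abel
    have h2 := cGH.add_pow n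
    rw [h1, one_pow] at h2
    calc K ^ k = K ^ k * 1 := (mul_one _).symm
      _ = _ := by
        rw [h2, Finset.mul_sum]
        refine Finset.sum_congr rfl fun i _ => ?_
        rw [← Nat.cast_comm, ← nsmul_eq_mul, mul_smul_comm, Nat.cast_smul_eq_nsmul]
  calc ‖(K ^ k) v‖ = ‖∑ i ∈ Finset.range (n + 1),
        (n.choose i : ℝ) • (K ^ k * (G ^ i * H ^ (n - i))) v‖ := by
        conv_lhs => rw [hsum]
        rw [sum_apply]
        rfl
    _ ≤ ∑ i ∈ Finset.range (n + 1), (n.choose i : ℝ) * (b ^ n * B) := by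
        refine norm_sum_le_of_le _ fun i hi => ?_
        rw [norm_smul, Real.norm_of_nonneg (by positivity)]
        exact mul_le_mul_of_nonneg_left (hterm i hi) (by positivity)
    _ = 2 ^ n * b ^ n * B := by
        rw [← Finset.sum_mul]
        have h1 := Nat.sum_range_choose n
        have h2 : ∑ i ∈ Finset.range (n + 1), (n.choose i : ℝ) = 2 ^ n := by exact_mod_cast h1
        rw [h2, mul_assoc]

/-- Split the integral at τ. Below τ use R(t)y = R(0)y - tR(t)R(0)y, which is controlled by ‖R(0)y‖;
above τ use ‖R(t)‖ ≤ c/t. -/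
theorem norm_balakrishnan_apply_le (h : PositiveResolvent A c) {θ : ℝ} (h0 : 0 < θ) (h1 : θ < 1)
    {τ : ℝ} (hτ : 0 < τ) (y : X) : ‖balakrishnan A θ y‖ ≤ |Real.sin (Real.pi * θ) / Real.pi| *
      ((1 + c) * (τ ^ (1 - θ) / (1 - θ)) * ‖resolventOp A 0 y‖ + c * (τ ^ (-θ) / θ) * ‖y‖) := by
  have hc := h.pseudoResolvent.nonneg
  have hi := h.pseudoResolvent.integrableOn_rpow_smul h0 h1
  rw [balakrishnan, smul_apply, norm_smul, Real.norm_eq_abs]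
  gcongr
  have hiy : IntegrableOn (fun t : ℝ => t ^ (-θ) • resolventOp A t y) (Ioi 0) :=
    hi.apply_continuousLinearMap y
  have happ : (∫ t in Ioi (0 : ℝ), t ^ (-θ) • resolventOp A t) y
      = ∫ t in Ioi (0 : ℝ), t ^ (-θ) • resolventOp A t y :=
    ContinuousLinearMap.integral_apply hi y
  have hsplit := setIntegral_union (Ioc_disjoint_Ioi le_rfl) measurableSet_Ioi
    (hiy.mono_set (fun t ht => ht.1 : Ioc 0 τ ⊆ Ioi 0)) (hiy.mono_set (Ioi_subset_Ioi hτ.le))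
  rw [Ioc_union_Ioi_eq_Ioi hτ.le] at hsplit
  rw [happ, hsplit]
  refine (norm_add_le _ _).trans (add_le_add ?_ ?_)
  · have e1 : ∫ t in Ioc 0 τ, t ^ (-θ) = τ ^ (1 - θ) / (1 - θ) := by
      rw [← intervalIntegral.integral_of_le hτ.le, integral_rpow (Or.inl (by linarith)),
        Real.zero_rpow (by linarith), sub_zero, neg_add_eq_sub]
    have e2 : IntegrableOn (fun t : ℝ => t ^ (-θ)) (Ioc 0 τ) := by
      rw [← intervalIntegrable_iff_integrableOn_Ioc_of_le hτ.le]
      exact intervalIntegral.intervalIntegrable_rpow' (by linarith)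
    rw [← e1, mul_right_comm, mul_comm, ← integral_mul_const]
    refine norm_integral_le_of_norm_le (e2.mul_const _) ?_
    filter_upwards [ae_restrict_mem measurableSet_Ioc] with t ht
    have ht0 : 0 < t := ht.1
    rw [norm_smul, Real.norm_of_nonneg (by positivity)]
    gcongr
    have e3 := h.pseudoResolvent.sub_eq t 0 ht0.le le_rfl
    rw [Complex.ofReal_zero, zero_sub] at e3
    have e4 : resolventOp A t y = resolventOp A 0 y - t • resolventOp A t (resolventOp A 0 y) := by
      have := congrArg (fun T : X →L[ℂ] X => T y) e3
      simp only [sub_apply, smul_apply, mul_apply_eq_comp] at this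
      rw [sub_eq_iff_eq_add] at this
      rw [this]
      module
    rw [e4, add_mul, one_mul]
    refine (norm_sub_le _ _).trans (add_le_add le_rfl ?_)
    rw [norm_smul, Real.norm_of_nonneg ht0.le]
    calc t * ‖resolventOp A t (resolventOp A 0 y)‖ ≤ t * (‖resolventOp A t‖ * ‖resolventOp A 0 y‖) := by
          gcongr; exact ContinuousLinearMap.le_opNorm _ _
      _ = t * ‖resolventOp A t‖ * ‖resolventOp A 0 y‖ := by ring
      _ ≤ c * ‖resolventOp A 0 y‖ := by gcongr; exact h.mul_norm_le ht0.le
  · have e1 : ∫ t in Ioi τ, t ^ (-θ - 1) = τ ^ (-θ) / θ := by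
      rw [integral_Ioi_rpow_of_lt (by linarith) hτ, sub_add_cancel, neg_div_neg_eq]
    have e2 : IntegrableOn (fun t : ℝ => t ^ (-θ - 1)) (Ioi τ) :=
      integrableOn_Ioi_rpow_of_lt (by linarith) hτ
    rw [← e1, mul_right_comm, mul_comm, ← integral_mul_const]
    refine norm_integral_le_of_norm_le (e2.mul_const _) ?_
    filter_upwards [ae_restrict_mem measurableSet_Ioi] with t ht
    have ht0 : 0 < t := hτ.trans ht
    rw [norm_smul, Real.norm_of_nonneg (by positivity), Real.rpow_sub_one ht0.ne', div_mul_eq_mul_div,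
      mul_div_assoc]
    gcongr
    rw [le_div_iff₀ ht0, mul_comm]
    calc t * ‖resolventOp A t y‖ ≤ t * (‖resolventOp A t‖ * ‖y‖) := by
          gcongr; exact ContinuousLinearMap.le_opNorm _ _
      _ = t * ‖resolventOp A t‖ * ‖y‖ := by ring
      _ ≤ c * ‖y‖ := by gcongr; exact h.mul_norm_le ht0.le

/-- The moment inequality, in additive form. -/
theorem exists_norm_negFracPow_apply_le (h : PositiveResolvent A c) {β : ℝ} (hβ : 0 ≤ β) {n : ℕ}
    (hn : β ≤ n) : ∃ C : ℝ, 0 ≤ C ∧ ∀ τ : ℝ, 0 < τ → ∀ v : X, ‖negFracPow A β v‖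
      ≤ C * (τ ^ (-β) * ‖v‖ + τ ^ (n - β) * ‖(resolventOp A 0 ^ n) v‖) := by
  have hc := h.pseudoResolvent.nonneg
  have hfl := natFloor_add_fract hβ
  set k := ⌊β⌋₊ with hk
  have hkn : k ≤ n := by
    have : (k : ℝ) ≤ n := by linarith [Int.fract_nonneg β]
    exact_mod_cast this
  have hint : ∀ j : ℕ, j ≤ n → ∃ C : ℝ, 0 ≤ C ∧ ∀ τ : ℝ, 0 < τ → ∀ v : X,
      ‖(resolventOp A 0 ^ j) v‖
        ≤ C * (τ ^ (-(j : ℝ)) * ‖v‖ + τ ^ ((n : ℝ) - j) * ‖(resolventOp A 0 ^ n) v‖) := by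
    intro j hj
    obtain ⟨C, hC, hCb⟩ := exists_norm_pow_apply_le h j (n - j)
    refine ⟨C, hC, fun τ hτ v => ?_⟩
    have := hCb τ hτ v
    rw [Nat.add_sub_cancel' hj] at this
    rwa [Real.rpow_neg hτ.le, Real.rpow_natCast, ← inv_pow, ← Nat.cast_sub hj, Real.rpow_natCast]
  by_cases hf : Int.fract β = 0
  · have hβk : β = k := by linarith
    obtain ⟨C, hC, hCb⟩ := hint k hkn
    refine ⟨C, hC, fun τ hτ v => ?_⟩
    rw [negFracPow_of_fract_eq_zero hf, ← hk, hβk]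
    exact hCb τ hτ v
  · have hθ0 := fract_pos hf
    have hθ1 := Int.fract_lt_one β
    set θ := Int.fract β with hθ
    have hkn' : k + 1 ≤ n := by
      have : (k : ℝ) < n := by linarith
      exact_mod_cast this
    -- The fractional power interpolates between the integer powers k and k + 1; using the same τ
    -- everywhere makes the exponents add up.
    obtain ⟨C₁, hC₁, hb₁⟩ := hint k hkn
    obtain ⟨C₂, hC₂, hb₂⟩ := hint (k + 1) hkn'
    set S := |Real.sin (Real.pi * θ) / Real.pi|
    have hθ1' : 0 < 1 - θ := by linarith
    refine ⟨S * ((1 + c) / (1 - θ) * C₂ + c / θ * C₁), by positivity, fun τ hτ v => ?_⟩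
    have e0 : negFracPow A β v = balakrishnan A θ ((resolventOp A 0 ^ k) v) := by
      rw [negFracPow_of_fract_ne_zero hf]
      have hcomm : Commute (balakrishnan A θ) (resolventOp A 0 ^ k) :=
        (((commute_balakrishnan h hθ0 hθ1 fun t ht => h.isResolventAt_zero.commute
          (isResolventAt_resolventOp (h.mem_rho t ht)))).symm.pow_right _)
      rw [← hcomm.eq]
      rfl
    have e1 := norm_balakrishnan_apply_le h hθ0 hθ1 hτ ((resolventOp A 0 ^ k) v)
    have e2 : resolventOp A 0 ((resolventOp A 0 ^ k) v) = (resolventOp A 0 ^ (k + 1)) v := by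
      rw [pow_succ']; rfl
    set B := τ ^ (-β) * ‖v‖ + τ ^ (n - β) * ‖(resolventOp A 0 ^ n) v‖ with hB
    have e3 : τ ^ (1 - θ) * ‖(resolventOp A 0 ^ (k + 1)) v‖ ≤ C₂ * B := by
      refine (mul_le_mul_of_nonneg_left (hb₂ τ hτ v) (by positivity)).trans_eq ?_
      rw [hB, mul_left_comm, mul_add, ← mul_assoc (τ ^ (1 - θ)), ← mul_assoc (τ ^ (1 - θ)),
        ← Real.rpow_add hτ, ← Real.rpow_add hτ,
        show 1 - θ + -((k + 1 : ℕ) : ℝ) = -β by push_cast; linarith,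
        show 1 - θ + ((n : ℝ) - (k + 1 : ℕ)) = n - β by push_cast; linarith]
    have e4 : τ ^ (-θ) * ‖(resolventOp A 0 ^ k) v‖ ≤ C₁ * B := by
      refine (mul_le_mul_of_nonneg_left (hb₁ τ hτ v) (by positivity)).trans_eq ?_
      rw [hB, mul_left_comm, mul_add, ← mul_assoc (τ ^ (-θ)), ← mul_assoc (τ ^ (-θ)),
        ← Real.rpow_add hτ, ← Real.rpow_add hτ, show -θ + -(k : ℝ) = -β by linarith,
        show -θ + ((n : ℝ) - k) = n - β by linarith]
    rw [e0]
    refine e1.trans ?_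
    rw [e2, mul_assoc S]
    refine mul_le_mul_of_nonneg_left ?_ (abs_nonneg _)
    calc (1 + c) * (τ ^ (1 - θ) / (1 - θ)) * ‖(resolventOp A 0 ^ (k + 1)) v‖
          + c * (τ ^ (-θ) / θ) * ‖(resolventOp A 0 ^ k) v‖
        = (1 + c) / (1 - θ) * (τ ^ (1 - θ) * ‖(resolventOp A 0 ^ (k + 1)) v‖)
          + c / θ * (τ ^ (-θ) * ‖(resolventOp A 0 ^ k) v‖) := by ring
      _ ≤ (1 + c) / (1 - θ) * (C₂ * B) + c / θ * (C₁ * B) := by gcongr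
      _ = _ := by ring

end FractionalPowers

/-! ### Adjoints of fractional powers. -/

section Adjoint

open MeasureTheory

variable {X : Type*} [NormedAddCommGroup X] [InnerProductSpace ℂ X] [CompleteSpace X]
  {A : X →ₗ.[ℂ] X} {c : ℝ}

theorem PositiveResolvent.adjoint (h : PositiveResolvent A c) (hd : Dense (A.domain : Set X)) :
    PositiveResolvent A.adjoint c where
  mem_rho t ht := mem_rho_adjoint hd (by rw [Complex.conj_ofReal]; exact h.mem_rho t ht)
  norm_le t ht := by
    rw [resolventOp_adjoint_ofReal hd (h.mem_rho t ht), LinearIsometryEquiv.norm_map]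
    exact h.norm_le t ht

theorem negFracPow_adjoint (h : PositiveResolvent A c) (hd : Dense (A.domain : Set X)) (β : ℝ) :
    negFracPow A.adjoint β = ContinuousLinearMap.adjoint (negFracPow A β) := by
  rw [← ContinuousLinearMap.star_eq_adjoint]
  have hK : resolventOp A.adjoint 0 = star (resolventOp A 0) := by
    have := resolventOp_adjoint_ofReal hd (h.mem_rho 0 le_rfl)
    rwa [Complex.ofReal_zero] at this
  by_cases hf : Int.fract β = 0
  · rw [negFracPow_of_fract_eq_zero hf, negFracPow_of_fract_eq_zero hf, hK, star_pow]
  · have hθ0 := fract_pos hf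
    have hθ1 := Int.fract_lt_one β
    have hcomm : Commute (balakrishnan A (Int.fract β)) (resolventOp A 0 ^ ⌊β⌋₊) :=
      (((commute_balakrishnan h hθ0 hθ1 fun t ht => h.isResolventAt_zero.commute
        (isResolventAt_resolventOp (h.mem_rho t ht)))).symm.pow_right _)
    rw [negFracPow_of_fract_ne_zero hf, negFracPow_of_fract_ne_zero hf, hK, ← hcomm.eq, star_mul,
      star_pow]
    congr 1
    rw [balakrishnan, balakrishnan, star_smul, star_trivial]
    congr 1
    have h1 := ((starL' ℝ : (X →L[ℂ] X) ≃L[ℝ] (X →L[ℂ] X)) :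
      (X →L[ℂ] X) →L[ℝ] (X →L[ℂ] X)).integral_comp_comm
        (h.pseudoResolvent.integrableOn_rpow_smul hθ0 hθ1)
    refine Eq.trans ?_ h1
    refine setIntegral_congr_fun measurableSet_Ioi fun t ht => ?_
    change _ = star _
    rw [star_smul, star_trivial, resolventOp_adjoint_ofReal hd (h.mem_rho t (le_of_lt ht))]
    rfl

end Adjoint

/-! ### The constant M_C: boundedness of R(z, A) A^(-⌈α⌉). -/

section ResolventGrowth

variable {X : Type*} [NormedAddCommGroup X] [NormedSpace ℂ X] [CompleteSpace X]
  {A : X →ₗ.[ℂ] X}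

/-- Iterate R(z)R(0) = z⁻¹(R(0) - R(z)): each step divides by z and leaves one term of the sum. -/
theorem norm_resolventOp_mul_pow_le (h0 : (0 : ℂ) ∈ rho A) {z : ℂ} (hz : z ∈ rho A) (hz0 : z ≠ 0)
    (n : ℕ) : ‖resolventOp A z * resolventOp A 0 ^ n‖ ≤ ‖resolventOp A z‖ / ‖z‖ ^ n +
      ∑ k ∈ Finset.Icc 1 n, ‖resolventOp A 0‖ ^ k / ‖z‖ ^ (n + 1 - k) := by
  have hz' : 0 < ‖z‖ := norm_pos_iff.2 hz0
  have h1 : resolventOp A z * resolventOp A 0 = z⁻¹ • (resolventOp A 0 - resolventOp A z) := by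
    rw [(isResolventAt_resolventOp h0).sub_eq (isResolventAt_resolventOp hz), smul_smul, sub_zero,
      inv_mul_cancel₀ hz0, one_smul]
    exact ((isResolventAt_resolventOp hz).commute (isResolventAt_resolventOp h0)).eq
  induction n with
  | zero => simp
  | succ n ih =>
    have h2 : resolventOp A z * resolventOp A 0 ^ (n + 1)
        = z⁻¹ • (resolventOp A 0 ^ (n + 1) - resolventOp A z * resolventOp A 0 ^ n) := by
      rw [pow_succ', ← mul_assoc, h1, smul_mul_assoc, sub_mul]
    have h3 : ‖resolventOp A 0 ^ (n + 1)‖ ≤ ‖resolventOp A 0‖ ^ (n + 1) :=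
      norm_clm_pow_le le_rfl _
    rw [h2, norm_smul, norm_inv]
    calc ‖z‖⁻¹ * ‖resolventOp A 0 ^ (n + 1) - resolventOp A z * resolventOp A 0 ^ n‖
        ≤ ‖z‖⁻¹ * (‖resolventOp A 0‖ ^ (n + 1) + (‖resolventOp A z‖ / ‖z‖ ^ n +
            ∑ k ∈ Finset.Icc 1 n, ‖resolventOp A 0‖ ^ k / ‖z‖ ^ (n + 1 - k))) := by
          gcongr
          exact (norm_sub_le _ _).trans (add_le_add h3 ih)
      _ = ‖resolventOp A z‖ / ‖z‖ ^ (n + 1) +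
            (∑ k ∈ Finset.Icc 1 n, ‖resolventOp A 0‖ ^ k / ‖z‖ ^ (n + 1 + 1 - k) +
              ‖resolventOp A 0‖ ^ (n + 1) / ‖z‖ ^ (n + 1 + 1 - (n + 1))) := by
          have h4 : ∀ k ∈ Finset.Icc 1 n, ‖resolventOp A 0‖ ^ k / ‖z‖ ^ (n + 1 + 1 - k)
              = ‖z‖⁻¹ * (‖resolventOp A 0‖ ^ k / ‖z‖ ^ (n + 1 - k)) := by
            intro k hk
            have := (Finset.mem_Icc.1 hk).2
            rw [show n + 1 + 1 - k = (n + 1 - k) + 1 by omega, pow_succ]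
            field_simp
          rw [Finset.sum_congr rfl h4, ← Finset.mul_sum, show n + 1 + 1 - (n + 1) = 1 by omega,
            pow_one, pow_succ]
          field_simp
          ring
      _ = _ := by rw [Finset.sum_Icc_succ_top (by omega)]

theorem one_add_rpow_div_pow_le {α s₀ s : ℝ} (hs₀ : 0 < s₀) (hs : s₀ ≤ s) :
    (1 + s ^ α) / s ^ ⌈α⌉₊ ≤ (1 + s₀ ^ α) / s₀ ^ ⌈α⌉₊ := by
  have hs0 : 0 < s := hs₀.trans_le hs
  have hn : 0 ≤ (⌈α⌉₊ : ℝ) - α := sub_nonneg.2 (Nat.le_ceil α)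
  have hsplit : ∀ x : ℝ, 0 < x → x ^ ⌈α⌉₊ = x ^ α * x ^ ((⌈α⌉₊ : ℝ) - α) := fun x hx => by
    rw [← Real.rpow_add hx, add_sub_cancel, Real.rpow_natCast]
  rw [div_le_div_iff₀ (by positivity) (by positivity), add_mul, add_mul, one_mul, one_mul]
  refine add_le_add (by gcongr) ?_
  rw [hsplit s hs0, hsplit s₀ hs₀]
  calc s ^ α * (s₀ ^ α * s₀ ^ ((⌈α⌉₊ : ℝ) - α)) = s₀ ^ α * (s ^ α * s₀ ^ ((⌈α⌉₊ : ℝ) - α)) := by ring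
    _ ≤ s₀ ^ α * (s ^ α * s ^ ((⌈α⌉₊ : ℝ) - α)) := by gcongr

/-- The two entries of the maximum correspond to |Im z| ≤ s₀, where A^(-⌈α⌉) is estimated crudely,
and |Im z| ≥ s₀, where every term is largest at s₀ because ⌈α⌉ ≥ α. -/
theorem norm_resolventOp_mul_pow_le_constMC {MR M₀ α s₀ : ℝ} (hMR : 0 ≤ MR) (hM₀ : 0 ≤ M₀)
    (hα : 0 < α) (hs₀ : 0 < s₀) (h0 : (0 : ℂ) ∈ rho A) {z : ℂ} (hz : z ∈ rho A)
    (hR : ‖resolventOp A z‖ ≤ MR * M₀ * (1 + |z.im| ^ α)) :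
    ‖resolventOp A z * resolventOp A 0 ^ ⌈α⌉₊‖ ≤ constMC MR M₀ ‖invOp A‖ α s₀ := by
  have ha : ‖invOp A‖ = ‖resolventOp A 0‖ := by rw [invOp, norm_neg]
  rw [ha, constMC]
  rcases le_total |z.im| s₀ with h | h
  · refine le_trans ?_ (le_max_left _ _)
    calc ‖resolventOp A z * resolventOp A 0 ^ ⌈α⌉₊‖
        ≤ ‖resolventOp A z‖ * ‖resolventOp A 0‖ ^ ⌈α⌉₊ :=
          (norm_mul_le _ _).trans (by gcongr; exact norm_clm_pow_le le_rfl _)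
      _ ≤ (MR * M₀ * (1 + s₀ ^ α)) * ‖resolventOp A 0‖ ^ ⌈α⌉₊ := by
          gcongr
          refine hR.trans ?_
          gcongr
      _ = _ := by ring
  · refine le_trans ?_ (le_max_right _ _)
    have him : 0 < |z.im| := hs₀.trans_le h
    have hzn : |z.im| ≤ ‖z‖ := Complex.abs_im_le_norm z
    have hz0 : z ≠ 0 := norm_pos_iff.1 (him.trans_le hzn)
    refine (norm_resolventOp_mul_pow_le h0 hz hz0 _).trans (add_le_add ?_ ?_)
    · calc ‖resolventOp A z‖ / ‖z‖ ^ ⌈α⌉₊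
          ≤ MR * M₀ * (1 + |z.im| ^ α) / |z.im| ^ ⌈α⌉₊ := by gcongr
        _ = MR * M₀ * ((1 + |z.im| ^ α) / |z.im| ^ ⌈α⌉₊) := mul_div_assoc _ _ _
        _ ≤ MR * M₀ * ((1 + s₀ ^ α) / s₀ ^ ⌈α⌉₊) := by
            gcongr ?_ * ?_
            exact one_add_rpow_div_pow_le hs₀ h
        _ = _ := (mul_div_assoc _ _ _).symm
    · refine Finset.sum_le_sum fun k _ => ?_
      have := h.trans hzn
      gcongr

theorem constMC_pos {MR M₀ a α s₀ : ℝ} (hMR : 0 < MR) (hM₀ : 0 < M₀) (ha : 0 ≤ a) (hs₀ : 0 < s₀) :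
    0 < constMC MR M₀ a α s₀ := by
  refine lt_of_lt_of_le ?_ (le_max_right _ _)
  have h1 : 0 ≤ ∑ k ∈ Finset.Icc 1 ⌈α⌉₊, a ^ k / s₀ ^ (⌈α⌉₊ + 1 - k) :=
    Finset.sum_nonneg fun k _ => by positivity
  have h2 : 0 < MR * M₀ * (1 + s₀ ^ α) / s₀ ^ ⌈α⌉₊ := by positivity
  linarith

end ResolventGrowth

/-! ### Hilbert-Schmidt operators and countable families. -/

section HilbertSchmidt

variable {X Y : Type*} [NormedAddCommGroup X] [InnerProductSpace ℂ X]
  [NormedAddCommGroup Y] [InnerProductSpace ℂ Y]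

/-- The operator norm is bounded by the Hilbert--Schmidt norm. -/
theorem norm_apply_le_of_summable {ι : Type*} (b : HilbertBasis ι ℂ Y) (T : Y →L[ℂ] X)
    (hT : Summable fun i => ‖T (b i)‖ ^ 2) (u : Y) :
    ‖T u‖ ≤ Real.sqrt (∑' i, ‖T (b i)‖ ^ 2) * ‖u‖ := by
  have h1 : HasSum (fun i => T (b.repr u i • b i)) (T u) := (b.hasSum_repr u).mapL T
  refine le_of_tendsto h1.norm (Eventually.of_forall fun s => ?_)
  calc ‖∑ i ∈ s, T (b.repr u i • b i)‖ ≤ ∑ i ∈ s, ‖T (b i)‖ * ‖⟪b i, u⟫_ℂ‖ := by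
        refine norm_sum_le_of_le _ fun i _ => ?_
        rw [map_smul, norm_smul, b.repr_apply_apply, mul_comm]
    _ ≤ Real.sqrt (∑ i ∈ s, ‖T (b i)‖ ^ 2) * Real.sqrt (∑ i ∈ s, ‖⟪b i, u⟫_ℂ‖ ^ 2) :=
        Real.sum_mul_le_sqrt_mul_sqrt _ _ _
    _ ≤ Real.sqrt (∑' i, ‖T (b i)‖ ^ 2) * ‖u‖ := by
        gcongr
        · exact hT.sum_le_tsum s fun i _ => sq_nonneg _
        · rw [Real.sqrt_le_left (norm_nonneg u)]
          exact b.orthonormal.sum_inner_products_le u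

/-- Summability leaves only countably many basis vectors with nonzero image. Countability is needed
later to exchange the sum with an integral along vertical lines. -/
theorem IsHilbertSchmidt.exists_countable {K : Y →L[ℂ] X} (h : IsHilbertSchmidt K) :
    ∃ (ι : Set Y) (_ : Countable ι) (v : ι → X), Summable (fun i => ‖v i‖ ^ 2) ∧
      ∀ (T : X →L[ℂ] X) (u : Y), ‖T (K u)‖ ≤ Real.sqrt (∑' i, ‖T (v i)‖ ^ 2) * ‖u‖ := by
  obtain ⟨w, b, hb⟩ := h
  set f : w → ℝ := fun i => ‖K (b i)‖ ^ 2 with hf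
  have hsub : ∀ i : w, (i : Y) ∉ ((↑) '' Function.support f : Set Y) → K (b i) = 0 := by
    intro i hi
    by_contra hne
    exact hi ⟨i, by simpa [hf] using hne, rfl⟩
  refine ⟨(↑) '' Function.support f, (hb.countable_support.image _).to_subtype,
    fun i => K (b ⟨i, Subtype.coe_image_subset w _ i.2⟩), ?_, fun T u => ?_⟩
  · exact hb.comp_injective (i := fun i : ((↑) '' Function.support f : Set Y) =>
      (⟨i, Subtype.coe_image_subset w _ i.2⟩ : w)) fun i j hij => by
        simpa [Subtype.ext_iff] using hij
  · have h1 : Summable fun i => ‖(T ∘L K) (b i)‖ ^ 2 := by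
      refine (hb.mul_left (‖T‖ ^ 2)).of_nonneg_of_le (fun i => sq_nonneg _) fun i => ?_
      rw [← mul_pow]
      gcongr
      exact T.le_opNorm _
    refine (norm_apply_le_of_summable b (T ∘L K) h1 u).trans_eq ?_
    congr 2
    set g : ((↑) '' Function.support f : Set Y) → w := fun i =>
      ⟨i, Subtype.coe_image_subset w _ i.2⟩ with hg
    have hginj : Function.Injective g := fun i j hij => by
      simpa [hg, Subtype.ext_iff] using hij
    refine (hginj.tsum_eq (f := fun i => ‖(T ∘L K) (b i)‖ ^ 2) fun i hi => ?_).symm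
    by_contra hn
    have h2 : K (b i) = 0 := hsub i fun hmem => hn ⟨⟨i, hmem⟩, rfl⟩
    simp [h2] at hi

end HilbertSchmidt

/-! ### The resolvent of A + BC and its square integrability. -/

section Perturbation

open MeasureTheory

variable {X Y : Type*} [NormedAddCommGroup X] [InnerProductSpace ℂ X] [CompleteSpace X]
  [NormedAddCommGroup Y] [InnerProductSpace ℂ Y] [CompleteSpace Y] {A : X →ₗ.[ℂ] X}

/-- The resolvent of `A + BC`. -/
theorem IsResolventAt.addBounded_comp {z : ℂ} {R : X →L[ℂ] X} (h : IsResolventAt A z R)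
    {B : Y →L[ℂ] X} {C : X →L[ℂ] Y} {Q : Y →L[ℂ] Y} (h1 : (1 - C ∘L R ∘L B) * Q = 1)
    (h2 : Q * (1 - C ∘L R ∘L B) = 1) :
    IsResolventAt (PolyStab.addBounded A (B ∘L C)) z (R + R ∘L B ∘L Q ∘L C ∘L R) := by
  have e1 : ∀ y, Q y - C (R (B (Q y))) = y := fun y =>
    congrArg (fun S : Y →L[ℂ] Y => S y) h1
  have e2 : ∀ y, Q (y - C (R (B y))) = y := fun y =>
    congrArg (fun S : Y →L[ℂ] Y => S y) h2
  have h3 : (1 - (B ∘L C) * R) * (1 + B ∘L Q ∘L C ∘L R) = 1 := by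
    ext x
    change (x + B (Q (C (R x)))) - B (C (R (x + B (Q (C (R x)))))) = x
    rw [map_add, map_add, ← sub_eq_zero]
    have := congrArg B (e1 (C (R x)))
    rw [map_sub] at this
    rw [map_add]
    linear_combination (norm := module) this
  have h4 : (1 + B ∘L Q ∘L C ∘L R) * (1 - (B ∘L C) * R) = 1 := by
    ext x
    change (x - B (C (R x))) + B (Q (C (R (x - B (C (R x)))))) = x
    have := congrArg B (e2 (C (R x)))
    rw [map_sub R, map_sub C]
    linear_combination (norm := module) this
  have h5 : R + R ∘L B ∘L Q ∘L C ∘L R = R * (1 + B ∘L Q ∘L C ∘L R) := by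
    rw [mul_add, mul_one]
    rfl
  rw [h5]
  exact h.addBounded h3 h4

/-- The key estimate: by the moment inequality, the correction term in the resolvent of the
perturbed operator is controlled by the unperturbed resolvent. -/
theorem norm_correction_apply_le {R N₁ N₂ K : X →L[ℂ] X} {B' C' : Y →L[ℂ] X} {Q : Y →L[ℂ] Y}
    {β γ c₁ c₂ M b₀ d₀ : ℝ} (hn : 0 < β + γ) (hc₁ : 0 ≤ c₁) (hc₂ : 0 ≤ c₂) (hM : 0 ≤ M) (hb₀ : ‖B'‖ ≤ b₀)
    (hd₀ : ‖C'‖ ≤ d₀) (hQ : ‖Q‖ ≤ 2)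
    (hN₁ : ∀ τ : ℝ, 0 < τ → ∀ v, ‖N₁ v‖ ≤ c₁ * (τ ^ (-β) * ‖v‖ + τ ^ γ * ‖K v‖))
    (hN₂ : ∀ τ : ℝ, 0 < τ → ∀ v, ‖N₂ v‖ ≤ c₂ * (τ ^ (-γ) * ‖v‖ + τ ^ β * ‖K v‖))
    (hRN : Commute R N₁) (hKR : ‖K * R‖ ≤ M) {S : ℝ} (hS0 : 0 ≤ S) (hS : ∀ u, ‖R (B' u)‖ ≤ S * ‖u‖)
    (x : X) :
    ‖R (N₁ (B' (Q (ContinuousLinearMap.adjoint C' (N₂ (R x))))))‖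
      ≤ 2 * c₁ * c₂ * (1 + M * b₀) * d₀ * (1 + M) * (S * ‖x‖ + ‖R x‖) := by
  have hb0 : 0 ≤ b₀ := (norm_nonneg _).trans hb₀
  have hd0 : 0 ≤ d₀ := (norm_nonneg _).trans hd₀
  by_cases hRx : R x = 0
  · simp only [hRx, map_zero, norm_zero]
    positivity
  have hx : x ≠ 0 := fun h => hRx (by rw [h, map_zero])
  have hx0 : 0 < ‖x‖ := norm_pos_iff.2 hx
  have hRx0 : 0 < ‖R x‖ := norm_pos_iff.2 hRx
  -- One parameter serves both moment inequalities. With τ^(β + γ) = ρ the two factors are of order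
  -- τ^β‖x‖ and τ^γ, so their product is of order ρ‖x‖ = S‖x‖ + ‖Rx‖, linear in both quantities to
  -- be square-integrated.
  set ρ := S + ‖R x‖ / ‖x‖ with hρ
  have hρ0 : 0 < ρ := by positivity
  have hρx : ρ * ‖x‖ = S * ‖x‖ + ‖R x‖ := by
    rw [hρ, add_mul, div_mul_cancel₀ _ hx0.ne']
  set τ := ρ ^ (1 / (β + γ)) with hτ
  have hτ0 : 0 < τ := by positivity
  have hτρ : τ ^ (β + γ) = ρ := by
    rw [hτ, ← Real.rpow_mul hρ0.le, one_div_mul_cancel hn.ne', Real.rpow_one]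
  have hτβ : τ ^ (-β) * ρ = τ ^ γ := by
    rw [← hτρ, ← Real.rpow_add hτ0]; congr 1; ring
  have hτγ : τ ^ (-γ) * ρ = τ ^ β := by
    rw [← hτρ, ← Real.rpow_add hτ0]; congr 1; ring
  have hKR' : ∀ v, ‖K (R v)‖ ≤ M * ‖v‖ := fun v => ContinuousLinearMap.le_of_opNorm_le _ hKR v
  have h1 : ‖N₂ (R x)‖ ≤ c₂ * (1 + M) * τ ^ β * ‖x‖ := by
    refine (hN₂ τ hτ0 (R x)).trans ?_
    have e1 : ‖R x‖ ≤ ρ * ‖x‖ := by rw [hρx]; linarith [mul_nonneg hS0 hx0.le]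
    calc c₂ * (τ ^ (-γ) * ‖R x‖ + τ ^ β * ‖K (R x)‖)
        ≤ c₂ * (τ ^ (-γ) * (ρ * ‖x‖) + τ ^ β * (M * ‖x‖)) := by
          gcongr
          exact hKR' x
      _ = c₂ * (1 + M) * τ ^ β * ‖x‖ := by rw [← mul_assoc (τ ^ (-γ)), hτγ]; ring
  set u := Q (ContinuousLinearMap.adjoint C' (N₂ (R x))) with hu
  have h2 : ‖u‖ ≤ 2 * (d₀ * (c₂ * (1 + M) * τ ^ β * ‖x‖)) := by
    refine ContinuousLinearMap.le_of_opNorm_le_of_le _ hQ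
      (ContinuousLinearMap.le_of_opNorm_le_of_le _ ?_ h1)
    rwa [LinearIsometryEquiv.norm_map]
  have h3 : R (N₁ (B' u)) = N₁ (R (B' u)) := congrArg (fun T : X →L[ℂ] X => T (B' u)) hRN.eq
  have h4 : ‖N₁ (R (B' u))‖ ≤ c₁ * (1 + M * b₀) * τ ^ γ * ‖u‖ := by
    refine (hN₁ τ hτ0 _).trans ?_
    have e1 : ‖R (B' u)‖ ≤ ρ * ‖u‖ :=
      (hS u).trans (mul_le_mul_of_nonneg_right (by rw [hρ]; linarith [div_pos hRx0 hx0])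
        (norm_nonneg _))
    have e2 : ‖K (R (B' u))‖ ≤ M * (b₀ * ‖u‖) :=
      (hKR' _).trans (by gcongr; exact ContinuousLinearMap.le_of_opNorm_le _ hb₀ u)
    calc c₁ * (τ ^ (-β) * ‖R (B' u)‖ + τ ^ γ * ‖K (R (B' u))‖)
        ≤ c₁ * (τ ^ (-β) * (ρ * ‖u‖) + τ ^ γ * (M * (b₀ * ‖u‖))) := by gcongr
      _ = c₁ * (1 + M * b₀) * τ ^ γ * ‖u‖ := by rw [← mul_assoc (τ ^ (-β)), hτβ]; ring
  rw [h3, ← hρx, ← hτρ, Real.rpow_add hτ0]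
  calc ‖N₁ (R (B' u))‖ ≤ c₁ * (1 + M * b₀) * τ ^ γ * ‖u‖ := h4
    _ ≤ c₁ * (1 + M * b₀) * τ ^ γ * (2 * (d₀ * (c₂ * (1 + M) * τ ^ β * ‖x‖))) := by gcongr
    _ = _ := by ring

theorem continuous_resolventOp_line (hρ : ∀ z : ℂ, 0 < z.re → z ∈ rho A) {σ : ℝ} (hσ : 0 < σ)
    (x : X) : Continuous fun ξ : ℝ => resolventOp A (σ + 2 * Real.pi * ξ * Complex.I) x := by
  have h1 : Continuous fun ξ : ℝ => resolventOp A (σ + 2 * Real.pi * ξ * Complex.I) := by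
    rw [← continuousOn_univ]
    refine continuousOn_resolventOp.comp (by fun_prop) fun ξ _ => hρ _ ?_
    simpa using hσ
  exact h1.clm_apply continuous_const

/-- After squaring, the right-hand side is a countable sum of terms ‖R(z)vᵢ‖²‖x‖² plus ‖R(z)x‖². The
square bound for A applies to each term, and the resulting constants are summable. -/
theorem SquareBounded.of_norm_le {A₁ : X →ₗ.[ℂ] X} {c L : ℝ} (hA : SquareBounded A c) (hc : 0 ≤ c)
    (hρ : ∀ z : ℂ, 0 < z.re → z ∈ rho A₁) {ι : Type*} [Countable ι] {v : ι → X}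
    (hv : Summable fun i => ‖v i‖ ^ 2)
    (h : ∀ z : ℂ, 0 < z.re → ∀ x, ‖resolventOp A₁ z x‖
      ≤ L * (Real.sqrt (∑' i, ‖resolventOp A z (v i)‖ ^ 2) * ‖x‖ + ‖resolventOp A z x‖)) :
    SquareBounded A₁ (2 * L ^ 2 * (c * (∑' i, ‖v i‖ ^ 2) + c)) where
  mem_rho := hρ
  lintegral_le σ hσ x := by
    set Z : ℝ → ℂ := fun ξ => σ + 2 * Real.pi * ξ * Complex.I with hZ
    have hZre : ∀ ξ, 0 < (Z ξ).re := fun ξ => by simpa [hZ] using hσ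
    have hmeas : ∀ y, Measurable fun ξ => ‖resolventOp A (Z ξ) y‖ₑ ^ 2 := fun y =>
      (continuous_resolventOp_line hA.mem_rho hσ y).enorm.measurable.pow_const 2
    have hpt : ∀ ξ, ‖resolventOp A₁ (Z ξ) x‖ₑ ^ 2 ≤ ENNReal.ofReal (2 * L ^ 2) *
        (ENNReal.ofReal (‖x‖ ^ 2) * (∑' i, ‖resolventOp A (Z ξ) (v i)‖ₑ ^ 2)
          + ‖resolventOp A (Z ξ) x‖ₑ ^ 2) := by
      intro ξ
      have hs : Summable fun i => ‖resolventOp A (Z ξ) (v i)‖ ^ 2 := by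
        refine (hv.mul_left (‖resolventOp A (Z ξ)‖ ^ 2)).of_nonneg_of_le (fun i => sq_nonneg _)
          fun i => ?_
        rw [← mul_pow]
        gcongr
        exact ContinuousLinearMap.le_opNorm _ _
      have hen : ∀ y : X, ‖y‖ₑ ^ 2 = ENNReal.ofReal (‖y‖ ^ 2) := fun y => by
        rw [ENNReal.ofReal_pow (norm_nonneg _), ofReal_norm]
      simp only [hen]
      rw [← ENNReal.ofReal_tsum_of_nonneg (fun i => sq_nonneg _) hs,
        ← ENNReal.ofReal_mul (sq_nonneg _),
        ← ENNReal.ofReal_add (mul_nonneg (sq_nonneg _) (tsum_nonneg fun i => sq_nonneg _))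
          (sq_nonneg _), ← ENNReal.ofReal_mul (by positivity)]
      refine ENNReal.ofReal_le_ofReal ?_
      have h1 := pow_le_pow_left₀ (norm_nonneg _) (h (Z ξ) (hZre ξ) x) 2
      refine h1.trans ?_
      set S := ∑' i, ‖resolventOp A (Z ξ) (v i)‖ ^ 2
      have hS : 0 ≤ S := tsum_nonneg fun i => sq_nonneg _
      have h2 : (Real.sqrt S * ‖x‖) ^ 2 = ‖x‖ ^ 2 * S := by
        rw [mul_pow, Real.sq_sqrt hS, mul_comm]
      rw [mul_pow, ← h2, mul_comm 2, mul_assoc]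
      gcongr
      nlinarith [sq_nonneg (Real.sqrt S * ‖x‖ - ‖resolventOp A (Z ξ) x‖)]
    calc ∫⁻ ξ, ‖resolventOp A₁ (Z ξ) x‖ₑ ^ 2
        ≤ ∫⁻ ξ, ENNReal.ofReal (2 * L ^ 2) *
          (ENNReal.ofReal (‖x‖ ^ 2) * (∑' i, ‖resolventOp A (Z ξ) (v i)‖ₑ ^ 2)
          + ‖resolventOp A (Z ξ) x‖ₑ ^ 2) := lintegral_mono hpt
      _ = ENNReal.ofReal (2 * L ^ 2) * (ENNReal.ofReal (‖x‖ ^ 2) *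
          (∑' i, ∫⁻ ξ, ‖resolventOp A (Z ξ) (v i)‖ₑ ^ 2) + ∫⁻ ξ, ‖resolventOp A (Z ξ) x‖ₑ ^ 2) := by
          have hts : Measurable fun ξ => ∑' i, ‖resolventOp A (Z ξ) (v i)‖ₑ ^ 2 :=
            Measurable.tsum fun i => hmeas (v i)
          rw [lintegral_const_mul' _ _ ENNReal.ofReal_ne_top,
            lintegral_add_left (hts.const_mul _), lintegral_const_mul _ hts,
            lintegral_tsum fun i => (hmeas (v i)).aemeasurable]
      _ ≤ ENNReal.ofReal (2 * L ^ 2) * (ENNReal.ofReal (‖x‖ ^ 2) *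
          (∑' i, ENNReal.ofReal (c / σ * ‖v i‖ ^ 2)) + ENNReal.ofReal (c / σ * ‖x‖ ^ 2)) := by
          gcongr
          · exact hA.lintegral_le σ hσ _
          · exact hA.lintegral_le σ hσ _
      _ = ENNReal.ofReal (2 * L ^ 2 * (c * (∑' i, ‖v i‖ ^ 2) + c) / σ * ‖x‖ ^ 2) := by
          have hts : 0 ≤ ∑' i, ‖v i‖ ^ 2 := tsum_nonneg fun i => sq_nonneg _
          rw [← ENNReal.ofReal_tsum_of_nonneg (fun i => by positivity) (hv.mul_left _), tsum_mul_left,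
            ← ENNReal.ofReal_mul (by positivity), ← ENNReal.ofReal_add (by positivity) (by positivity),
            ← ENNReal.ofReal_mul (by positivity)]
          congr 1
          ring

end Perturbation

/-! ### Stability of the perturbed semigroup. -/

section PerturbedSemigroup

variable {X Y : Type*} [NormedAddCommGroup X] [InnerProductSpace ℂ X] [CompleteSpace X]
  [NormedAddCommGroup Y] [InnerProductSpace ℂ Y] [CompleteSpace Y] {A : X →ₗ.[ℂ] X}

theorem SquareBounded.mono {C C' : ℝ} (h : SquareBounded A C) (hC : C ≤ C') : SquareBounded A C' where
  mem_rho := h.mem_rho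
  lintegral_le σ hσ x := (h.lintegral_le σ hσ x).trans (ENNReal.ofReal_le_ofReal (by gcongr))

theorem MDissipative.mono {ω ω' : ℝ} (h : MDissipative A ω) (hω : ω ≤ ω') : MDissipative A ω' where
  dense := h.dense
  re_inner_le x := (h.re_inner_le x).trans (by gcongr)
  mem_rho z hz := h.mem_rho z (by linarith)

theorem MDissipative.exists_positiveResolvent (h : MDissipative A 0) (h0 : (0 : ℂ) ∈ rho A) :
    ∃ c, PositiveResolvent A c :=
  PolyStab.exists_positiveResolvent h0 (fun t ht => h.mem_rho t (by simpa using ht)) fun t ht => by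
    simpa using h.norm_resolventOp_le (z := (t : ℂ)) (by simpa using ht)

/-- Polynomial stability is preserved under perturbations `BC` for which `(-A)^β B` and
`(-A*)^γ C*` are small Hilbert--Schmidt operators. -/
theorem MDissipative.exists_polynomiallyStable_addBounded (hA : MDissipative A 0) {α N M β γ : ℝ}
    {n : ℕ} (hα : 0 < α) (hN : 0 < N) (hρ : ∀ z : ℂ, 0 ≤ z.re → z ∈ rho A)
    (hR : ∀ z : ℂ, 0 ≤ z.re → ‖resolventOp A z‖ ≤ N * (1 + |z.im| ^ α))
    (hM : ∀ z : ℂ, 0 ≤ z.re → ‖resolventOp A z * resolventOp A 0 ^ n‖ ≤ M)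
    (hn : 0 < n) (hβ : 0 ≤ β) (hγ : 0 ≤ γ) (hβγ : β + γ = n)
    {B : Y →L[ℂ] X} {C : X →L[ℂ] Y} {B' C' : Y →L[ℂ] X} (hB : B = negFracPow A β ∘L B')
    (hC : C = ContinuousLinearMap.adjoint C' ∘L negFracPow A γ)
    (hB' : IsHilbertSchmidt B') (hC' : IsHilbertSchmidt C') (hsmall : ‖C'‖ * (M * ‖B'‖) ≤ 1 / 2) :
    ∃ T : ℝ → X →L[ℂ] X, IsC0Semigroup T ∧ IsGenerator (PolyStab.addBounded A (B ∘L C)) T ∧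
      IsPolynomiallyStable (PolyStab.addBounded A (B ∘L C)) T α := by
  have h0 : (0 : ℂ) ∈ rho A := hρ 0 (by simp)
  have hM0 : 0 ≤ M := (norm_nonneg _).trans (hM 0 (by simp))
  obtain ⟨c, hP⟩ := hA.exists_positiveResolvent h0
  have hP' := hP.adjoint hA.dense
  set A₁ := PolyStab.addBounded A (B ∘L C) with hA₁
  set K := resolventOp A 0 with hK
  have hK' : resolventOp A.adjoint 0 = ContinuousLinearMap.adjoint K := by
    simpa using resolventOp_adjoint hA.dense h0
  have hnβ : (n : ℝ) - β = γ := by linarith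
  have hnγ : (n : ℝ) - γ = β := by linarith
  have hnpos : 0 < β + γ := by rw [hβγ]; exact_mod_cast hn
  obtain ⟨c₁, hc₁, hm₁⟩ := exists_norm_negFracPow_apply_le hP hβ (n := n) (by linarith)
  obtain ⟨c₂, hc₂, hm₂⟩ := exists_norm_negFracPow_apply_le hP hγ (n := n) (by linarith)
  obtain ⟨c₃, hc₃, hm₃⟩ := exists_norm_negFracPow_apply_le hP' hγ (n := n) (by linarith)
  obtain ⟨c₄, hc₄, hm₄⟩ := exists_norm_negFracPow_apply_le hP' hβ (n := n) (by linarith)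
  rw [hnβ] at hm₁ hm₄
  rw [hnγ] at hm₂ hm₃
  have hcomm : ∀ z : ℂ, 0 ≤ z.re → ∀ s : ℝ, Commute (resolventOp A z) (negFracPow A s) :=
    fun z hz s => commute_resolventOp_negFracPow hP (hρ z hz) s
  have hcommK : ∀ z : ℂ, 0 ≤ z.re → Commute (resolventOp A z) (K ^ n) := fun z hz =>
    ((isResolventAt_resolventOp (hρ z hz)).commute hP.isResolventAt_zero).pow_right n
  -- The fractional powers commute with the resolvent and combine to the integer power n, so only
  -- ‖R(z)R(0)^n‖ ≤ M is needed.
  have hCRB : ∀ z : ℂ, 0 ≤ z.re → ‖C ∘L resolventOp A z ∘L B‖ ≤ 1 / 2 := by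
    intro z hz
    have e1 : C ∘L resolventOp A z ∘L B
        = ContinuousLinearMap.adjoint C' ∘L (resolventOp A z * K ^ n) ∘L B' := by
      have e2 : negFracPow A γ * (resolventOp A z * negFracPow A β) = resolventOp A z * K ^ n := by
        rw [← mul_assoc, ← (hcomm z hz γ).eq, mul_assoc,
          negFracPow_mul_negFracPow hP hγ hβ (by rw [add_comm]; exact hβγ)]
      rw [← e2, hB, hC]
      rfl
    rw [e1]
    refine le_trans ?_ hsmall
    refine (ContinuousLinearMap.opNorm_comp_le _ _).trans ?_
    rw [LinearIsometryEquiv.norm_map]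
    gcongr
    exact (ContinuousLinearMap.opNorm_comp_le _ _).trans (by gcongr; exact hM z hz)
  have hres : ∀ z : ℂ, 0 ≤ z.re → ∃ Q : Y →L[ℂ] Y, ‖Q‖ ≤ 2 ∧
      IsResolventAt A₁ z (resolventOp A z + resolventOp A z ∘L B ∘L Q ∘L C ∘L resolventOp A z) := by
    intro z hz
    obtain ⟨Q, h1, h2, h3⟩ := exists_inverse_one_sub (C ∘L resolventOp A z ∘L B)
      ((hCRB z hz).trans_lt (by norm_num))
    refine ⟨Q, h3.trans ?_, (isResolventAt_resolventOp (hρ z hz)).addBounded_comp h1 h2⟩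
    rw [inv_le_comm₀ (by linarith [hCRB z hz]) (by norm_num)]
    linarith [hCRB z hz]
  have hρ₁ : ∀ z : ℂ, 0 ≤ z.re → z ∈ rho A₁ := fun z hz => (hres z hz).choose_spec.2.mem_rho
  have hd₁ : Dense (A₁.domain : Set X) := hA.dense
  set L := 2 * c₁ * c₂ * (1 + M * ‖B'‖) * ‖C'‖ * (1 + M) + 1 with hL
  have hL1 : 1 ≤ L := le_add_of_nonneg_left (by positivity)
  have hkey : ∀ z : ℂ, 0 ≤ z.re → ∀ S : ℝ, 0 ≤ S → (∀ u, ‖resolventOp A z (B' u)‖ ≤ S * ‖u‖) →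
      ∀ x, ‖resolventOp A₁ z x‖ ≤ L * (S * ‖x‖ + ‖resolventOp A z x‖) := by
    intro z hz S hS0 hS x
    obtain ⟨Q, hQ, hQr⟩ := hres z hz
    have e1 := norm_correction_apply_le (B' := B') (C' := C') hnpos hc₁ hc₂ hM0 le_rfl le_rfl hQ hm₁ hm₂ (hcomm z hz β)
      (by rw [← (hcommK z hz).eq]; exact hM z hz) hS0 hS x
    rw [hQr.resolventOp_eq]
    have e2 : (resolventOp A z ∘L B ∘L Q ∘L C ∘L resolventOp A z) x = resolventOp A z (negFracPow A β
        (B' (Q (ContinuousLinearMap.adjoint C' (negFracPow A γ (resolventOp A z x)))))) := by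
      rw [hB, hC]; rfl
    rw [add_apply, e2]
    refine (norm_add_le _ _).trans ((add_le_add le_rfl e1).trans ?_)
    rw [hL]
    nlinarith [mul_nonneg hS0 (norm_nonneg x)]
  -- The adjoint of the correction has the same shape with (B', β) and (C', γ) interchanged, so the
  -- same lemma covers it; this is where the Hilbert-Schmidt property of C' is used.
  set L' := 2 * c₃ * c₄ * (1 + M * ‖C'‖) * ‖B'‖ * (1 + M) + 1 with hL'
  have hkey' : ∀ z : ℂ, 0 ≤ z.re → ∀ S : ℝ, 0 ≤ S →
      (∀ u, ‖resolventOp A.adjoint z (C' u)‖ ≤ S * ‖u‖) →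
      ∀ x, ‖resolventOp A₁.adjoint z x‖ ≤ L' * (S * ‖x‖ + ‖resolventOp A.adjoint z x‖) := by
    intro z hz S hS0 hS x
    set w := starRingEnd ℂ z with hw
    have hwz : starRingEnd ℂ w = z := Complex.conj_conj z
    have hwre : 0 ≤ w.re := by simpa [hw] using hz
    obtain ⟨Q, hQ, hQr⟩ := hres w hwre
    have hRz : resolventOp A.adjoint z = ContinuousLinearMap.adjoint (resolventOp A w) := by
      rw [← hwz]; exact resolventOp_adjoint hA.dense (hρ w hwre)
    have hRz₁ : resolventOp A₁.adjoint z = ContinuousLinearMap.adjoint (resolventOp A₁ w) := by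
      rw [← hwz]; exact resolventOp_adjoint hd₁ (hρ₁ w hwre)
    have e0 : Commute (resolventOp A.adjoint z) (negFracPow A.adjoint γ) := by
      rw [hRz, negFracPow_adjoint hP hA.dense, ← ContinuousLinearMap.star_eq_adjoint,
        ← ContinuousLinearMap.star_eq_adjoint]
      exact (hcomm w hwre γ).star_star
    have e3 : ‖resolventOp A.adjoint 0 ^ n * resolventOp A.adjoint z‖ ≤ M := by
      rw [hRz, hK', ← ContinuousLinearMap.star_eq_adjoint, ← ContinuousLinearMap.star_eq_adjoint,
        ← star_pow, ← star_mul, norm_star]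
      exact hM w hwre
    have e1 := norm_correction_apply_le (Q := ContinuousLinearMap.adjoint Q) (B' := C') (C' := B')
      (by rw [add_comm]; exact hnpos) hc₃ hc₄ hM0 le_rfl le_rfl
      (by rwa [LinearIsometryEquiv.norm_map]) hm₃ hm₄ e0 e3 hS0 hS x
    have e2 : ContinuousLinearMap.adjoint (resolventOp A w ∘L B ∘L Q ∘L C ∘L resolventOp A w) x
        = resolventOp A.adjoint z (negFracPow A.adjoint γ (C' (ContinuousLinearMap.adjoint Q
          (ContinuousLinearMap.adjoint B' (negFracPow A.adjoint β (resolventOp A.adjoint z x)))))) := by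
      rw [hRz, negFracPow_adjoint hP hA.dense, negFracPow_adjoint hP hA.dense, hB, hC]
      simp only [ContinuousLinearMap.adjoint_comp, ContinuousLinearMap.adjoint_adjoint]
      rfl
    rw [hRz₁, hQr.resolventOp_eq, map_add, ← hRz, add_apply, e2]
    refine (norm_add_le _ _).trans ((add_le_add le_rfl e1).trans ?_)
    rw [hL']
    nlinarith [mul_nonneg hS0 (norm_nonneg x)]
  obtain ⟨S₀, S₀', hS₀⟩ := hA.exists_adjointPair
  have hsq := hS₀.left.squareBounded fun z hz => hρ z hz.le
  have hsq' := hS₀.right.squareBounded fun z hz => hA.mem_rho_adjoint hz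
  obtain ⟨ι, hι, v, hv, hvb⟩ := hB'.exists_countable
  obtain ⟨ι', hι', v', hv', hvb'⟩ := hC'.exists_countable
  have hsq₁ := hsq.of_norm_le zero_le_one (fun z hz => hρ₁ z hz.le) hv (L := L) fun z hz x =>
    hkey z hz.le _ (Real.sqrt_nonneg _) (hvb _) x
  have hsq₁' := hsq'.of_norm_le zero_le_one
    (fun z hz => PolyStab.mem_rho_adjoint hd₁ (hρ₁ _ (by simpa using hz.le))) hv' (L := L') fun z hz x =>
    hkey' z hz.le _ (Real.sqrt_nonneg _) (hvb' _) x
  -- Bounded perturbation theory gives only the growth rate ‖BC‖; one is added to make the rate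
  -- positive, and the square bounds then remove it.
  obtain ⟨T, T', hT⟩ := ((hA.addBounded (B ∘L C)).mono
    (show 0 + ‖B ∘L C‖ ≤ ‖B ∘L C‖ + 1 by linarith)).exists_adjointPair
  have hω : 0 < ‖B ∘L C‖ + 1 := by positivity
  set E₁ := 2 * L ^ 2 * (1 * (∑' i, ‖v i‖ ^ 2) + 1)
  set E₂ := 2 * L' ^ 2 * (1 * (∑' i, ‖v' i‖ ^ 2) + 1)
  have hE : 1 ≤ max 1 (max E₁ E₂) := le_max_left _ _
  have hb₁ := hsq₁.mono ((le_max_left E₁ E₂).trans (le_max_right 1 _))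
  have hb₁' := hsq₁'.mono ((le_max_right E₁ E₂).trans (le_max_right 1 _))
  -- With the operator norm in place of the square-integrable majorant S, the key estimate shows
  -- that the perturbation does not worsen the growth exponent of the resolvent.
  have hR₁ : ∀ z : ℂ, 0 ≤ z.re → ‖resolventOp A₁ z‖ ≤ L * (‖B'‖ + 1) * N * (1 + |z.im| ^ α) := by
    intro z hz
    have hr := hR z hz
    have hnn : 0 ≤ N * (1 + |z.im| ^ α) := (norm_nonneg _).trans hr
    refine ContinuousLinearMap.opNorm_le_bound _ (by positivity) fun x => ?_
    have e1 := hkey z hz (‖resolventOp A z‖ * ‖B'‖) (by positivity) (fun u => by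
      rw [mul_assoc]
      exact ContinuousLinearMap.le_opNorm_of_le _ (B'.le_opNorm u)) x
    calc ‖resolventOp A₁ z x‖
        ≤ L * (‖resolventOp A z‖ * ‖B'‖ * ‖x‖ + ‖resolventOp A z x‖) := e1
      _ ≤ L * (‖resolventOp A z‖ * ‖B'‖ * ‖x‖ + ‖resolventOp A z‖ * ‖x‖) := by
          gcongr
          exact ContinuousLinearMap.le_opNorm _ _
      _ = L * (‖B'‖ + 1) * ‖resolventOp A z‖ * ‖x‖ := by ring
      _ ≤ L * (‖B'‖ + 1) * (N * (1 + |z.im| ^ α)) * ‖x‖ := by gcongr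
      _ = _ := by ring
  refine ⟨T, hT.left.isC0Semigroup, hT.left.isGenerator (hρ₁ 0 (by simp)), ?_, fun s =>
    hρ₁ _ (by simp), ?_⟩
  · obtain ⟨k, -, hk⟩ := hT.exists_norm_le hω hE hb₁ hb₁'
    exact ⟨k, hk⟩
  · obtain ⟨M', hM'0, hM'⟩ := hT.polynomial_decay hω hE hb₁ hb₁' hα (N := L * (‖B'‖ + 1) * N)
      (by positivity) hρ₁ hR₁
    refine ⟨M', hM'0, fun t ht => ?_⟩
    rw [invOp, ContinuousLinearMap.comp_neg, norm_neg]
    exact hM' t ht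

end PerturbedSemigroup

end PolyStab

end

theorem theorem2p2
    {X : Type*} [NormedAddCommGroup X] [InnerProductSpace ℂ X] [CompleteSpace X]
    {U : Type*} [NormedAddCommGroup U] [InnerProductSpace ℂ U] [CompleteSpace U]
    {Y : Type*} [NormedAddCommGroup Y] [InnerProductSpace ℂ Y] [CompleteSpace Y]
    (A₀ : X →ₗ.[ℂ] X) (hA₀ : PolyStab.IsSkewAdjoint A₀) (D : U →L[ℂ] X)
    (A : X →ₗ.[ℂ] X) (hA : A = PolyStab.damped A₀ D)
    (η₀ δ₀ : ℝ) (hη₀ : 0 < η₀) (hδ₀ : 0 < δ₀)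
    (η δ : ℝ → ℝ) (hη : ∀ s, η s ∈ Ioc 0 η₀) (hδ : ∀ s, δ s ∈ Ioc 0 δ₀)
    (hD : ∀ s : ℝ, ∀ x ∈ range (PolyStab.spectralProj A₀ (s - δ s) (s + δ s)),
      η s * ‖x‖ ≤ ‖ContinuousLinearMap.adjoint D x‖) :
    (∀ s : ℝ, Complex.I * (s : ℂ) ∈ PolyStab.rho A ∧
      ‖PolyStab.resolventOp A (Complex.I * (s : ℂ))‖ ≤
        PolyStab.constMR η₀ δ₀ ‖D‖ / (η s ^ 2 * δ s ^ 2)) ∧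
    ∀ α M₀ : ℝ, 0 < α → 0 < M₀ →
      (∀ s : ℝ, (η s ^ 2)⁻¹ * (δ s ^ 2)⁻¹ ≤ M₀ * (1 + |s| ^ α)) →
      ∀ β γ : ℝ, 0 ≤ β → 0 ≤ γ → β + γ = (⌈α⌉₊ : ℝ) →
      ∀ s₀ κ : ℝ, 0 < s₀ → 0 < κ →
      κ < 1 / Real.sqrt (2 * PolyStab.constMC (PolyStab.constMR η₀ δ₀ ‖D‖) M₀
        ‖PolyStab.invOp A‖ α s₀) →
        -- `ℂ₊ ⊆ ρ(A)`, and `κ < 1 / (sup_{z ∈ ℂ₊} ‖R(z, A) (-A)^(-β-γ)‖) ^ (1/2)`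
        (∀ z : ℂ, 0 < z.re → z ∈ PolyStab.rho A) ∧
        ENNReal.ofReal κ <
          ((⨆ z : ℂ, ⨆ _ : 0 < z.re,
            ‖PolyStab.resolventOp A z ∘L PolyStab.negFracPow A (β + γ)‖ₑ) ^ (1 / 2 : ℝ))⁻¹ ∧
        -- polynomial stability is preserved under perturbations of size less than `κ`,
        -- where `B' = (-A)^β B` and `C' = (-A*)^γ C*`
        ∀ (B : Y →L[ℂ] X) (C : X →L[ℂ] Y) (B' C' : Y →L[ℂ] X),
          PolyStab.IsCompOf (PolyStab.fracPow A β) B B' →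
          PolyStab.IsCompOf (PolyStab.fracPow A.adjoint γ) (ContinuousLinearMap.adjoint C) C' →
          PolyStab.IsHilbertSchmidt B' → PolyStab.IsHilbertSchmidt C' →
          ‖B'‖ < κ → ‖C'‖ < κ →
          ∃ T : ℝ → X →L[ℂ] X, PolyStab.IsC0Semigroup T ∧
            PolyStab.IsGenerator (PolyStab.addBounded A (B ∘L C)) T ∧
            PolyStab.IsPolynomiallyStable (PolyStab.addBounded A (B ∘L C)) T α := by
  open PolyStab in
  subst hA
  have hres := fun z hz => hA₀.damped_resolvent hη hδ hD (z := z) hz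
  refine ⟨fun s => ?_, ?_⟩
  · have h := hres (Complex.I * s) (by simp)
    simpa using h
  intro α M₀ hα hM₀ hgrowth β γ hβ hγ hβγ s₀ κ hs₀ hκ hκlt
  have hMR : 0 < constMR η₀ δ₀ ‖D‖ := constMR_pos hη₀ hδ₀
  set A := damped A₀ D with hA
  set MR := constMR η₀ δ₀ ‖D‖ with hMRdef
  set M := constMC MR M₀ ‖invOp A‖ α s₀ with hMdef
  have hM0 : 0 < M := constMC_pos hMR hM₀ (norm_nonneg _) hs₀
  have hdiss : MDissipative A 0 := hA₀.mDissipative_damped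
  have hρ : ∀ z : ℂ, 0 ≤ z.re → z ∈ rho A := fun z hz => (hres z hz).1
  have h0 : (0 : ℂ) ∈ rho A := hρ 0 (by simp)
  have hR : ∀ z : ℂ, 0 ≤ z.re → ‖resolventOp A z‖ ≤ MR * M₀ * (1 + |z.im| ^ α) := by
    intro z hz
    refine (hres z hz).2.trans ?_
    rw [div_eq_mul_inv, mul_inv, mul_assoc]
    exact mul_le_mul_of_nonneg_left (hgrowth z.im) hMR.le
  have hM : ∀ z : ℂ, 0 ≤ z.re → ‖resolventOp A z * resolventOp A 0 ^ ⌈α⌉₊‖ ≤ M := fun z hz =>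
    norm_resolventOp_mul_pow_le_constMC hMR.le hM₀.le hα hs₀ h0 (hρ z hz) (hR z hz)
  have hκM : κ ^ 2 * (2 * M) < 1 := by
    have h1 : 0 < Real.sqrt (2 * M) := Real.sqrt_pos.2 (by positivity)
    rw [lt_div_iff₀ h1] at hκlt
    have h2 : (κ * Real.sqrt (2 * M)) ^ 2 < 1 := by
      rw [sq_lt_one_iff₀ (by positivity)]; exact hκlt
    rwa [mul_pow, Real.sq_sqrt (by positivity)] at h2
  refine ⟨fun z hz => hρ z hz.le, ?_, ?_⟩
  · have hsup : (⨆ z : ℂ, ⨆ _ : 0 < z.re, ‖resolventOp A z ∘L negFracPow A (β + γ)‖ₑ)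
        ≤ ENNReal.ofReal M := by
      refine iSup₂_le fun z hz => ?_
      -- Since β + γ = ⌈α⌉, the power in the supremum is an integer power of R(0).
      rw [hβγ, negFracPow_natCast, ← ofReal_norm]
      exact ENNReal.ofReal_le_ofReal (hM z hz.le)
    have h1 : (⨆ z : ℂ, ⨆ _ : 0 < z.re, ‖resolventOp A z ∘L negFracPow A (β + γ)‖ₑ) ^ (1 / 2 : ℝ)
        ≤ ENNReal.ofReal (Real.sqrt M) := by
      rw [Real.sqrt_eq_rpow, ← ENNReal.ofReal_rpow_of_nonneg hM0.le (by norm_num)]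
      exact ENNReal.rpow_le_rpow hsup (by norm_num)
    refine lt_of_lt_of_le ?_ (ENNReal.inv_le_inv.2 h1)
    have hs : 0 < Real.sqrt M := Real.sqrt_pos.2 hM0
    rw [← ENNReal.ofReal_inv_of_pos hs, ENNReal.ofReal_lt_ofReal_iff (by positivity)]
    -- The factor 2 in √(2M_C) gives the strict inequality here, and below it gives the bound 1/2
    -- for the Neumann series.
    refine hκlt.trans ?_
    rw [one_div]
    exact inv_strictAnti₀ hs (Real.sqrt_lt_sqrt hM0.le (by linarith))
  · intro B C B' C' hB hC hB' hC' hBκ hCκ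
    obtain ⟨c, hP⟩ := hdiss.exists_positiveResolvent h0
    have hBeq : B = negFracPow A β ∘L B' := hB.eq_comp (injective_negFracPow hP hβ hγ hβγ)
    have hCeq : C = ContinuousLinearMap.adjoint C' ∘L negFracPow A γ := by
      have h1 := hC.eq_comp (injective_negFracPow (hP.adjoint hdiss.dense) hγ hβ
        (by rw [add_comm]; exact hβγ))
      rw [negFracPow_adjoint hP hdiss.dense] at h1
      rw [← ContinuousLinearMap.adjoint_adjoint C, h1, ContinuousLinearMap.adjoint_comp,
        ContinuousLinearMap.adjoint_adjoint]
    refine hdiss.exists_polynomiallyStable_addBounded hα (mul_pos hMR hM₀) hρ hR hM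
      (Nat.ceil_pos.2 hα) hβ hγ hβγ hBeq hCeq hB' hC' ?_
    calc ‖C'‖ * (M * ‖B'‖) ≤ κ * (M * κ) := by gcongr
      _ ≤ 1 / 2 := by linarith [sq κ, hκM]
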